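/- **Setting.** Let $(Y_\varepsilon)_{\varepsilon>0}$ be real random variables on a probability space. For $\varepsilon>0$ let $$\Lambda_\varepsilon(u):=\varepsilon\log\mathbb E\big[e^{uY_\varepsilon/\varepsilon}\big],\qquad u\in\mathcal D_\varepsilon:=\{u\in\mathbb R:\mathbb E[e^{uY_\varepsilon/\varepsilon}]<\infty\},$$ and assume that the limit $$\mathcal D_0:=\lim_{\varepsilon\downarrow0}\mathcal D_\varepsilon=\bigcup_{\varepsilon>0}\bigcap_{0<s\le\varepsilon}\mathcal D_s=\bigcap_{\varepsilon>0}\bigcup_{0<s\le\varepsilon}\mathcal D_s$$ exists; $\mathcal D_0^o$ is its interior. For complex $z$ write $\Re\Lambda_\varepsilon(z):=\varepsilon\log\big|\mathbb E[e^{zY_\varepsilon/\varepsilon}]\big|$ (equal to $-\infty$ if the expectation vanishes) and $\Re\Lambda_0(z):=\lim_{\varepsilon\downarrow0}\Re\Lambda_\varepsilon(z)$. **Assumptions on $(Y_\varepsilon)$.** 1. There are functions $\Lambda_0,\Lambda_1,\Lambda_2$ on $\mathcal D_0^o$ with $\Lambda_\varepsilon(u)=\Lambda_0(u)+\Lambda_1(u)\varepsilon+\Lambda_2(u)\varepsilon^2+\mathcal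 O(\varepsilon^3)$ as $\varepsilon\downarrow0$, uniformly for $u$ in compact subsets of $\mathcal D_0^o$. 2. For some $\varepsilon_0>0$ the map $(\varepsilon,u)\mapsto\Lambda_\varepsilon(u)$ is finite and of class $C^\infty$ on $(0,\varepsilon_0)\times\mathcal D_0^o$. 3. $0\in\mathcal D_0^o$. 4. $\Lambda_0$ is strictly convex on $\mathcal D_0^o$ and essentially smooth: it is differentiable on $\mathcal D_0^o$, and $|\Lambda_0'(u_n)|\to\infty$ for every sequence $(u_n)$ in $\mathcal D_0^o$ converging to a boundary point of $\mathcal D_0^o$. 5. (a) $\Re\Lambda_\varepsilon(p_r+\mathrm ip_i)=\Re\Lambda_0(p_r+\mathrm ip_i)+\mathcal O(\varepsilon)$ as $\varepsilon\downarrow0$, uniformly for $(p_r,p_i)$ in compact subsets of $(\mathcal D_0^o\setminus\{0\})\times\mathbb R$ (in particular $\Re\Lambda_\varepsilon$ is finite there for small $\varepsilon$). Moreover, for each $p_r\in\mathcal D_0^o\setminus\{0\}$: (b) the function $L:p_i\mapsto\Re\Lambda_0(p_r+\mathrm ip_i)$ on $\mathbb R$ has a unique maximum at $0$ and is bounded away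 from $L(0)$ as $|p_i|\to\infty$; (c) there are $\varepsilon_1,p^*>0$ and $M\in\mathbb R$ with $\Re\Lambda_\varepsilon(p_r+\mathrm ip_i)-\Re\Lambda_0(p_r+\mathrm ip_i)\le M\varepsilon$ for all $|p_i|\ge p^*$ and $0<\varepsilon\le\varepsilon_1$. **Notation.** Let $c\in\mathcal D_0^o$, $c\ge0$, and let $f\ge0$ be a function of $\varepsilon>0$ with $\varepsilon f(\varepsilon)=c+\mathcal O(\varepsilon)$ as $\varepsilon\downarrow0$. Write $\Lambda_{i,l}=\partial_u^l\Lambda_i$. For $k\in\Lambda_{0,1}(\mathcal D_0^o)$ let $u^*=u^*(k)$ be the unique point of $\mathcal D_0^o$ with $\Lambda_{0,1}(u^*)=k$, let $\Lambda^*(k)=\sup_{u\in\mathcal D_0^o}\{uk-\Lambda_0(u)\}$, and, with all $\Lambda_i,\Lambda_{i,l}$ evaluated at $u^*(k)$, let $$\bar A_c(k,\varepsilon)=\frac{c\sqrt\varepsilon\,1_{\{c>0\}}+\varepsilon^{3/2}f(\varepsilon)1_{\{c=0\}}}{u^*(u^*-c)\sqrt{2\pi\Lambda_{0,2}}},$$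 $$A_c(k,\varepsilon)=1+\Upsilon(c,k)\varepsilon+\frac{u^*(\varepsilon f(\varepsilon)-c)}{(u^*-c)c}1_{\{c>0\}}+\frac{\varepsilon f(\varepsilon)}{u^*}1_{\{c=0\}},$$ $$\Upsilon(c,k)=\Lambda_2-\frac{5\Lambda_{0,3}^2}{24\Lambda_{0,2}^3}+\frac{4\Lambda_{1,1}\Lambda_{0,3}+\Lambda_{0,4}}{8\Lambda_{0,2}^2}-\frac{\Lambda_{1,1}^2+\Lambda_{1,2}}{2\Lambda_{0,2}}-\frac{\Lambda_{0,3}}{2u^*\Lambda_{0,2}^2}-\frac{\Lambda_{0,3}}{2(u^*-c)\Lambda_{0,2}^2}-\frac{\Lambda_{1,1}(c-2u^*)+3}{u^*(u^*-c)\Lambda_{0,2}}-\frac{c^2}{(u^*)^2(u^*-c)^2\Lambda_{0,2}}.$$ **Claim.** For every $k\in\Lambda_{0,1}(\mathcal D_0^o)\setminus\{\Lambda_{0,1}(0),\Lambda_{0,1}(c)\}$ (that is, every $k\in\mathbb R\setminus\{\Lambda_{0,1}(0),\Lambda_{0,1}(c)\}$ when $\Lambda_{0,1}$ maps $\mathcal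 D_0^o$ onto $\mathbb R$), for all sufficiently small $\varepsilon>0$ one has $\varepsilon f(\varepsilon)\in\mathcal D_\varepsilon$, the call payoff is integrable, and, as $\varepsilon\downarrow0$, $$\mathbb E\big(e^{Y_\varepsilon f(\varepsilon)}-e^{kf(\varepsilon)}\big)^+=e^{\Lambda_\varepsilon(\varepsilon f(\varepsilon))/\varepsilon}1_{\{k<\Lambda_{0,1}(c)\}}-e^{kf(\varepsilon)}1_{\{k<\Lambda_{0,1}(0)\}}+e^{-\Lambda^*(k)/\varepsilon+kf(\varepsilon)+\Lambda_1(u^*(k))}\,\bar A_c(k,\varepsilon)\big[A_c(k,\varepsilon)+\mathcal O(\varepsilon^2)\big].$$ -/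

import Mathlib

open Real Set Filter Topology MeasureTheory ProbabilityTheory Asymptotics

noncomputable section

namespace SharpOption

variable {Ω : Type*} [MeasurableSpace Ω]

/-- Re-normalised logarithmic moment generating function
`Λ_ε(u) = ε log E[exp (u Y_ε / ε)]` (meaningful for `u ∈ dom P Y ε`). -/
def lmgf (P : Measure Ω) (Y : ℝ → Ω → ℝ) (ε u : ℝ) : ℝ :=
  ε * Real.log (∫ ω, Real.exp (u * Y ε ω / ε) ∂P)

/-- The effective domain `D_ε` of `Λ_ε`: the `u` with `E[exp (u Y_ε / ε)] < ∞`. -/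
def dom (P : Measure Ω) (Y : ℝ → Ω → ℝ) (ε : ℝ) : Set ℝ :=
  {u | Integrable (fun ω => Real.exp (u * Y ε ω / ε)) P}

/-- `liminf_{ε ↓ 0} D_ε = ⋃_{ε > 0} ⋂_{0 < s ≤ ε} D_s`. -/
def domLiminf (P : Measure Ω) (Y : ℝ → Ω → ℝ) : Set ℝ :=
  ⋃ ε ∈ Ioi (0 : ℝ), ⋂ s ∈ Ioc (0 : ℝ) ε, dom P Y s

/-- `limsup_{ε ↓ 0} D_ε = ⋂_{ε > 0} ⋃_{0 < s ≤ ε} D_s`. -/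
def domLimsup (P : Measure Ω) (Y : ℝ → Ω → ℝ) : Set ℝ :=
  ⋂ ε ∈ Ioi (0 : ℝ), ⋃ s ∈ Ioc (0 : ℝ) ε, dom P Y s

/-- The interior of `D_0 = lim_{ε ↓ 0} D_ε` (that the limit exists, i.e. that the lower and the
upper limit agree, is a field of `Admissible`). -/
def domZeroInt (P : Measure Ω) (Y : ℝ → Ω → ℝ) : Set ℝ :=
  interior (domLiminf P Y)

/-- The moment generating function at complex arguments, `E[exp (z Y_ε / ε)]`. -/
def cmgf (P : Measure Ω) (Y : ℝ → Ω → ℝ) (ε : ℝ) (z : ℂ) : ℂ :=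
  ∫ ω, Complex.exp (z * (Y ε ω : ℂ) / (ε : ℂ)) ∂P

/-- `Re Λ_ε(z) = ε log |E[exp (z Y_ε / ε)]|` for complex `z`
(meaningful where the expectation does not vanish). -/
def reLmgf (P : Measure Ω) (Y : ℝ → Ω → ℝ) (ε : ℝ) (z : ℂ) : ℝ :=
  ε * Real.log ‖cmgf P Y ε z‖

/-- `Re Λ_0(z) = lim_{ε ↓ 0} Re Λ_ε(z)` for complex `z`. It is only used together with the
first tail condition below, which forces the limit to exist. -/
def reLmgfZero (P : Measure Ω) (Y : ℝ → Ω → ℝ) (z : ℂ) : ℝ :=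
  limUnder (𝓝[>] (0 : ℝ)) (fun ε => reLmgf P Y ε z)

/-- A function `h` is essentially smooth on the open set `U`: `U` is non-empty, `h` is
differentiable on `U`, and `|h'(u_n)| → ∞` along every sequence in `U` converging to a boundary
point of `U`. -/
structure EssentiallySmoothOn (U : Set ℝ) (h : ℝ → ℝ) : Prop where
  nonempty : U.Nonempty
  differentiable : ∀ u ∈ U, DifferentiableAt ℝ h u
  steep : ∀ (v : ℕ → ℝ) (a : ℝ), (∀ n, v n ∈ U) → a ∈ frontier U → Tendsto v atTop (𝓝 a) →
    Tendsto (fun n => |deriv h (v n)|) atTop atTop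

/-- The tail error control. All error terms are uniform on compact sets. -/
structure TailControl (P : Measure Ω) (Y : ℝ → Ω → ℝ) : Prop where
  /-- `Re Λ_ε(p_r + i p_i) = Re Λ_0(p_r + i p_i) + O(ε)`, for `p_r ∈ D_0ᵒ \ {0}`; part of the
  assertion is that `Λ_ε` is finite there for small `ε`. -/
  approx : ∀ K : Set ℂ, IsCompact K → (∀ z ∈ K, z.re ∈ domZeroInt P Y ∧ z.re ≠ 0) →
    ∃ C : ℝ, ∃ ε₁ > 0, ∀ ε ∈ Ioo (0 : ℝ) ε₁, ∀ z ∈ K,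
      cmgf P Y ε z ≠ 0 ∧ |reLmgf P Y ε z - reLmgfZero P Y z| ≤ C * ε
  /-- `L(p_i) = Re Λ_0(p_r + i p_i)` has a unique maximum at zero. -/
  unique_max : ∀ pr ∈ domZeroInt P Y, pr ≠ 0 → ∀ p : ℝ, p ≠ 0 →
    reLmgfZero P Y ⟨pr, p⟩ < reLmgfZero P Y ⟨pr, 0⟩
  /-- Moreover `L` is bounded away from `L(0)` as `|p_i| → ∞`. -/
  away : ∀ pr ∈ domZeroInt P Y, pr ≠ 0 → ∃ δ > 0, ∃ R : ℝ, ∀ p : ℝ, R ≤ |p| →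
    reLmgfZero P Y ⟨pr, p⟩ ≤ reLmgfZero P Y ⟨pr, 0⟩ - δ
  /-- `Re (Λ_ε - Λ_0)(p_r + i p_i) ≤ M ε` for all large `|p_i|` and small `ε`; there is nothing
  to require where the expectation vanishes, the real part of its logarithm being `-∞`. -/
  tail : ∀ pr ∈ domZeroInt P Y, pr ≠ 0 → ∃ ε₁ > 0, ∃ pstar > 0, ∃ M : ℝ,
    ∀ p : ℝ, pstar ≤ |p| → ∀ ε ∈ Ioc (0 : ℝ) ε₁, cmgf P Y ε ⟨pr, p⟩ ≠ 0 →
      reLmgf P Y ε ⟨pr, p⟩ - reLmgfZero P Y ⟨pr, p⟩ ≤ M * ε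

/-- The standing assumptions on the process `(Y_ε)`; `Λ₀, Λ₁, Λ₂` are the coefficients of the
expansion of `Λ_ε` on the interior of `D_0` (which determines them there). -/
structure Admissible (P : Measure Ω) (Y : ℝ → Ω → ℝ) (Λ₀ Λ₁ Λ₂ : ℝ → ℝ) : Prop where
  /-- the limit `D_0` of the domains exists -/
  dom_lim : domLiminf P Y = domLimsup P Y
  /-- expansion property, with error uniform on compact sets -/
  expansion : ∀ K : Set ℝ, IsCompact K → K ⊆ domZeroInt P Y →
    ∃ C : ℝ, ∃ ε₁ > 0, ∀ ε ∈ Ioo (0 : ℝ) ε₁, ∀ u ∈ K,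
      |lmgf P Y ε u - (Λ₀ u + Λ₁ u * ε + Λ₂ u * ε ^ 2)| ≤ C * ε ^ 3
  /-- `(ε, u) ↦ Λ_ε(u)` is finite and of class `C^∞` on `(0, ε₀) × D_0ᵒ` -/
  smooth : ∃ ε₀ > 0, (∀ ε ∈ Ioo (0 : ℝ) ε₀, domZeroInt P Y ⊆ dom P Y ε) ∧
    ContDiffOn ℝ ((⊤ : ℕ∞) : WithTop ℕ∞) (fun p : ℝ × ℝ => lmgf P Y p.1 p.2) (Ioo (0 : ℝ) ε₀ ×ˢ domZeroInt P Y)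
  /-- non-degenerate interior -/
  zero_mem : (0 : ℝ) ∈ domZeroInt P Y
  /-- strict convexity and essential smoothness -/
  strictConvex : StrictConvexOn ℝ (domZeroInt P Y) Λ₀
  essSmooth : EssentiallySmoothOn (domZeroInt P Y) Λ₀
  /-- tail error control -/
  tail : TailControl P Y

/-- The saddlepoint `u*(k)`: the solution in `U` of `Λ₀'(u) = k` (for `k ∈ Λ₀'(U)`;
unique when `Λ₀` is strictly convex on `U`). -/
def uStar (U : Set ℝ) (Λ₀ : ℝ → ℝ) (k : ℝ) : ℝ :=
  Function.invFunOn (deriv Λ₀) U k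

/-- The Fenchel-Legendre transform `Λ*(k) = sup_u (u k - Λ₀(u))`. The supremum is over the interior
`U` of `D_0`, where `Λ₀` is given; by convexity boundary points of `D_0` do not change it. -/
def legendre (U : Set ℝ) (Λ₀ : ℝ → ℝ) (k : ℝ) : ℝ :=
  sSup ((fun u => u * k - Λ₀ u) '' U)

/-- `Υ(b, k)`, written as a function of `b` and of the saddlepoint `u = u*(k)`. -/
def Upsilon (Λ₀ Λ₁ Λ₂ : ℝ → ℝ) (b u : ℝ) : ℝ :=
  let L02 := iteratedDeriv 2 Λ₀ u
  let L03 := iteratedDeriv 3 Λ₀ u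
  let L04 := iteratedDeriv 4 Λ₀ u
  let L11 := iteratedDeriv 1 Λ₁ u
  let L12 := iteratedDeriv 2 Λ₁ u
  Λ₂ u - 5 * L03 ^ 2 / (24 * L02 ^ 3) + (4 * L11 * L03 + L04) / (8 * L02 ^ 2)
    - (L11 ^ 2 + L12) / (2 * L02)
    - L03 / (2 * u * L02 ^ 2) - L03 / (2 * (u - b) * L02 ^ 2)
    - (L11 * (b - 2 * u) + 3) / (u * (u - b) * L02)
    - b ^ 2 / (u ^ 2 * (u - b) ^ 2 * L02)

/-- The prefactor `Ā_b(k, ε)`, as a function of the saddlepoint `u = u*(k)`. -/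
def Abar (Λ₀ : ℝ → ℝ) (f : ℝ → ℝ) (b u ε : ℝ) : ℝ :=
  ((if 0 < b then b * √ε else 0) + (if b = 0 then ε ^ (3 / 2 : ℝ) * f ε else 0)) /
    (u * (u - b) * √(2 * π * iteratedDeriv 2 Λ₀ u))

/-- The first-order factor `A_b(k, ε)`, as a function of the saddlepoint `u = u*(k)`. -/
def Afac (Λ₀ Λ₁ Λ₂ : ℝ → ℝ) (f : ℝ → ℝ) (b u ε : ℝ) : ℝ :=
  1 + Upsilon Λ₀ Λ₁ Λ₂ b u * ε
    + (if 0 < b then u * (ε * f ε - b) / ((u - b) * b) else 0)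
    + (if b = 0 then ε * f ε / u else 0)

end SharpOption

end

/-! Write b = f(ε)ε and u = u*(k). Remove from the payoff the exponentials that stop it from
decaying after weighting by the dual exponential at u: the term e^{Yf} when u < b, and the constant
e^{kf} when u < 0. The remainder has transform b / ((u+iy)(u-b+iy)) along the line Re z = u. Fourier
inversion and Fubini then give the price as these explicit terms plus e^{kf}/(2π) times the integral
over y of this kernel against E[e^{(u+iy)Y/ε}] e^{-(u+iy)k/ε} (`integral_payoff_eq`). Since Λ₀'(u) =
k, the line passes through the saddlepoint, and the integral is evaluated by Laplace's method with t
= √ε.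

Away from y = 0 the tail hypotheses make the integrand exponentially smaller than at the saddle
(`Admissible.exists_far_bound`). Near y = 0 an expansion of the logarithm at complex arguments is
needed, whereas the O(ε³) expansion is assumed only on the real axis; off the axis only the real
part is known, and only up to O(ε). `exists_holomorphic_expansion` bridges this gap.
Borel–Carathéodory gives a holomorphic limit G₀ with rate O(ε). The first difference quotients are
bounded on a disc and differ by O(ε + ε') on the diameter, so a two constants estimate makes them
converge to a holomorphic G₁ at rate ε^{3/4}. The second quotients H are then O(ε^{-1/4}) on a disc
and known up to O(ε) on the diameter; a second interpolation gives increments O(√ε) from ε to ε/2,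
and summing these dyadically shows that H is bounded. This is enough, because Laplace's method needs
H only up to O(ε) at the centre and bounded elsewhere.

The saddle is nondegenerate although strict convexity alone allows Λ₀'' = 0: the inequality |E
e^{zY}| ≤ E e^{(Re z)Y} passes to the limit as Re G₀ ≤ Λ₀ on vertical lines, and a non-affine
function with this property has a positive second derivative (`iteratedDeriv_two_re_pos`).

After scaling y = √ε x the integrand is a Gaussian times a function expanded to order t⁴. Odd powers
of t integrate to zero, so the relative error is O(ε²), and the coefficient of ε is Υ
(`Upsilon_eq`). All estimates are uniform for b near c, which permits b = f(ε)ε; expanding the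
b-dependent prefactor about c produces the last terms of A_c (`isBigO_price_remainder`). -/

noncomputable section

/-! ### Two constants estimates, holomorphic limits and logarithms on a disc -/

namespace SharpOption

/-- Two constants estimate for a half-disc. -/
theorem norm_le_two_constants_upper {f : ℂ → ℂ} {R B η : ℝ} (hR : 0 < R)
    (hf : DifferentiableOn ℂ f (Metric.ball 0 R)) (hη : 0 < η) (hηB : η ≤ B)
    (hB : ∀ z ∈ Metric.ball (0 : ℂ) R, ‖f z‖ ≤ B)
    (hreal : ∀ x : ℝ, |x| < R → ‖f x‖ ≤ η)
    {z : ℂ} (hz : ‖z‖ ≤ R / 12) (hzi : 0 ≤ z.im) :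
    ‖f z‖ ≤ η ^ (3 / 4 : ℝ) * B ^ (1 / 4 : ℝ) := by
  have hBpos : 0 < B := hη.trans_le hηB
  set L : ℝ := Real.log (B / η) with hL
  have hL0 : 0 ≤ L := Real.log_nonneg (by rw [le_div_iff₀ hη]; linarith)
  set r : ℝ := 11 * R / 12 with hr
  have hr0 : 0 < r := by positivity
  have hrR : r < R := by rw [hr]; linarith
  -- An explicit exponent stands in for harmonic measure. With z/r = x + iy, the real part of (z/r)²
  -- - 2i(z/r) is x² - y² + 2y, which is nonnegative on the diameter and equals 1 + 2y(1-y) ≥ 1 on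
  -- the arc. So the damping factor is at most 1 on the diameter and at most η/B on the arc, and the
  -- maximum principle on the half-disc gives η inside.
  have key : ∀ z : ℂ, ‖z‖ ≤ r → 0 ≤ z.im →
      ‖f z * Complex.exp (-(L : ℂ) * ((z / r) ^ 2 - 2 * Complex.I * (z / r)))‖ ≤ η := by
    intro z hz hzi
    set U : Set ℂ := Metric.ball 0 r ∩ {z | 0 < z.im} with hU
    have hUo : IsOpen U := Metric.isOpen_ball.inter (isOpen_lt continuous_const Complex.continuous_im)
    have hUcl : closure U ⊆ {z | ‖z‖ ≤ r ∧ 0 ≤ z.im} := by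
      apply closure_minimal
      · rintro z ⟨h1, h2⟩
        exact ⟨by simpa using (mem_ball_zero_iff.1 h1).le, le_of_lt h2⟩
      · exact (isClosed_le continuous_norm continuous_const).inter
          (isClosed_le continuous_const Complex.continuous_im)
    have hconv : Convex ℝ U := (convex_ball 0 r).inter (convex_halfSpace_im_gt 0)
    have hcl : z ∈ closure U := by
      have hp : (⟨0, r / 2⟩ : ℂ) ∈ U := by
        constructor
        · rw [mem_ball_zero_iff, show (⟨0, r / 2⟩ : ℂ) = ((r / 2 : ℝ) : ℂ) * Complex.I by
            apply Complex.ext <;> simp]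
          rw [norm_mul, Complex.norm_I, Complex.norm_real, Real.norm_eq_abs, abs_of_pos (by positivity)]
          linarith
        · change 0 < r / 2
          positivity
      have hlim : Tendsto (fun t : ℝ => z + (t : ℂ) * (⟨0, r / 2⟩ - z)) (𝓝[>] 0) (𝓝 z) := by
        have : Continuous (fun t : ℝ => z + (t : ℂ) * (⟨0, r / 2⟩ - z)) := by fun_prop
        have h := this.tendsto 0
        simp only [Complex.ofReal_zero, zero_mul, add_zero] at h
        exact h.mono_left nhdsWithin_le_nhds
      refine mem_closure_of_tendsto hlim ?_
      filter_upwards [Ioo_mem_nhdsGT (zero_lt_one' ℝ)] with t ht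
      have hpn := mem_ball_zero_iff.1 hp.1
      constructor
      · rw [mem_ball_zero_iff]
        calc ‖z + (t : ℂ) * (⟨0, r / 2⟩ - z)‖ = ‖((1 - t : ℝ) : ℂ) * z + (t : ℂ) * ⟨0, r / 2⟩‖ := by
              congr 1; push_cast; ring
          _ ≤ (1 - t) * ‖z‖ + t * ‖(⟨0, r / 2⟩ : ℂ)‖ := by
              refine (norm_add_le _ _).trans_eq ?_
              rw [norm_mul, norm_mul, Complex.norm_real, Complex.norm_real, Real.norm_eq_abs,
                Real.norm_eq_abs, abs_of_pos ht.1, abs_of_pos (by linarith [ht.2])]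
          _ < r := by nlinarith [ht.1, ht.2]
      · change 0 < (z + (t : ℂ) * (⟨0, r / 2⟩ - z)).im
        simp only [Complex.add_im, Complex.mul_im, Complex.ofReal_re, Complex.sub_im,
          Complex.ofReal_im, zero_mul, add_zero]
        nlinarith [ht.1, ht.2]
    have hsub : {z : ℂ | ‖z‖ ≤ r ∧ 0 ≤ z.im} ⊆ Metric.ball 0 R := fun z hz => by
      rw [mem_ball_zero_iff]; exact hz.1.trans_lt hrR
    have hd : DiffContOnCl ℂ (fun z => f z * Complex.exp (-(L : ℂ) * ((z / r) ^ 2 - 2 * Complex.I * (z / r)))) U := by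
      have : DifferentiableOn ℂ (fun z => f z * Complex.exp (-(L : ℂ) * ((z / r) ^ 2 - 2 * Complex.I * (z / r)))) (Metric.ball 0 R) :=
        hf.mul (by fun_prop)
      exact (this.mono (hUcl.trans hsub)).diffContOnCl
    refine Complex.norm_le_of_forall_mem_frontier_norm_le
      ((Metric.isBounded_ball (x := (0 : ℂ)) (r := r)).subset inter_subset_left) hd ?_ hcl
    intro w hw
    have hwc := hUcl (frontier_subset_closure hw)
    have hwU : w ∉ U := by
      rw [hUo.frontier_eq] at hw; exact hw.2
    rw [norm_mul, Complex.norm_exp]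
    have hre : (-(L : ℂ) * ((w / r) ^ 2 - 2 * Complex.I * (w / r))).re =
        -L * ((w.re / r) ^ 2 - (w.im / r) ^ 2 + 2 * (w.im / r)) := by
      have h1 : (w / (r : ℂ)).re = w.re / r := by simp [Complex.div_ofReal_re]
      have h2 : (w / (r : ℂ)).im = w.im / r := by simp [Complex.div_ofReal_im]
      generalize w / (r : ℂ) = v at h1 h2
      rw [← h1, ← h2]
      simp [pow_two]
    rw [hre]
    by_cases him : w.im = 0
    · have hwr : w = (w.re : ℂ) := by apply Complex.ext <;> simp [him]
      have h1 : ‖f w‖ ≤ η := by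
        rw [hwr]
        apply hreal
        have := (Complex.abs_re_le_norm w).trans hwc.1
        linarith
      have h2 : Real.exp (-L * ((w.re / r) ^ 2 - (w.im / r) ^ 2 + 2 * (w.im / r))) ≤ 1 := by
        rw [him, Real.exp_le_one_iff]
        simp
        positivity
      calc _ ≤ η * 1 := by gcongr
        _ = η := mul_one _
    · have himp : 0 < w.im := lt_of_le_of_ne hwc.2 (Ne.symm him)
      have hnorm : ‖w‖ = r := by
        apply le_antisymm hwc.1
        by_contra! h
        exact hwU ⟨by simpa using h, himp⟩
      have hsq : (w.re / r) ^ 2 + (w.im / r) ^ 2 = 1 := by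
        have h3 := Complex.sq_norm w
        rw [Complex.normSq_apply, hnorm] at h3
        field_simp
        linarith
      have himr : w.im / r ≤ 1 := by
        rw [div_le_one hr0, ← hnorm]
        exact (le_abs_self _).trans (Complex.abs_im_le_norm w)
      have himr0 : 0 ≤ w.im / r := by positivity
      have h4 : 1 ≤ (w.re / r) ^ 2 - (w.im / r) ^ 2 + 2 * (w.im / r) := by nlinarith
      have h5 : Real.exp (-L * ((w.re / r) ^ 2 - (w.im / r) ^ 2 + 2 * (w.im / r))) ≤ η / B := by
        rw [← Real.exp_log (show 0 < η / B by positivity)]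
        apply Real.exp_le_exp.2
        have : Real.log (η / B) = -L := by
          rw [hL, ← Real.log_inv, inv_div]
        rw [this]
        nlinarith
      calc _ ≤ B * (η / B) := by
            gcongr
            exact hB w (hsub hwc)
        _ = η := by field_simp
  have hzr : ‖z‖ ≤ r := by rw [hr]; linarith
  have h := key z hzr hzi
  rw [norm_mul, Complex.norm_exp] at h
  -- Here ‖z/r‖ ≤ 1/11, so the exponent has modulus at most L/4; undoing the damping costs only
  -- (B/η)^{1/4}.
  have hre : -(L / 4) ≤ (-(L : ℂ) * ((z / r) ^ 2 - 2 * Complex.I * (z / r))).re := by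
    have hn : ‖z / (r : ℂ)‖ ≤ 1 / 11 := by
      rw [norm_div, Complex.norm_real, Real.norm_eq_abs, abs_of_pos hr0, div_le_iff₀ hr0, hr]
      linarith
    have h1 : ‖(z / (r : ℂ)) ^ 2 - 2 * Complex.I * (z / r)‖ ≤ 1 / 4 := by
      refine (norm_sub_le _ _).trans ?_
      rw [norm_pow, norm_mul, norm_mul, Complex.norm_I]
      simp only [Complex.norm_ofNat, mul_one]
      nlinarith [norm_nonneg (z / (r : ℂ))]
    have h2 := (abs_le.1 (Complex.abs_re_le_norm (-(L : ℂ) * ((z / r) ^ 2 - 2 * Complex.I * (z / r))))).1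
    refine le_trans ?_ h2
    rw [norm_mul, norm_neg, Complex.norm_real, Real.norm_eq_abs, abs_of_nonneg hL0]
    nlinarith
  have h6 : Real.exp (-(L / 4)) = η ^ (1 / 4 : ℝ) * (B ^ (1 / 4 : ℝ))⁻¹ := by
    rw [hL, Real.log_div hBpos.ne' hη.ne', Real.rpow_def_of_pos hη, Real.rpow_def_of_pos hBpos,
      ← Real.exp_neg, ← Real.exp_add]
    congr 1; ring
  have h7 : ‖f z‖ * (η ^ (1 / 4 : ℝ) * (B ^ (1 / 4 : ℝ))⁻¹) ≤ η := by
    rw [← h6]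
    refine le_trans ?_ h
    gcongr
  have hη4 : 0 < η ^ (1 / 4 : ℝ) := by positivity
  have hB4 : 0 < B ^ (1 / 4 : ℝ) := by positivity
  have h8 : η ^ (3 / 4 : ℝ) * η ^ (1 / 4 : ℝ) = η := by
    rw [← Real.rpow_add hη]; norm_num
  have h9 : ‖f z‖ * η ^ (1 / 4 : ℝ) ≤ (η ^ (3 / 4 : ℝ) * B ^ (1 / 4 : ℝ)) * η ^ (1 / 4 : ℝ) := by
    calc ‖f z‖ * η ^ (1 / 4 : ℝ) = ‖f z‖ * (η ^ (1 / 4 : ℝ) * (B ^ (1 / 4 : ℝ))⁻¹) * B ^ (1 / 4 : ℝ) := by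
          field_simp
      _ ≤ η * B ^ (1 / 4 : ℝ) := by gcongr
      _ = _ := by
          calc η * B ^ (1 / 4 : ℝ) = (η ^ (3 / 4 : ℝ) * η ^ (1 / 4 : ℝ)) * B ^ (1 / 4 : ℝ) := by rw [h8]
            _ = _ := by ring
  exact le_of_mul_le_mul_right h9 hη4

/-- Two constants estimate: a holomorphic function on a disc which is small on the real diameter is
small on a smaller concentric disc. -/
theorem norm_le_two_constants {f : ℂ → ℂ} {R B η : ℝ} (hR : 0 < R)
    (hf : DifferentiableOn ℂ f (Metric.ball 0 R)) (hη : 0 < η) (hηB : η ≤ B)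
    (hB : ∀ z ∈ Metric.ball (0 : ℂ) R, ‖f z‖ ≤ B)
    (hreal : ∀ x : ℝ, |x| < R → ‖f x‖ ≤ η)
    {z : ℂ} (hz : z ∈ Metric.ball (0 : ℂ) (R / 12)) :
    ‖f z‖ ≤ η ^ (3 / 4 : ℝ) * B ^ (1 / 4 : ℝ) := by
  have hz' : ‖z‖ ≤ R / 12 := (mem_ball_zero_iff.1 hz).le
  rcases le_total 0 z.im with h | h
  · exact norm_le_two_constants_upper hR hf hη hηB hB hreal hz' h
  -- The lower half-disc is reduced to the upper one by z ↦ -z, which preserves the real diameter.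
  · have hneg : MapsTo (fun z : ℂ => -z) (Metric.ball 0 R) (Metric.ball 0 R) := fun w hw => by
      simpa using hw
    have := norm_le_two_constants_upper (f := fun z => f (-z)) hR
      (hf.comp (by fun_prop) hneg) hη hηB (fun w hw => hB _ (hneg hw))
      (fun x hx => by simpa using hreal (-x) (by simpa using hx)) (z := -z) (by simpa using hz')
      (by simpa using h)
    simpa using this

/-- Uniform Cauchy limits of holomorphic families are holomorphic. -/
theorem exists_holomorphic_limit {F : ℝ → ℂ → ℂ} {R ε₁ : ℝ} {w : ℝ → ℝ} (hε₁ : 0 < ε₁)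
    (hF : ∀ ε ∈ Ioo 0 ε₁, DifferentiableOn ℂ (F ε) (Metric.ball 0 R))
    (hw : Tendsto w (𝓝[>] 0) (𝓝 0))
    (hc : ∀ ε ∈ Ioo 0 ε₁, ∀ ε' ∈ Ioo 0 ε₁, ∀ z ∈ Metric.ball (0 : ℂ) R,
      ‖F ε z - F ε' z‖ ≤ w ε + w ε') :
    ∃ G : ℂ → ℂ, DifferentiableOn ℂ G (Metric.ball 0 R) ∧
      ∀ ε ∈ Ioo 0 ε₁, ∀ z ∈ Metric.ball (0 : ℂ) R, ‖F ε z - G z‖ ≤ w ε := by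
  have hmem : ∀ᶠ ε in 𝓝[>] (0 : ℝ), ε ∈ Ioo 0 ε₁ := Ioo_mem_nhdsGT hε₁
  have hlim : ∀ z ∈ Metric.ball (0 : ℂ) R, ∃ l, Tendsto (fun ε => F ε z) (𝓝[>] 0) (𝓝 l) := by
    intro z hz
    refine cauchy_map_iff_exists_tendsto.1 ?_
    rw [Metric.cauchy_iff]
    refine ⟨inferInstance, fun δ hδ => ?_⟩
    have hwδ : ∀ᶠ ε in 𝓝[>] (0 : ℝ), w ε < δ / 2 := hw.eventually_lt_const (by positivity)
    refine ⟨(fun ε => F ε z) '' {ε | ε ∈ Ioo 0 ε₁ ∧ w ε < δ / 2}, image_mem_map (hmem.and hwδ), ?_⟩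
    rintro _ ⟨a, ⟨ha, ha'⟩, rfl⟩ _ ⟨b, ⟨hb, hb'⟩, rfl⟩
    rw [dist_eq_norm]
    linarith [hc a ha b hb z hz]
  choose! G hG using hlim
  have hbound : ∀ ε ∈ Ioo 0 ε₁, ∀ z ∈ Metric.ball (0 : ℂ) R, ‖F ε z - G z‖ ≤ w ε := by
    intro ε hε z hz
    have h1 : Tendsto (fun ε' => ‖F ε z - F ε' z‖) (𝓝[>] 0) (𝓝 ‖F ε z - G z‖) :=
      (tendsto_const_nhds.sub (hG z hz)).norm
    have h2 : Tendsto (fun ε' => w ε + w ε') (𝓝[>] 0) (𝓝 (w ε + 0)) := tendsto_const_nhds.add hw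
    rw [add_zero] at h2
    refine le_of_tendsto_of_tendsto h1 h2 ?_
    filter_upwards [hmem] with ε' hε'
    exact hc ε hε ε' hε' z hz
  refine ⟨G, ?_, hbound⟩
  have hunif : TendstoUniformlyOn F G (𝓝[>] 0) (Metric.ball 0 R) := by
    rw [Metric.tendstoUniformlyOn_iff]
    intro δ hδ
    filter_upwards [hmem, hw.eventually_lt_const hδ] with ε hε hδ' z hz
    rw [dist_comm, dist_eq_norm]
    exact (hbound ε hε z hz).trans_lt hδ'
  exact hunif.tendstoLocallyUniformlyOn.differentiableOn (hmem.mono hF) Metric.isOpen_ball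

/-- On a disc, a nonvanishing holomorphic function which is positive on the reals has a holomorphic
logarithm which is real on the reals. -/
theorem exists_log_branch {M : ℂ → ℂ} {m : ℝ → ℝ} {R : ℝ} (hR : 0 < R)
    (hM : DifferentiableOn ℂ M (Metric.ball 0 R)) (hM0 : ∀ z ∈ Metric.ball (0 : ℂ) R, M z ≠ 0)
    (hm : ∀ x : ℝ, |x| < R → M x = m x ∧ 0 < m x) :
    ∃ F : ℂ → ℂ, DifferentiableOn ℂ F (Metric.ball 0 R) ∧
      (∀ z ∈ Metric.ball (0 : ℂ) R, Complex.exp (F z) = M z) ∧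
      ∀ x : ℝ, |x| < R → F x = (Real.log (m x) : ℂ) := by
  have hopen : IsOpen (Metric.ball (0 : ℂ) R) := Metric.isOpen_ball
  have h0 : (0 : ℂ) ∈ Metric.ball (0 : ℂ) R := Metric.mem_ball_self hR
  -- The logarithm is the primitive of M'/M whose value at 0 is real.
  have hq : DifferentiableOn ℂ (fun z => deriv M z / M z) (Metric.ball 0 R) :=
    (hM.deriv hopen).div hM hM0
  obtain ⟨F, hF, hF'⟩ := hq.isExactOn_ball.with_val_at 0 (Real.log (m 0) : ℂ)
  have hd : DifferentiableOn ℂ F (Metric.ball 0 R) :=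
    fun z hz => (hF' z hz).differentiableAt.differentiableWithinAt
  have hm0 := hm 0 (by simpa using hR)
  have hexp : ∀ z ∈ Metric.ball (0 : ℂ) R, Complex.exp (F z) = M z := by
    have hconst : ∀ z ∈ Metric.ball (0 : ℂ) R, HasDerivAt (fun z => Complex.exp (-F z) * M z) 0 z := by
      intro z hz
      have h1 := ((hF' z hz).neg.cexp).mul
        ((hM z hz).differentiableAt (hopen.mem_nhds hz)).hasDerivAt
      have h5 : deriv M z / M z * M z = deriv M z := div_mul_cancel₀ _ (hM0 z hz)
      have h6 : Complex.exp (-F z) * -(deriv M z / M z) * M z + Complex.exp (-F z) * deriv M z = 0 := by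
        linear_combination -Complex.exp (-F z) * h5
      exact h1.congr_deriv h6
    intro z hz
    have h2 : Complex.exp (-F z) * M z = Complex.exp (-F 0) * M 0 :=
      (convex_ball (0 : ℂ) R).is_const_of_fderivWithin_eq_zero (𝕜 := ℂ)
        (fun w hw => (hconst w hw).differentiableAt.differentiableWithinAt)
        (fun w hw => by
          rw [fderivWithin_of_isOpen hopen hw]
          ext; simp [(hconst w hw).deriv]) hz h0
    have h3 : Complex.exp (-F 0) * M 0 = 1 := by
      have h4 := hm0.1
      rw [Complex.ofReal_zero] at h4
      rw [hF, h4, ← Complex.ofReal_neg, ← Complex.ofReal_exp, Real.exp_neg, Real.exp_log hm0.2,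
        ← Complex.ofReal_mul, inv_mul_cancel₀ hm0.2.ne', Complex.ofReal_one]
    rw [h3, Complex.exp_neg] at h2
    field_simp at h2
    exact h2.symm
  refine ⟨F, hd, hexp, ?_⟩
  intro x hx
  have hball : ∀ y : ℝ, y ∈ uIcc 0 x → (y : ℂ) ∈ Metric.ball (0 : ℂ) R := by
    intro y hy
    rw [mem_ball_zero_iff, Complex.norm_real, Real.norm_eq_abs]
    have := abs_sub_left_of_mem_uIcc hy
    simp only [sub_zero] at this
    exact this.trans_lt hx
  have hint : ∀ y : ℝ, y ∈ uIcc 0 x → ∃ n : ℤ, F y = (Real.log (m y) : ℂ) + n * (2 * π * Complex.I) := by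
    intro y hy
    have hyb := hball y hy
    have hy' : |y| < R := by simpa using hyb
    obtain ⟨h1, h2⟩ := hm y hy'
    apply Complex.exp_eq_exp_iff_exists_int.1
    rw [hexp _ hyb, h1, ← Complex.ofReal_exp, Real.exp_log h2]
  have him : ∀ y : ℝ, y ∈ uIcc 0 x → ∀ n : ℤ, F y = (Real.log (m y) : ℂ) + n * (2 * π * Complex.I) →
      (F y).im = n * (2 * π) := by
    intro y hy n hn
    rw [hn]; simp
  obtain ⟨n, hn⟩ := hint x right_mem_uIcc
  have hn' := him x right_mem_uIcc n hn
  have hcont : ContinuousOn (fun y : ℝ => (F y).im) (uIcc 0 x) :=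
    Complex.continuous_im.comp_continuousOn
      (hd.continuousOn.comp Complex.continuous_ofReal.continuousOn hball)
  have hiv := intermediate_value_uIcc hcont
  have hF0 : (F ((0 : ℝ) : ℂ)).im = 0 := by rw [Complex.ofReal_zero, hF]; simp
  -- Along the real segment Im F is continuous, takes values in 2πℤ and starts at 0. A nonzero end
  -- value would force the intermediate value π or -π.
  have hnz : n = 0 := by
    by_contra hne
    have hmem : ((n.sign : ℝ) * π) ∈ uIcc (F ((0 : ℝ) : ℂ)).im (F (x : ℂ)).im := by
      rw [hF0, hn', mem_uIcc]
      rcases lt_or_gt_of_ne hne with h | h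
      · right
        rw [Int.sign_eq_neg_one_of_neg h]
        have : (n : ℝ) ≤ -1 := by exact_mod_cast Int.le_sub_one_of_lt h
        push_cast
        constructor <;> nlinarith [Real.pi_pos]
      · left
        rw [Int.sign_eq_one_of_pos h]
        have : (1 : ℝ) ≤ n := by exact_mod_cast h
        push_cast
        constructor <;> nlinarith [Real.pi_pos]
    obtain ⟨y, hy, hy'⟩ := hiv hmem
    obtain ⟨j, hj⟩ := hint y hy
    have hj' := him y hy j hj
    simp only at hy'
    rw [hj'] at hy'
    have h5 : (2 * j : ℝ) = n.sign := by
      have := Real.pi_pos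
      apply mul_right_cancel₀ this.ne'
      linarith
    have h6 : 2 * j = n.sign := by exact_mod_cast h5
    rcases lt_or_gt_of_ne hne with h | h
    · rw [Int.sign_eq_neg_one_of_neg h] at h6; omega
    · rw [Int.sign_eq_one_of_pos h] at h6; omega
  rw [hn, hnz]; simp

end SharpOption

/-! ### From a real expansion to a holomorphic one -/

namespace SharpOption

/-- A holomorphic family with controlled real part which is real on the reals converges, at a linear
rate, on a smaller disc. -/
theorem exists_limit_of_re_le {F : ℝ → ℂ → ℂ} {R ε₁ C : ℝ} {r₀ : ℂ → ℝ} (hR : 0 < R)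
    (hε₁ : 0 < ε₁) (hC : 0 < C)
    (hF : ∀ ε ∈ Ioo 0 ε₁, DifferentiableOn ℂ (F ε) (Metric.ball 0 R))
    (hre : ∀ ε ∈ Ioo 0 ε₁, ∀ z ∈ Metric.ball (0 : ℂ) R, |(F ε z).re - r₀ z| ≤ C * ε)
    (hreal : ∀ ε ∈ Ioo 0 ε₁, (F ε 0).im = 0) :
    ∃ G : ℂ → ℂ, DifferentiableOn ℂ G (Metric.ball 0 (R / 2)) ∧
      ∀ ε ∈ Ioo 0 ε₁, ∀ z ∈ Metric.ball (0 : ℂ) (R / 2), ‖F ε z - G z‖ ≤ 5 * C * ε := by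
  have hsub : Metric.ball (0 : ℂ) (R / 2) ⊆ Metric.ball 0 R := Metric.ball_subset_ball (by linarith)
  refine exists_holomorphic_limit hε₁ (fun ε hε => (hF ε hε).mono hsub) ?_ ?_
  · have : Tendsto (fun ε : ℝ => 5 * C * ε) (𝓝 0) (𝓝 (5 * C * 0)) := by
      exact (continuous_const.mul continuous_id).tendsto 0
    rw [mul_zero] at this
    exact this.mono_left nhdsWithin_le_nhds
  · intro ε hε ε' hε' z hz
    set M : ℝ := C * (ε + ε') with hM
    have hMpos : 0 < M := mul_pos hC (by linarith [hε.1, hε'.1])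
    have hbd : ∀ w ∈ Metric.ball (0 : ℂ) R, |(F ε w - F ε' w).re| ≤ M := by
      intro w hw
      have h1 := abs_le.1 (hre ε hε w hw)
      have h2 := abs_le.1 (hre ε' hε' w hw)
      rw [Complex.sub_re, abs_le, hM]
      constructor <;> nlinarith [h1.1, h1.2, h2.1, h2.2]
    have h0 : ‖F ε 0 - F ε' 0‖ ≤ M := by
      have : F ε 0 - F ε' 0 = (((F ε 0 - F ε' 0).re : ℝ) : ℂ) := by
        apply Complex.ext <;> simp [hreal ε hε, hreal ε' hε']
      rw [this, Complex.norm_real, Real.norm_eq_abs]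
      exact hbd 0 (Metric.mem_ball_self hR)
    -- Only the real part of the difference is controlled on the disc. Its value at 0 is real, hence
    -- also controlled, and Borel–Carathéodory bounds the modulus on the half-radius disc by 2M +
    -- 3M.
    have h1 := Complex.borelCaratheodory (f := fun w => F ε w - F ε' w) hMpos
      ((hF ε hε).sub (hF ε' hε')) (fun w hw => (le_abs_self _).trans (hbd w hw)) hR (hsub hz)
    have hzn : ‖z‖ < R / 2 := mem_ball_zero_iff.1 hz
    have h2 : 2 * M * ‖z‖ / (R - ‖z‖) ≤ 2 * M := by
      rw [div_le_iff₀ (by linarith)]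
      nlinarith
    have h3 : ‖F ε 0 - F ε' 0‖ * (R + ‖z‖) / (R - ‖z‖) ≤ 3 * M := by
      rw [div_le_iff₀ (by linarith)]
      nlinarith [norm_nonneg z, norm_nonneg (F ε 0 - F ε' 0)]
    calc ‖F ε z - F ε' z‖ ≤ 2 * M + 3 * M := h1.trans (add_le_add h2 h3)
      _ = 5 * C * ε + 5 * C * ε' := by rw [hM]; ring

/-- Dyadic boundedness: a family whose consecutive dyadic increments are `O(√ε)` is bounded. -/
theorem bounded_of_dyadic {g : ℝ → ℂ} {ε₁ K A₀ : ℝ} (hε₁ : 0 < ε₁) (hK : 0 ≤ K)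
    (h0 : ∀ ε ∈ Ioo 0 ε₁, ε₁ / 2 ≤ ε → ‖g ε‖ ≤ A₀)
    (hd : ∀ ε ∈ Ioo 0 ε₁, ‖g ε - g (ε / 2)‖ ≤ K * √ε) :
    ∀ ε ∈ Ioo 0 ε₁, ‖g ε‖ ≤ A₀ + 4 * K * √ε₁ := by
  -- The term -4K√ε makes the induction close: going from 2ε to ε frees 4K(√(2ε) - √ε), which is at
  -- least K√(2ε) since √ε ≤ (3/4)√(2ε).
  have key : ∀ n : ℕ, ∀ ε ∈ Ioo 0 ε₁, ε₁ / 2 ^ (n + 1) ≤ ε →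
      ‖g ε‖ ≤ A₀ + 4 * K * √ε₁ - 4 * K * √ε := by
    intro n
    induction n with
    | zero =>
      intro ε hε h
      have h1 := h0 ε hε (by simpa using h)
      have h2 : √ε ≤ √ε₁ := Real.sqrt_le_sqrt hε.2.le
      nlinarith
    | succ n ih =>
      intro ε hε h
      by_cases hc : ε₁ / 2 ^ (n + 1) ≤ ε
      · exact ih ε hε hc
      · push Not at hc
        have hlt : ε₁ / 2 ^ (n + 1) ≤ ε₁ / 2 := by
          rw [pow_succ]
          gcongr
          have : (1 : ℝ) ≤ 2 ^ n := one_le_pow₀ (by norm_num)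
          linarith
        have hm : 2 * ε ∈ Ioo 0 ε₁ := ⟨by linarith [hε.1], by linarith⟩
        have h1 := ih (2 * ε) hm (by
          rw [pow_succ] at h
          have : ε₁ / (2 ^ (n + 1) * 2) = ε₁ / 2 ^ (n + 1) / 2 := by field_simp
          linarith)
        have h2 := hd (2 * ε) hm
        rw [show 2 * ε / 2 = ε by ring] at h2
        have h3 : √ε ≤ 3 / 4 * √(2 * ε) := by
          have h5 : √(9 / 16 * (2 * ε)) = √(9 / 16) * √(2 * ε) := Real.sqrt_mul (by norm_num) _
          rw [show (9 : ℝ) / 16 = (3 / 4) ^ 2 by norm_num, Real.sqrt_sq (by norm_num)] at h5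
          rw [← h5]
          apply Real.sqrt_le_sqrt
          linarith [hε.1]
        have h4 : ‖g ε‖ ≤ ‖g (2 * ε)‖ + ‖g (2 * ε) - g ε‖ := by
          have := norm_sub_norm_le (g ε) (g (2 * ε))
          rw [norm_sub_rev] at this
          linarith
        nlinarith [Real.sqrt_nonneg (2 * ε)]
  intro ε hε
  obtain ⟨n, hn⟩ := exists_pow_lt_of_lt_one (show 0 < ε / ε₁ from div_pos hε.1 hε₁)
    (show (1 / 2 : ℝ) < 1 by norm_num)
  have h1 := key n ε hε (by
    rw [lt_div_iff₀ hε₁] at hn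
    have : ε₁ / 2 ^ (n + 1) ≤ (1 / 2) ^ n * ε₁ := by
      rw [one_div, inv_pow, div_eq_mul_inv, mul_comm]
      gcongr
      · norm_num
      · omega
    linarith)
  nlinarith [Real.sqrt_nonneg ε]

/-- A holomorphic family with controlled real part and with a real expansion up to `O(ε³)` admits a
holomorphic expansion to second order on a smaller disc, with bounded remainder. -/
theorem exists_holomorphic_expansion {F : ℝ → ℂ → ℂ} {R ε₁ C : ℝ} {r₀ : ℂ → ℝ} {a₀ a₁ a₂ : ℝ → ℝ}
    (hR : 0 < R) (hε₁ : 0 < ε₁) (hε₁' : ε₁ ≤ 1) (hC : 0 < C)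
    (hF : ∀ ε ∈ Ioo 0 ε₁, DifferentiableOn ℂ (F ε) (Metric.ball 0 R))
    (hre : ∀ ε ∈ Ioo 0 ε₁, ∀ z ∈ Metric.ball (0 : ℂ) R, |(F ε z).re - r₀ z| ≤ C * ε)
    (hexp : ∀ ε ∈ Ioo 0 ε₁, ∀ x : ℝ, |x| < R → ∃ l : ℝ, F ε x = l ∧
      |l - (a₀ x + a₁ x * ε + a₂ x * ε ^ 2)| ≤ C * ε ^ 3) :
    ∃ (ρ C' : ℝ) (G₀ G₁ : ℂ → ℂ) (H : ℝ → ℂ → ℂ), 0 < ρ ∧ ρ ≤ R ∧ 0 < C' ∧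
      DifferentiableOn ℂ G₀ (Metric.ball 0 ρ) ∧ DifferentiableOn ℂ G₁ (Metric.ball 0 ρ) ∧
      (∀ x : ℝ, |x| < ρ → G₀ x = a₀ x ∧ G₁ x = a₁ x) ∧
      ∀ ε ∈ Ioo 0 ε₁, DifferentiableOn ℂ (H ε) (Metric.ball 0 ρ) ∧
        (∀ z ∈ Metric.ball (0 : ℂ) ρ, ‖H ε z‖ ≤ C' ∧ F ε z = G₀ z + ε * G₁ z + ε ^ 2 * H ε z) ∧
        ‖H ε 0 - a₂ 0‖ ≤ C' * ε := by
  have hmem : ∀ᶠ ε in 𝓝[>] (0 : ℝ), ε ∈ Ioo 0 ε₁ := Ioo_mem_nhdsGT hε₁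
  have hexp' : ∀ ε ∈ Ioo 0 ε₁, ∀ x : ℝ, |x| < R →
      ‖F ε x - (a₀ x + a₁ x * ε + a₂ x * ε ^ 2)‖ ≤ C * ε ^ 3 := by
    intro ε hε x hx
    obtain ⟨l, hl, hl'⟩ := hexp ε hε x hx
    rw [hl]
    have : ((l : ℂ) - (a₀ x + a₁ x * ε + a₂ x * ε ^ 2)) =
        ((l - (a₀ x + a₁ x * ε + a₂ x * ε ^ 2) : ℝ) : ℂ) := by push_cast; ring
    rw [this, Complex.norm_real]
    exact hl'
  obtain ⟨G₀, hG₀, hFG⟩ := exists_limit_of_re_le hR hε₁ hC hF hre (fun ε hε => by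
    obtain ⟨l, hl, -⟩ := hexp ε hε 0 (by simpa using hR)
    rw [Complex.ofReal_zero] at hl
    rw [hl]; simp)
  have hb2 : ∀ x : ℝ, |x| < R / 2 → (x : ℂ) ∈ Metric.ball (0 : ℂ) (R / 2) := fun x hx => by simpa using hx
  -- the leading coefficient
  have hG₀a : ∀ x : ℝ, |x| < R / 2 → G₀ x = a₀ x := by
    intro x hx
    have h1 : Tendsto (fun ε : ℝ => F ε x) (𝓝[>] 0) (𝓝 (G₀ x)) := by
      rw [tendsto_iff_norm_sub_tendsto_zero]
      refine squeeze_zero' (Eventually.of_forall fun _ => norm_nonneg _)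
        (hmem.mono fun ε hε => hFG ε hε x (hb2 x hx)) ?_
      have : Tendsto (fun ε : ℝ => 5 * C * ε) (𝓝 0) (𝓝 (5 * C * 0)) :=
        (continuous_const.mul continuous_id).tendsto 0
      rw [mul_zero] at this
      exact this.mono_left nhdsWithin_le_nhds
    have h2 : Tendsto (fun ε : ℝ => F ε x - (a₀ x + a₁ x * ε + a₂ x * ε ^ 2)) (𝓝[>] 0) (𝓝 0) := by
      rw [tendsto_zero_iff_norm_tendsto_zero]
      refine squeeze_zero' (Eventually.of_forall fun _ => norm_nonneg _)
        (hmem.mono fun ε hε => hexp' ε hε x (by linarith)) ?_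
      have : Tendsto (fun ε : ℝ => C * ε ^ 3) (𝓝 0) (𝓝 (C * 0 ^ 3)) :=
        (by fun_prop : Continuous fun ε : ℝ => C * ε ^ 3).tendsto 0
      rw [zero_pow (by norm_num), mul_zero] at this
      exact this.mono_left nhdsWithin_le_nhds
    have h3 : Tendsto (fun ε : ℝ => ((a₀ x : ℂ) + a₁ x * ε + a₂ x * ε ^ 2)) (𝓝[>] 0) (𝓝 (a₀ x)) := by
      have : Tendsto (fun ε : ℝ => ((a₀ x : ℂ) + a₁ x * ε + a₂ x * ε ^ 2)) (𝓝 0)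
          (𝓝 ((a₀ x : ℂ) + a₁ x * (0 : ℝ) + a₂ x * (0 : ℝ) ^ 2)) :=
        (by fun_prop : Continuous fun ε : ℝ => ((a₀ x : ℂ) + a₁ x * ε + a₂ x * ε ^ 2)).tendsto 0
      simp only [Complex.ofReal_zero, mul_zero, ne_eq, OfNat.ofNat_ne_zero, not_false_eq_true,
        zero_pow, add_zero] at this
      exact this.mono_left nhdsWithin_le_nhds
    have h4 := h2.add h3
    simp only [sub_add_cancel, zero_add] at h4
    exact tendsto_nhds_unique h1 h4
  -- the first difference quotient
  set G : ℝ → ℂ → ℂ := fun ε z => (F ε z - G₀ z) / ε with hGdef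
  have hsub2 : Metric.ball (0 : ℂ) (R / 2) ⊆ Metric.ball 0 R := Metric.ball_subset_ball (by linarith)
  have hGd : ∀ ε ∈ Ioo 0 ε₁, DifferentiableOn ℂ (G ε) (Metric.ball 0 (R / 2)) := fun ε hε =>
    (((hF ε hε).mono hsub2).sub hG₀).div_const _
  have hGb : ∀ ε ∈ Ioo 0 ε₁, ∀ z ∈ Metric.ball (0 : ℂ) (R / 2), ‖G ε z‖ ≤ 5 * C := by
    intro ε hε z hz
    rw [hGdef]
    simp only [norm_div, Complex.norm_real, Real.norm_eq_abs, abs_of_pos hε.1]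
    rw [div_le_iff₀ hε.1]
    exact hFG ε hε z hz
  have hGr : ∀ ε ∈ Ioo 0 ε₁, ∀ x : ℝ, |x| < R / 2 → ‖G ε x - (a₁ x + a₂ x * ε)‖ ≤ C * ε ^ 2 := by
    intro ε hε x hx
    have h1 := hexp' ε hε x (by linarith)
    have hne : (ε : ℂ) ≠ 0 := by exact_mod_cast hε.1.ne'
    have h2 : G ε x - (a₁ x + a₂ x * ε) = (F ε x - (a₀ x + a₁ x * ε + a₂ x * ε ^ 2)) / ε := by
      simp only [hGdef, hG₀a x hx]
      field_simp
      ring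
    rw [h2, norm_div, Complex.norm_real, Real.norm_eq_abs, abs_of_pos hε.1, div_le_iff₀ hε.1]
    calc _ ≤ C * ε ^ 3 := h1
      _ = _ := by ring
  -- Nothing is assumed about the size of a₂. Subtracting the real expansions at the two fixed times
  -- e and e/2 isolates a₂(x)·e/2 among bounded quantities.
  obtain ⟨A₂, hA₂pos, hA₂⟩ : ∃ A : ℝ, 0 < A ∧ ∀ x : ℝ, |x| < R / 2 → |a₂ x| ≤ A := by
    set e := ε₁ / 2 with he
    have he1 : e ∈ Ioo 0 ε₁ := ⟨by positivity, by rw [he]; linarith⟩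
    have he2 : e / 2 ∈ Ioo 0 ε₁ := ⟨by linarith [he1.1], by linarith [he1.1, he1.2]⟩
    refine ⟨(10 * C + 2 * C) / (e / 2), div_pos (by positivity) he2.1, fun x hx => ?_⟩
    rw [le_div_iff₀ he2.1]
    have h1 := hGb e he1 x (hb2 x hx)
    have h2 := hGb (e / 2) he2 x (hb2 x hx)
    have h3 := hGr e he1 x hx
    have h4 := hGr (e / 2) he2 x hx
    have h5 : (a₂ x : ℂ) * (e / 2 : ℝ) = (G e x - G (e / 2) x) -
        (G e x - (a₁ x + a₂ x * e)) + (G (e / 2) x - (a₁ x + a₂ x * (e / 2 : ℝ))) := by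
      push_cast; ring
    have h6 : ‖(a₂ x : ℂ) * (e / 2 : ℝ)‖ = |a₂ x| * (e / 2) := by
      rw [norm_mul, Complex.norm_real, Complex.norm_real, Real.norm_eq_abs, Real.norm_eq_abs,
        abs_of_pos he2.1]
    rw [← h6, h5]
    have h7 : C * e ^ 2 ≤ C := by
      have : e ^ 2 ≤ 1 := pow_le_one₀ he1.1.le (by linarith [he1.2])
      nlinarith
    have h8 : C * (e / 2) ^ 2 ≤ C := by
      have : (e / 2) ^ 2 ≤ 1 := pow_le_one₀ he2.1.le (by linarith [he2.2])
      nlinarith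
    calc _ ≤ ‖G e x‖ + ‖G (e / 2) x‖ + ‖G e x - (a₁ x + a₂ x * e)‖ +
          ‖G (e / 2) x - (a₁ x + a₂ x * (e / 2 : ℝ))‖ := by
            refine (norm_add_le _ _).trans (add_le_add ?_ le_rfl)
            refine (norm_sub_le _ _).trans (add_le_add ?_ le_rfl)
            exact norm_sub_le _ _
      _ ≤ _ := by linarith
  -- Convergence of the difference quotients
  set C₂ : ℝ := A₂ + C with hC₂
  have hC₂pos : 0 < C₂ := by positivity
  -- The first summand bounds the difference of two quotients on the disc; the second ensures that
  -- the bound C₂(ε + ε') on the diameter stays below B.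
  set B : ℝ := 10 * C + 2 * C₂ with hB
  have hBpos : 0 < B := by positivity
  have hR2 : 0 < R / 2 := by positivity
  set K : ℝ := C₂ ^ (3 / 4 : ℝ) * B ^ (1 / 4 : ℝ) with hK
  have hKpos : 0 < K := by positivity
  obtain ⟨G₁, hG₁, hGG⟩ : ∃ G₁ : ℂ → ℂ, DifferentiableOn ℂ G₁ (Metric.ball 0 (R / 2 / 12)) ∧
      ∀ ε ∈ Ioo 0 ε₁, ∀ z ∈ Metric.ball (0 : ℂ) (R / 2 / 12),
        ‖G ε z - G₁ z‖ ≤ K * ε ^ (3 / 4 : ℝ) := by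
    refine exists_holomorphic_limit hε₁ (fun ε hε => (hGd ε hε).mono
      (Metric.ball_subset_ball (by linarith))) ?_ ?_
    · have : Tendsto (fun ε : ℝ => K * ε ^ (3 / 4 : ℝ)) (𝓝 0) (𝓝 (K * 0 ^ (3 / 4 : ℝ))) :=
        (continuous_const.mul (Real.continuous_rpow_const (by norm_num))).tendsto 0
      rw [Real.zero_rpow (by norm_num), mul_zero] at this
      exact this.mono_left nhdsWithin_le_nhds
    · intro ε hε ε' hε' z hz
      have hs : 0 < ε + ε' := by linarith [hε.1, hε'.1]
      have h1 := norm_le_two_constants (f := fun z => G ε z - G ε' z) (B := B) (η := C₂ * (ε + ε'))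
        hR2 ((hGd ε hε).sub (hGd ε' hε')) (by positivity) (by
          rw [hB]; nlinarith [hε.2, hε'.2])
        (fun w hw => by
          refine (norm_sub_le _ _).trans ?_
          linarith [hGb ε hε w hw, hGb ε' hε' w hw])
        (fun x hx => by
          have h2 := hGr ε hε x hx
          have h3 := hGr ε' hε' x hx
          have h4 : G ε x - G ε' x = (G ε x - (a₁ x + a₂ x * ε)) -
              (G ε' x - (a₁ x + a₂ x * ε')) + (a₂ x : ℂ) * ((ε - ε' : ℝ) : ℂ) := by
            push_cast; ring
          have h5 : ‖(a₂ x : ℂ) * ((ε - ε' : ℝ) : ℂ)‖ ≤ A₂ * (ε + ε') := by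
            rw [norm_mul, Complex.norm_real, Complex.norm_real, Real.norm_eq_abs, Real.norm_eq_abs]
            have h6 : |ε - ε'| ≤ ε + ε' := by
              rw [abs_le]; constructor <;> linarith [hε.1, hε'.1]
            exact mul_le_mul (hA₂ x hx) h6 (abs_nonneg _) hA₂pos.le
          have h7 : C * ε ^ 2 ≤ C * ε := by nlinarith [hε.1, hε.2, mul_pos hC hε.1]
          have h8 : C * ε' ^ 2 ≤ C * ε' := by nlinarith [hε'.1, hε'.2, mul_pos hC hε'.1]
          change ‖G ε x - G ε' x‖ ≤ _
          rw [h4]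
          refine (norm_add_le _ _).trans ?_
          refine (add_le_add (norm_sub_le _ _) le_rfl).trans ?_
          rw [hC₂]
          linarith) hz
      refine h1.trans ?_
      rw [Real.mul_rpow hC₂pos.le hs.le, ← mul_add, hK]
      have h9 := Real.rpow_add_le_add_rpow hε.1.le hε'.1.le (show (0 : ℝ) ≤ 3 / 4 by norm_num)
        (by norm_num)
      calc C₂ ^ (3 / 4 : ℝ) * (ε + ε') ^ (3 / 4 : ℝ) * B ^ (1 / 4 : ℝ)
          = C₂ ^ (3 / 4 : ℝ) * B ^ (1 / 4 : ℝ) * (ε + ε') ^ (3 / 4 : ℝ) := by ring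
        _ ≤ _ := by gcongr
  set R₁ : ℝ := R / 2 / 12 with hR₁
  have hR₁pos : 0 < R₁ := by positivity
  have hR₁2 : R₁ < R / 2 := by rw [hR₁]; linarith
  have hb1 : ∀ x : ℝ, |x| < R₁ → (x : ℂ) ∈ Metric.ball (0 : ℂ) R₁ := fun x hx => by simpa using hx
  have hsub1 : Metric.ball (0 : ℂ) R₁ ⊆ Metric.ball 0 (R / 2) := Metric.ball_subset_ball hR₁2.le
  have hG₁a : ∀ x : ℝ, |x| < R₁ → G₁ x = a₁ x := by
    intro x hx
    have h1 : Tendsto (fun ε : ℝ => G ε x) (𝓝[>] 0) (𝓝 (G₁ x)) := by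
      rw [tendsto_iff_norm_sub_tendsto_zero]
      refine squeeze_zero' (Eventually.of_forall fun _ => norm_nonneg _)
        (hmem.mono fun ε hε => hGG ε hε x (hb1 x hx)) ?_
      have : Tendsto (fun ε : ℝ => K * ε ^ (3 / 4 : ℝ)) (𝓝 0) (𝓝 (K * 0 ^ (3 / 4 : ℝ))) :=
        (continuous_const.mul (Real.continuous_rpow_const (by norm_num))).tendsto 0
      rw [Real.zero_rpow (by norm_num), mul_zero] at this
      exact this.mono_left nhdsWithin_le_nhds
    have h2 : Tendsto (fun ε : ℝ => G ε x - (a₁ x + a₂ x * ε)) (𝓝[>] 0) (𝓝 0) := by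
      rw [tendsto_zero_iff_norm_tendsto_zero]
      refine squeeze_zero' (Eventually.of_forall fun _ => norm_nonneg _)
        (hmem.mono fun ε hε => hGr ε hε x (by linarith)) ?_
      have : Tendsto (fun ε : ℝ => C * ε ^ 2) (𝓝 0) (𝓝 (C * 0 ^ 2)) :=
        (by fun_prop : Continuous fun ε : ℝ => C * ε ^ 2).tendsto 0
      rw [zero_pow (by norm_num), mul_zero] at this
      exact this.mono_left nhdsWithin_le_nhds
    have h3 : Tendsto (fun ε : ℝ => ((a₁ x : ℂ) + a₂ x * ε)) (𝓝[>] 0) (𝓝 (a₁ x)) := by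
      have : Tendsto (fun ε : ℝ => ((a₁ x : ℂ) + a₂ x * ε)) (𝓝 0)
          (𝓝 ((a₁ x : ℂ) + a₂ x * (0 : ℝ))) :=
        (by fun_prop : Continuous fun ε : ℝ => ((a₁ x : ℂ) + a₂ x * ε)).tendsto 0
      simp only [Complex.ofReal_zero, mul_zero, add_zero] at this
      exact this.mono_left nhdsWithin_le_nhds
    have h4 := h2.add h3
    simp only [sub_add_cancel, zero_add] at h4
    exact tendsto_nhds_unique h1 h4
  -- the second difference quotient
  set H : ℝ → ℂ → ℂ := fun ε z => (G ε z - G₁ z) / ε with hHdef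
  have hHd : ∀ ε ∈ Ioo 0 ε₁, DifferentiableOn ℂ (H ε) (Metric.ball 0 R₁) := fun ε hε =>
    (((hGd ε hε).mono hsub1).sub hG₁).div_const _
  have hHr : ∀ ε ∈ Ioo 0 ε₁, ∀ x : ℝ, |x| < R₁ → ‖H ε x - a₂ x‖ ≤ C * ε := by
    intro ε hε x hx
    have h1 := hGr ε hε x (by linarith)
    have hne : (ε : ℂ) ≠ 0 := by exact_mod_cast hε.1.ne'
    have h2 : H ε x - a₂ x = (G ε x - (a₁ x + a₂ x * ε)) / ε := by
      simp only [hHdef, hG₁a x hx]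
      field_simp
      ring
    rw [h2, norm_div, Complex.norm_real, Real.norm_eq_abs, abs_of_pos hε.1, div_le_iff₀ hε.1]
    calc _ ≤ C * ε ^ 2 := h1
      _ = _ := by ring
  have hHb : ∀ ε ∈ Ioo 0 ε₁, ∀ z ∈ Metric.ball (0 : ℂ) R₁, ‖H ε z‖ ≤ K * ε ^ (-(1 / 4) : ℝ) := by
    intro ε hε z hz
    simp only [hHdef, norm_div, Complex.norm_real, Real.norm_eq_abs, abs_of_pos hε.1]
    rw [div_le_iff₀ hε.1]
    refine (hGG ε hε z hz).trans_eq ?_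
    have h1 : ε ^ (-(1 / 4) : ℝ) * ε = ε ^ (3 / 4 : ℝ) := by
      rw [← Real.rpow_add_one hε.1.ne']; norm_num
    rw [mul_assoc K, h1]
  have hhalf : ∀ ε ∈ Ioo 0 ε₁, ε / 2 ∈ Ioo 0 ε₁ := fun ε hε =>
    ⟨by linarith [hε.1], by linarith [hε.1, hε.2]⟩
  set C₃ : ℝ := 3 * K + 2 * C with hC₃
  have hC₃pos : 0 < C₃ := by positivity
  -- Interpolating between ε^{-1/4} on the disc and ε on the diameter yields ε^{3/4 - 1/16} =
  -- ε^{11/16} ≤ √ε, which is summable along ε, ε/2, ε/4, … .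
  have hdy : ∀ ε ∈ Ioo 0 ε₁, ∀ z ∈ Metric.ball (0 : ℂ) (R₁ / 12), ‖H ε z - H (ε / 2) z‖ ≤ C₃ * √ε := by
    intro ε hε z hz
    have hε1 : ε ≤ 1 := hε.2.le.trans hε₁'
    have hp1 : 1 ≤ ε ^ (-(1 / 4) : ℝ) := Real.one_le_rpow_of_pos_of_le_one_of_nonpos hε.1 hε1 (by norm_num)
    have h1 := norm_le_two_constants (f := fun z => H ε z - H (ε / 2) z) (η := C₃ * ε)
      (B := C₃ * ε ^ (-(1 / 4) : ℝ)) hR₁pos ((hHd ε hε).sub (hHd _ (hhalf ε hε)))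
      (mul_pos hC₃pos hε.1) (by gcongr; linarith)
      (fun w hw => by
        have h2 := hHb ε hε w hw
        have h3 := hHb _ (hhalf ε hε) w hw
        have h4 : (ε / 2) ^ (-(1 / 4) : ℝ) ≤ 2 * ε ^ (-(1 / 4) : ℝ) := by
          rw [div_eq_mul_inv, Real.mul_rpow hε.1.le (by norm_num), mul_comm]
          gcongr
          rw [Real.inv_rpow (by norm_num), ← Real.rpow_neg (by norm_num), neg_neg]
          calc (2 : ℝ) ^ (1 / 4 : ℝ) ≤ 2 ^ (1 : ℝ) :=
                Real.rpow_le_rpow_of_exponent_le (by norm_num) (by norm_num)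
            _ = 2 := Real.rpow_one 2
        refine (norm_sub_le _ _).trans ?_
        rw [hC₃]
        nlinarith)
      (fun x hx => by
        have h2 := hHr ε hε x hx
        have h3 := hHr _ (hhalf ε hε) x hx
        have h4 : H ε x - H (ε / 2) x = (H ε x - a₂ x) - (H (ε / 2) x - a₂ x) := by ring
        change ‖H ε x - H (ε / 2) x‖ ≤ _
        rw [h4]
        refine (norm_sub_le _ _).trans ?_
        rw [hC₃]
        nlinarith [hε.1]) hz
    refine h1.trans ?_
    have h5 : (C₃ * ε) ^ (3 / 4 : ℝ) * (C₃ * ε ^ (-(1 / 4) : ℝ)) ^ (1 / 4 : ℝ) = C₃ * ε ^ (11 / 16 : ℝ) := by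
      rw [Real.mul_rpow hC₃pos.le hε.1.le, Real.mul_rpow hC₃pos.le (by positivity), ← Real.rpow_mul hε.1.le]
      calc _ = (C₃ ^ (3 / 4 : ℝ) * C₃ ^ (1 / 4 : ℝ)) * (ε ^ (3 / 4 : ℝ) * ε ^ (-(1 / 4) * (1 / 4) : ℝ)) := by ring
        _ = _ := by rw [← Real.rpow_add hC₃pos, ← Real.rpow_add hε.1]; norm_num
    rw [h5, Real.sqrt_eq_rpow]
    gcongr 1
    exact Real.rpow_le_rpow_of_exponent_ge hε.1 hε1 (by norm_num)
  set A₀ : ℝ := K * (ε₁ / 2) ^ (-(1 / 4) : ℝ) with hA₀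
  have hA₀pos : 0 < A₀ := by positivity
  have hsub0 : Metric.ball (0 : ℂ) (R₁ / 12) ⊆ Metric.ball 0 R₁ := Metric.ball_subset_ball (by linarith)
  refine ⟨R₁ / 12, A₀ + 4 * C₃ * √ε₁ + C, G₀, G₁, H, by positivity, by rw [hR₁]; linarith, by positivity,
    hG₀.mono (hsub0.trans hsub1), hG₁.mono hsub0, fun x hx => ⟨hG₀a x (by linarith), hG₁a x (by linarith)⟩,
    fun ε hε => ⟨(hHd ε hε).mono hsub0, fun z hz => ⟨?_, ?_⟩, ?_⟩⟩
  · have := bounded_of_dyadic (g := fun ε => H ε z) (A₀ := A₀) hε₁ hC₃pos.le (fun e he he' => by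
      refine (hHb e he z (hsub0 hz)).trans ?_
      rw [hA₀]
      gcongr 1
      exact Real.rpow_le_rpow_of_nonpos (by positivity) he' (by norm_num)) (fun e he => hdy e he z hz) ε hε
    linarith
  · have hne : (ε : ℂ) ≠ 0 := by exact_mod_cast hε.1.ne'
    simp only [hHdef, hGdef]
    field_simp
    ring
  · have h1 := hHr ε hε 0 (by simpa using hR₁pos)
    rw [Complex.ofReal_zero] at h1
    have : 0 ≤ (A₀ + 4 * C₃ * √ε₁) * ε := mul_nonneg (by positivity) hε.1.le
    linarith

end SharpOption

/-! ### Taylor coefficients and nondegeneracy of the second derivative -/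

namespace SharpOption

/-- Passing to the difference quotient at 0 shifts the power series by one place. This identifies
the coefficients of holomorphic Taylor remainders. -/
theorem iteratedDeriv_dslope {A : ℂ → ℂ} (hA : AnalyticAt ℂ A 0) (m : ℕ) :
    iteratedDeriv m (dslope A 0) 0 / (m.factorial : ℂ) =
      iteratedDeriv (m + 1) A 0 / ((m + 1).factorial : ℂ) := by
  have h1 := hA.hasFPowerSeriesAt.has_fpower_series_dslope_fslope
  have h2 : AnalyticAt ℂ (dslope A 0) 0 := ⟨_, h1⟩
  have h3 := h2.hasFPowerSeriesAt.eq_formalMultilinearSeries h1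
  have h4 := congrArg (fun p => FormalMultilinearSeries.coeff p m) h3
  simpa [FormalMultilinearSeries.coeff_ofScalars, FormalMultilinearSeries.coeff_fslope] using h4

/-- Taylor's formula for a bounded holomorphic function on a disc, with a holomorphic remainder. -/
theorem exists_taylor_factor {A : ℂ → ℂ} {ρ M : ℝ} (hρ : 0 < ρ)
    (hA : DifferentiableOn ℂ A (Metric.ball 0 ρ)) (hM : ∀ z ∈ Metric.ball (0 : ℂ) ρ, ‖A z‖ ≤ M) (n : ℕ) :
    ∃ B : ℂ → ℂ, DifferentiableOn ℂ B (Metric.ball 0 ρ) ∧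
      (∀ z ∈ Metric.ball (0 : ℂ) ρ, ‖B z‖ ≤ (2 / ρ) ^ n * M) ∧
      (∀ z, A z = ∑ l ∈ Finset.range n,
        iteratedDeriv l A 0 / (l.factorial : ℂ) * z ^ l + z ^ n * B z) ∧
      ∀ m, iteratedDeriv m B 0 / (m.factorial : ℂ) =
        iteratedDeriv (m + n) A 0 / ((m + n).factorial : ℂ) := by
  have h0 : (0 : ℂ) ∈ Metric.ball (0 : ℂ) ρ := Metric.mem_ball_self hρ
  induction n with
  | zero => exact ⟨A, hA, by simpa using hM, by simp, by simp⟩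
  | succ n ih =>
    obtain ⟨B, hB, hBM, hAB, hd⟩ := ih
    refine ⟨dslope B 0, ?_, ?_, ?_, ?_⟩
    · exact (Complex.differentiableOn_dslope (Metric.ball_mem_nhds _ hρ)).2 hB
    · intro z hz
      -- Schwarz lemma: B maps the disc into a ball about B(0) whose radius is twice its bound, so
      -- each extraction of a factor z costs 2/ρ.
      have := Complex.norm_dslope_le_div_of_mapsTo_ball (R₂ := 2 * ((2 / ρ) ^ n * M)) hB
        (fun w hw => by
          rw [mem_closedBall_iff_norm]
          refine (norm_sub_le _ _).trans ?_
          linarith [hBM w hw, hBM 0 h0]) hz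
      refine this.trans_eq ?_
      rw [pow_succ]; ring
    · intro z
      rw [hAB z, Finset.sum_range_succ, add_assoc]
      congr 1
      have h1 : B z = B 0 + z * dslope B 0 z := by
        have := sub_smul_dslope B 0 z
        rw [sub_zero, smul_eq_mul] at this
        rw [this]; ring
      have h2 := hd 0
      simp only [iteratedDeriv_zero, Nat.factorial_zero, Nat.cast_one, div_one, zero_add] at h2
      rw [h1, h2]; ring
    · intro m
      rw [iteratedDeriv_dslope (hB.analyticAt (Metric.ball_mem_nhds _ hρ)), hd (m + 1)]
      rw [show m + 1 + n = m + (n + 1) by ring]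

/-- Derivatives of a real function with a holomorphic extension. -/
theorem iteratedDeriv_ofReal_eq {G : ℂ → ℂ} {g : ℝ → ℝ} {ρ : ℝ}
    (hG : DifferentiableOn ℂ G (Metric.ball 0 ρ)) (hg : ∀ x : ℝ, |x| < ρ → G x = g x) (n : ℕ) :
    ∀ x : ℝ, |x| < ρ → ((iteratedDeriv n g x : ℝ) : ℂ) = iteratedDeriv n G x := by
  have hopen : IsOpen (Metric.ball (0 : ℂ) ρ) := Metric.isOpen_ball
  have hdiff : ∀ n, DifferentiableOn ℂ (iteratedDeriv n G) (Metric.ball 0 ρ) := by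
    intro n
    induction n with
    | zero => simpa using hG
    | succ n ih => rw [iteratedDeriv_succ]; exact ih.deriv hopen
  induction n with
  | zero => intro x hx; simp [hg x hx]
  | succ n ih =>
    intro x hx
    have hb : (x : ℂ) ∈ Metric.ball (0 : ℂ) ρ := by simpa using hx
    have h1 : HasDerivAt (iteratedDeriv n G) (iteratedDeriv (n + 1) G x) (x : ℂ) := by
      rw [iteratedDeriv_succ]
      exact ((hdiff n x hb).differentiableAt (hopen.mem_nhds hb)).hasDerivAt
    have hnb : ∀ᶠ y : ℝ in 𝓝 x, |y| < ρ := (continuous_abs.tendsto x).eventually_lt_const hx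
    have h2 : HasDerivAt (fun y : ℝ => ((iteratedDeriv n g y : ℝ) : ℂ)) (iteratedDeriv (n + 1) G x) x :=
      h1.comp_ofReal.congr_of_eventuallyEq (hnb.mono fun y hy => ih y hy)
    have h3 : HasDerivAt (iteratedDeriv n g) (iteratedDeriv (n + 1) G x).re x := by
      have h4 : HasDerivAt (fun y : ℝ => ((iteratedDeriv n G y).re)) (iteratedDeriv (n + 1) G x).re x :=
        h1.real_of_complex
      refine h4.congr_of_eventuallyEq (hnb.mono fun y hy => ?_)
      simp only
      rw [← ih y hy, Complex.ofReal_re]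
    have h5 := h3.ofReal_comp
    rw [iteratedDeriv_succ, h3.deriv]
    exact h5.unique h2

/-- If `a cos (n θ) ≤ a cosⁿ θ` for all `θ`, with `n ≥ 2` and `a ≠ 0`, then `n = 2` and `a > 0`. -/
theorem eq_two_of_cos_le {a : ℝ} {n : ℕ} (ha : a ≠ 0) (hn : 2 ≤ n)
    (h : ∀ θ : ℝ, a * Real.cos (n * θ) ≤ a * Real.cos θ ^ n) : n = 2 ∧ 0 < a := by
  have hn0 : (0 : ℝ) < n := by positivity
  have hn2 : (2 : ℝ) ≤ n := by exact_mod_cast hn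
  have hpos : 0 < a := by
    by_contra! hle
    have hneg : a < 0 := lt_of_le_of_ne hle ha
    -- At this angle the left side is -a and the cosine is nonnegative, which excludes a < 0.
    have h1 := h (π / n)
    rw [mul_div_cancel₀ _ hn0.ne', Real.cos_pi] at h1
    have h2 : 0 ≤ Real.cos (π / n) := by
      apply Real.cos_nonneg_of_mem_Icc
      constructor
      · have : 0 ≤ π / n := by positivity
        linarith [Real.pi_pos]
      · gcongr
    have h3 := pow_nonneg h2 n
    nlinarith
  refine ⟨?_, hpos⟩
  by_contra hne
  have hn3 : (3 : ℝ) ≤ n := by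
    have : 3 ≤ n := by omega
    exact_mod_cast this
  -- At this angle the left side is a, while the cosine has modulus below 1 as soon as n ≥ 3.
  have h1 := h (2 * π / n)
  rw [mul_div_cancel₀ _ hn0.ne', Real.cos_two_pi] at h1
  have h2 : 0 < Real.sin (2 * π / n) := by
    apply Real.sin_pos_of_pos_of_lt_pi (by positivity)
    rw [div_lt_iff₀ hn0]
    nlinarith [Real.pi_pos]
  have h3 : |Real.cos (2 * π / n)| < 1 := by
    rw [← sq_lt_one_iff_abs_lt_one]
    nlinarith [Real.sin_sq_add_cos_sq (2 * π / n)]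
  have h4 : Real.cos (2 * π / n) ^ n < 1 := by
    refine (le_abs_self _).trans_lt ?_
    rw [abs_pow]
    exact pow_lt_one₀ (abs_nonneg _) h3 (by omega)
  nlinarith

/-- A holomorphic function whose real part is maximal, on vertical lines, at the reals, has a
positive second derivative at a real point around which it is not affine. -/
theorem iteratedDeriv_two_re_pos {G : ℂ → ℂ} {g : ℝ → ℝ} {ρ : ℝ} (hρ : 0 < ρ)
    (hG : DifferentiableOn ℂ G (Metric.ball 0 ρ)) (hg : ∀ x : ℝ, |x| < ρ → G x = g x)
    (hle : ∀ z ∈ Metric.ball (0 : ℂ) ρ, (G z).re ≤ g z.re)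
    (hna : ¬ ∀ᶠ x : ℝ in 𝓝 0, g x = g 0 + deriv g 0 * x) :
    0 < iteratedDeriv 2 g 0 := by
  have hball : Metric.ball (0 : ℂ) ρ ∈ 𝓝 0 := Metric.ball_mem_nhds _ hρ
  -- the function is bounded on a smaller disc, so Taylor's formula applies
  set B : ℂ → ℂ := dslope (dslope G 0) 0 with hB
  have hBd : DifferentiableOn ℂ B (Metric.ball 0 ρ) :=
    (Complex.differentiableOn_dslope hball).2 ((Complex.differentiableOn_dslope hball).2 hG)
  have hBan : AnalyticAt ℂ B 0 := hBd.analyticAt hball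
  have hGB : ∀ z, G z = G 0 + deriv G 0 * z + z ^ 2 * B z := by
    intro z
    have h1 := sub_smul_dslope G 0 z
    have h2 := sub_smul_dslope (dslope G 0) 0 z
    rw [sub_zero, smul_eq_mul] at h1 h2
    rw [dslope_same] at h2
    linear_combination -h1 - z * h2
  have hg0 : G 0 = g 0 := by simpa using hg 0 (by simpa using hρ)
  have hg1 : deriv G 0 = deriv g 0 := by
    have := iteratedDeriv_ofReal_eq hG hg 1 0 (by simpa using hρ)
    simpa using this.symm
  have hg2 : ((iteratedDeriv 2 g 0 : ℝ) : ℂ) = 2 * B 0 := by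
    have h1 := iteratedDeriv_ofReal_eq hG hg 2 0 (by simpa using hρ)
    have h2 := iteratedDeriv_dslope (hG.analyticAt hball) 1
    rw [Complex.ofReal_zero] at h1
    rw [h1, hB, dslope_same]
    simp only [iteratedDeriv_one, Nat.factorial_one, Nat.cast_one, div_one, Nat.reduceAdd] at h2
    rw [h2]
    simp
    field_simp
  have hnz : ¬ ∀ᶠ z in 𝓝 (0 : ℂ), B z = 0 := by
    intro hc
    apply hna
    have h1 : Tendsto (fun x : ℝ => (x : ℂ)) (𝓝 0) (𝓝 0) := by
      simpa using Complex.continuous_ofReal.tendsto 0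
    have hnb : ∀ᶠ y : ℝ in 𝓝 0, |y| < ρ := by
      have := (continuous_abs.tendsto (0 : ℝ)).eventually_lt_const (show |(0 : ℝ)| < ρ by simpa using hρ)
      exact this
    filter_upwards [h1.eventually hc, hnb] with x hx hx'
    have h2 := hGB x
    rw [hx, mul_zero, add_zero, hg x hx', hg0, hg1] at h2
    exact_mod_cast h2
  -- Beyond its affine part G equals z^{m+2} h(z) with h(0) ≠ 0. Dividing the inequality by r^{m+2}
  -- along the ray r e^{iθ} and letting r ↓ 0 leaves a cos(nθ) ≤ a cosⁿ θ, where n = m + 2 and a =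
  -- h(0).
  obtain ⟨m, h, han, hne, heq⟩ := hBan.exists_eventuallyEq_pow_smul_nonzero_iff.2 hnz
  simp only [sub_zero, smul_eq_mul] at heq
  -- the limit along rays
  have hray : ∀ w : ℂ, Tendsto (fun r : ℝ => (r : ℂ) * w) (𝓝[>] 0) (𝓝 0) := by
    intro w
    have : Tendsto (fun r : ℝ => (r : ℂ) * w) (𝓝 0) (𝓝 (((0 : ℝ) : ℂ) * w)) :=
      (by fun_prop : Continuous fun r : ℝ => (r : ℂ) * w).tendsto 0
    rw [Complex.ofReal_zero, zero_mul] at this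
    exact this.mono_left nhdsWithin_le_nhds
  have hrayh : ∀ w : ℂ, Tendsto (fun r : ℝ => h ((r : ℂ) * w)) (𝓝[>] 0) (𝓝 (h 0)) := fun w =>
    han.continuousAt.tendsto.comp (hray w)
  have hGh : ∀ w : ℂ, ∀ᶠ r : ℝ in 𝓝[>] 0, (r : ℂ) * w ∈ Metric.ball (0 : ℂ) ρ ∧
      G (r * w) = g 0 + deriv g 0 * (r * w) + (r : ℂ) ^ (m + 2) * (w ^ (m + 2) * h (r * w)) := by
    intro w
    filter_upwards [(hray w).eventually heq, (hray w).eventually hball] with r hr hr'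
    refine ⟨hr', ?_⟩
    rw [hGB, hr, hg0, hg1]
    ring
  have him : (h 0).im = 0 := by
    have h1 : Tendsto (fun r : ℝ => (h ((r : ℂ) * 1)).im) (𝓝[>] 0) (𝓝 (h 0).im) :=
      (Complex.continuous_im.tendsto _).comp (hrayh 1)
    refine tendsto_nhds_unique_of_eventuallyEq h1 tendsto_const_nhds ?_
    filter_upwards [hGh 1, self_mem_nhdsWithin] with r hr hr0
    have hr0' : (0 : ℝ) < r := hr0
    obtain ⟨h2, h3⟩ := hr
    rw [mul_one] at h2 h3 ⊢
    rw [hg r (by simpa using h2), one_pow, one_mul] at h3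
    have h4 := congrArg Complex.im h3
    rw [← Complex.ofReal_pow, ← Complex.ofReal_mul] at h4
    simp only [Complex.ofReal_im, Complex.add_im, Complex.im_ofReal_mul, add_zero, zero_add] at h4
    have h5 : r ^ (m + 2) ≠ 0 := by positivity
    rcases mul_eq_zero.1 h4.symm with h6 | h6
    · exact absurd h6 h5
    · exact h6
  have hre : (h 0).re ≠ 0 := fun hc => hne (Complex.ext hc him)
  have hcos : ∀ θ : ℝ, (h 0).re * Real.cos ((m + 2 : ℕ) * θ) ≤ (h 0).re * Real.cos θ ^ (m + 2) := by
    intro θ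
    set w : ℂ := Complex.exp (θ * Complex.I) with hw
    have hwre : w.re = Real.cos θ := Complex.exp_ofReal_mul_I_re θ
    have hwn : w ^ (m + 2) = Complex.exp (((m + 2 : ℕ) * θ : ℝ) * Complex.I) := by
      rw [hw, ← Complex.exp_nat_mul]
      congr 1; push_cast; ring
    have h1 : Tendsto (fun r : ℝ => (w ^ (m + 2) * h ((r : ℂ) * w)).re) (𝓝[>] 0)
        (𝓝 (w ^ (m + 2) * h 0).re) :=
      (Complex.continuous_re.tendsto _).comp (tendsto_const_nhds.mul (hrayh w))
    have h2 : Tendsto (fun r : ℝ => (((w.re : ℂ)) ^ (m + 2) * h ((r : ℂ) * w.re)).re) (𝓝[>] 0)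
        (𝓝 (((w.re : ℂ)) ^ (m + 2) * h 0).re) :=
      (Complex.continuous_re.tendsto _).comp (tendsto_const_nhds.mul (hrayh w.re))
    have h3 : (w ^ (m + 2) * h 0).re = (h 0).re * Real.cos ((m + 2 : ℕ) * θ) := by
      rw [hwn, Complex.mul_re, him, Complex.exp_ofReal_mul_I_re]; ring
    have h4 : (((w.re : ℂ)) ^ (m + 2) * h 0).re = (h 0).re * Real.cos θ ^ (m + 2) := by
      rw [hwre, ← Complex.ofReal_pow, Complex.re_ofReal_mul]; ring
    rw [← h3, ← h4]
    refine le_of_tendsto_of_tendsto h1 h2 ?_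
    filter_upwards [hGh w, hGh w.re, self_mem_nhdsWithin] with r hr hr' hr0
    have hr0' : (0 : ℝ) < r := hr0
    have h5 := hle _ hr.1
    have h6 : ((r : ℂ) * w).re = r * w.re := by rw [Complex.re_ofReal_mul]
    have h7 : g (r * w.re) = (G (r * (w.re : ℂ))).re := by
      have := hg (r * w.re) (by
        have := hr'.1
        rw [← Complex.ofReal_mul] at this
        simpa using this)
      rw [Complex.ofReal_mul] at this
      rw [this, Complex.ofReal_re]
    rw [h6, h7, hr.2, hr'.2] at h5
    have e1 : ∀ v : ℂ, ((r : ℂ) ^ (m + 2) * v).re = r ^ (m + 2) * v.re := by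
      intro v
      rw [← Complex.ofReal_pow, Complex.re_ofReal_mul]
    rw [Complex.add_re, Complex.add_re, Complex.add_re, Complex.add_re, e1, e1,
      Complex.re_ofReal_mul, Complex.re_ofReal_mul, Complex.re_ofReal_mul, Complex.re_ofReal_mul,
      Complex.ofReal_re w.re] at h5
    have h8 : 0 < r ^ (m + 2) := by positivity
    nlinarith
  obtain ⟨hm, hpos⟩ := eq_two_of_cos_le hre (by omega) hcos
  have hm0 : m = 0 := by omega
  have h9 : B 0 = h 0 := by
    have := heq.self_of_nhds
    rw [hm0, pow_zero, one_mul] at this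
    exact this
  have h10 := congrArg Complex.re hg2
  rw [h9] at h10
  simp at h10
  linarith

end SharpOption

/-! ### Fourier inversion of the call payoff -/

namespace SharpOption

/-- The one-sided exponential with Fourier-Laplace transform `1 / (w + iy)`. -/
def oneSidedExp (w t : ℝ) : ℝ :=
  if 0 < t then (if 0 < w then Real.exp (-w * t) else 0) else (if w < 0 then -Real.exp (-w * t) else 0)

/-- The sign of w selects the half-line on which the exponential decays; the minus sign on the
negative half-line makes both cases give one formula. -/
theorem oneSidedExp_fourier {w : ℝ} (hw : w ≠ 0) (y : ℝ) :
    Integrable (fun t : ℝ => Complex.exp (-(y * t) * Complex.I) * (oneSidedExp w t : ℂ)) ∧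
      ∫ t : ℝ, Complex.exp (-(y * t) * Complex.I) * (oneSidedExp w t : ℂ) = 1 / (w + y * Complex.I) := by
  rcases lt_or_gt_of_ne hw with h | h
  · have hre : 0 < (-((w : ℂ) + y * Complex.I)).re := by simpa using h
    have heq : (fun t : ℝ => Complex.exp (-(y * t) * Complex.I) * (oneSidedExp w t : ℂ)) =
        (Iic (0 : ℝ)).indicator (fun t : ℝ => -Complex.exp (-((w : ℂ) + y * Complex.I) * t)) := by
      ext t
      by_cases ht : 0 < t
      · simp [oneSidedExp, ht, not_lt.2 h.le]
      · rw [indicator_of_mem (by simpa using ht)]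
        simp only [oneSidedExp, ht, h, if_true, if_false]
        push_cast
        rw [mul_neg, ← Complex.exp_add]
        congr 2; ring
    rw [heq]
    refine ⟨(integrable_indicator_iff measurableSet_Iic).2
      (integrableOn_exp_mul_complex_Iic hre 0).neg, ?_⟩
    rw [integral_indicator measurableSet_Iic, integral_neg, integral_exp_mul_complex_Iic hre]
    simp only [Complex.ofReal_zero, mul_zero, Complex.exp_zero]
    rw [div_neg, neg_neg]
  · have hre : (-((w : ℂ) + y * Complex.I)).re < 0 := by simpa using h
    have heq : (fun t : ℝ => Complex.exp (-(y * t) * Complex.I) * (oneSidedExp w t : ℂ)) =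
        (Ioi (0 : ℝ)).indicator (fun t : ℝ => Complex.exp (-((w : ℂ) + y * Complex.I) * t)) := by
      ext t
      by_cases ht : 0 < t
      · rw [indicator_of_mem (by simpa using ht)]
        simp only [oneSidedExp, ht, h, if_true]
        push_cast
        rw [← Complex.exp_add]
        congr 1; ring
      · simp [oneSidedExp, ht, not_lt.2 h.le]
    rw [heq]
    refine ⟨(integrable_indicator_iff measurableSet_Ioi).2 (integrableOn_exp_mul_complex_Ioi hre 0), ?_⟩
    rw [integral_indicator measurableSet_Ioi, integral_exp_mul_complex_Ioi hre]
    simp only [Complex.ofReal_zero, mul_zero, Complex.exp_zero]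
    rw [neg_div_neg_eq]

/-- Normalised payoff, with the exponentials subtracted which make it decay at the dual `u`. -/
def reducedPayoff (u b t : ℝ) : ℝ :=
  max (Real.exp (b * t) - 1) 0 - (if u < b then Real.exp (b * t) else 0) + (if u < 0 then 1 else 0)

/-- Subtracting an exponential from a function supported on t > 0 moves that exponential, with
opposite sign, to t ≤ 0. The adjustments do this exactly to those parts that would grow after
weighting. Both remaining pieces therefore decay wherever u lies, apart from the poles 0 and b. -/
theorem exp_mul_reducedPayoff {u b : ℝ} (hu : u ≠ 0) (hub : u ≠ b) (hb : 0 ≤ b) (t : ℝ) :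
    Real.exp (-u * t) * reducedPayoff u b t = oneSidedExp (u - b) t - oneSidedExp u t := by
  have hexp : Real.exp (-u * t) * Real.exp (b * t) = Real.exp (-(u - b) * t) := by
    rw [← Real.exp_add]; congr 1; ring
  have h1 : (0 < u - b) ↔ ¬ u < b := by
    rw [sub_pos, not_lt]; exact ⟨le_of_lt, fun h => lt_of_le_of_ne h (Ne.symm hub)⟩
  have h2 : (u - b < 0) ↔ u < b := sub_neg
  have h3 : (0 < u) ↔ ¬ u < 0 := by
    rw [not_lt]; exact ⟨le_of_lt, fun h => lt_of_le_of_ne h (Ne.symm hu)⟩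
  unfold reducedPayoff oneSidedExp
  simp only [h1, h2, h3]
  by_cases ht : 0 < t
  · have hmax : max (Real.exp (b * t) - 1) 0 = Real.exp (b * t) - 1 := by
      apply max_eq_left
      have := Real.one_le_exp (x := b * t) (by positivity)
      linarith
    rw [hmax, ← hexp]
    by_cases hA : u < b <;> by_cases hB : u < 0 <;> simp [ht, hA, hB]
    all_goals ring
  · have hmax : max (Real.exp (b * t) - 1) 0 = 0 := by
      apply max_eq_right
      have : Real.exp (b * t) ≤ 1 := Real.exp_le_one_iff.2 (mul_nonpos_of_nonneg_of_nonpos hb (not_lt.1 ht))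
      linarith
    rw [hmax, ← hexp]
    by_cases hA : u < b <;> by_cases hB : u < 0 <;> simp [ht, hA, hB]
    ring

theorem continuous_reducedPayoff (u b : ℝ) : Continuous (reducedPayoff u b) := by
  unfold reducedPayoff
  split_ifs <;> fun_prop

theorem add_mul_I_ne_zero {w : ℝ} (hw : w ≠ 0) (y : ℝ) : (w : ℂ) + y * Complex.I ≠ 0 := by
  intro h
  have := congrArg Complex.re h
  simp at this
  exact hw this

/-- Integrable decay of the kernel with a constant depending only on a common lower bound for |w|
and |v|; later estimates are thus uniform in b. -/
theorem norm_inv_mul_le {m w v : ℝ} (hm : 0 < m) (hm1 : m ≤ 1) (hw : m ≤ |w|) (hv : m ≤ |v|) (y : ℝ) :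
    ‖(((w : ℂ) + y * Complex.I) * ((v : ℂ) + y * Complex.I))⁻¹‖ ≤ (m ^ 2)⁻¹ * (1 + y ^ 2)⁻¹ := by
  have key : ∀ w : ℝ, m ≤ |w| → m * √(1 + y ^ 2) ≤ ‖(w : ℂ) + y * Complex.I‖ := by
    intro w hw
    rw [Complex.norm_add_mul_I]
    apply Real.le_sqrt_of_sq_le
    rw [mul_pow, Real.sq_sqrt (by positivity)]
    have h1 : m ^ 2 ≤ w ^ 2 := by
      rw [← sq_abs w]; gcongr
    have h2 : m ^ 2 ≤ 1 := pow_le_one₀ hm.le hm1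
    nlinarith [sq_nonneg y]
  have hs : 0 < √(1 + y ^ 2) := Real.sqrt_pos.2 (by positivity)
  rw [norm_inv, norm_mul, ← mul_inv]
  apply inv_anti₀ (by positivity)
  calc m ^ 2 * (1 + y ^ 2) = (m * √(1 + y ^ 2)) * (m * √(1 + y ^ 2)) := by
        rw [← Real.sq_sqrt (show (0 : ℝ) ≤ 1 + y ^ 2 by positivity)]
        rw [Real.sqrt_sq hs.le]; ring
    _ ≤ _ := mul_le_mul (key w hw) (key v hv) (by positivity) (norm_nonneg _)

/-- The transform of the reduced payoff, along the line `u + iy`. -/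
def payoffKernel (u b y : ℝ) : ℂ :=
  b * (((u : ℂ) + y * Complex.I) * (((u - b : ℝ) : ℂ) + y * Complex.I))⁻¹

theorem continuous_payoffKernel {u b : ℝ} (hu : u ≠ 0) (hub : u ≠ b) :
    Continuous (payoffKernel u b) := by
  unfold payoffKernel
  refine continuous_const.mul (Continuous.inv₀ (by fun_prop) fun y => ?_)
  exact mul_ne_zero (add_mul_I_ne_zero hu y) (add_mul_I_ne_zero (sub_ne_zero.2 hub) y)

theorem integrable_payoffKernel {u b : ℝ} (hu : u ≠ 0) (hub : u ≠ b) :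
    Integrable (payoffKernel u b) := by
  set m : ℝ := min 1 (min |u| |u - b|) with hm
  have hmpos : 0 < m := lt_min one_pos (lt_min (abs_pos.2 hu) (abs_pos.2 (sub_ne_zero.2 hub)))
  refine Integrable.mono' ((integrable_inv_one_add_sq.const_mul ((m ^ 2)⁻¹)).const_mul |b|)
    (continuous_payoffKernel hu hub).aestronglyMeasurable (Eventually.of_forall fun y => ?_)
  rw [payoffKernel, norm_mul, Complex.norm_real, Real.norm_eq_abs]
  gcongr
  exact norm_inv_mul_le hmpos (min_le_left _ _) ((min_le_right _ _).trans (min_le_left _ _))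
    ((min_le_right _ _).trans (min_le_right _ _)) y

theorem payoffKernel_eq {u b : ℝ} (hu : u ≠ 0) (hub : u ≠ b) (y : ℝ) :
    payoffKernel u b y = 1 / (((u - b : ℝ) : ℂ) + y * Complex.I) - 1 / ((u : ℂ) + y * Complex.I) := by
  have h1 := add_mul_I_ne_zero hu y
  have h2 := add_mul_I_ne_zero (sub_ne_zero.2 hub) y
  rw [payoffKernel, div_sub_div _ _ h2 h1, mul_comm (((u - b : ℝ) : ℂ) + y * Complex.I), ← div_eq_mul_inv]
  congr 1
  · push_cast; ring
  · ring

/-- Fourier inversion for the reduced payoff. -/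
theorem integral_payoffKernel {u b : ℝ} (hu : u ≠ 0) (hub : u ≠ b) (hb : 0 ≤ b) (t : ℝ) :
    ∫ y : ℝ, payoffKernel u b y * Complex.exp (((u : ℂ) + y * Complex.I) * t) =
      2 * π * (reducedPayoff u b t : ℂ) := by
  have hub' : u - b ≠ 0 := sub_ne_zero.2 hub
  set g : ℝ → ℂ := fun t => ((Real.exp (-u * t) * reducedPayoff u b t : ℝ) : ℂ) with hg
  have hgeq : ∀ t, g t = (oneSidedExp (u - b) t : ℂ) - (oneSidedExp u t : ℂ) := fun t => by
    rw [hg]; simp only [exp_mul_reducedPayoff hu hub hb]; push_cast; ring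
  have hgc : Continuous g := by
    have := continuous_reducedPayoff u b
    fun_prop
  have hgi : Integrable g := by
    have h1 := (oneSidedExp_fourier hub' 0).1
    have h2 := (oneSidedExp_fourier hu 0).1
    simp only [Complex.ofReal_zero, zero_mul, neg_zero, Complex.exp_zero, one_mul] at h1 h2
    exact (h1.sub h2).congr (Eventually.of_forall fun t => (hgeq t).symm)
  have hfour : ∀ ξ : ℝ, FourierTransform.fourier g ξ = payoffKernel u b (2 * π * ξ) := by
    intro ξ
    rw [Real.fourier_real_eq_integral_exp_smul, payoffKernel_eq hu hub]
    have h1 := oneSidedExp_fourier hub' (2 * π * ξ)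
    have h2 := oneSidedExp_fourier hu (2 * π * ξ)
    rw [← h1.2, ← h2.2, ← integral_sub h1.1 h2.1]
    refine integral_congr_ae (Eventually.of_forall fun t => ?_)
    simp only [smul_eq_mul, hgeq]
    rw [← mul_sub]
    congr 2
    push_cast; ring
  have hfi : Integrable (FourierTransform.fourier g) := by
    rw [funext hfour]
    exact (integrable_payoffKernel hu hub).comp_mul_left' (by positivity)
  -- Inversion holds at every point because g is continuous (the unit jumps of the two one-sided
  -- exponentials at 0 cancel) and both g and its transform are integrable.
  have hinv := hgc.fourierInv_fourier_eq hgi hfi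
  have h3 := congrFun hinv t
  rw [Real.fourierInv_eq'] at h3
  simp only [hfour, smul_eq_mul] at h3
  have h4 : ∫ ξ : ℝ, Complex.exp (((2 * π * inner ℝ ξ t : ℝ) : ℂ) * Complex.I) * payoffKernel u b (2 * π * ξ) =
      ∫ ξ : ℝ, (fun y : ℝ => Complex.exp (y * t * Complex.I) * payoffKernel u b y) (2 * π * ξ) := by
    refine integral_congr_ae (Eventually.of_forall fun ξ => ?_)
    simp only
    congr 2
    simp [mul_comm, mul_left_comm, mul_assoc]
  rw [h4, Measure.integral_comp_mul_left (fun y : ℝ => Complex.exp (y * t * Complex.I) * payoffKernel u b y)] at h3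
  have hpi : (0 : ℝ) < 2 * π := by positivity
  rw [abs_of_pos (inv_pos.2 hpi), Complex.real_smul] at h3
  have h5 : ∫ y : ℝ, payoffKernel u b y * Complex.exp (((u : ℂ) + y * Complex.I) * t) =
      Complex.exp (u * t) * ∫ y : ℝ, Complex.exp (y * t * Complex.I) * payoffKernel u b y := by
    rw [← integral_const_mul]
    refine integral_congr_ae (Eventually.of_forall fun y => ?_)
    simp only
    rw [← mul_assoc, ← Complex.exp_add, mul_comm]
    congr 2; ring
  have h6 : ∫ y : ℝ, Complex.exp (y * t * Complex.I) * payoffKernel u b y = 2 * π * g t := by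
    rw [← h3]
    have : (2 * π : ℂ) ≠ 0 := by exact_mod_cast hpi.ne'
    generalize ∫ y : ℝ, Complex.exp (y * t * Complex.I) * payoffKernel u b y = J
    push_cast
    field_simp
  rw [h5, h6, hg]
  simp only
  push_cast
  have h7 : Complex.exp (u * t) * Complex.exp (-u * t) = 1 := by
    rw [← Complex.exp_add]; simp
  linear_combination (2 * π * (reducedPayoff u b t : ℂ)) * h7

variable {Ω : Type*} [MeasurableSpace Ω]

/-- The Fourier-inversion representation of the expected payoff. -/
theorem integral_payoff_eq (P : Measure Ω) [IsProbabilityMeasure P] (Y : ℝ → Ω → ℝ) {ε f k u : ℝ}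
    (hε : 0 < ε) (hY : Measurable (Y ε)) (hf : 0 ≤ f) (hu : u ≠ 0) (hub : u ≠ f * ε)
    (hud : u ∈ dom P Y ε) (hbd : f * ε ∈ dom P Y ε) :
    Integrable (fun ω => max (Real.exp (Y ε ω * f) - Real.exp (k * f)) 0) P ∧
    ((∫ ω, max (Real.exp (Y ε ω * f) - Real.exp (k * f)) 0 ∂P : ℝ) : ℂ) =
      (((if u < f * ε then ∫ ω, Real.exp (f * ε * Y ε ω / ε) ∂P else 0)
        - (if u < 0 then Real.exp (k * f) else 0) : ℝ) : ℂ)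
      + Real.exp (k * f) / (2 * π) * ∫ y : ℝ, payoffKernel u (f * ε) y *
          (cmgf P Y ε ((u : ℂ) + y * Complex.I) * Complex.exp (-(((u : ℂ) + y * Complex.I) * k / ε))) := by
  have hb : 0 ≤ f * ε := mul_nonneg hf hε.le
  have hfY : ∀ ω, Y ε ω * f = f * ε * Y ε ω / ε := fun ω => by field_simp
  have hint : Integrable (fun ω => max (Real.exp (Y ε ω * f) - Real.exp (k * f)) 0) P := by
    refine Integrable.mono' hbd (by fun_prop) (Eventually.of_forall fun ω => ?_)
    rw [Real.norm_eq_abs, abs_of_nonneg (le_max_right _ _)]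
    refine max_le ?_ (Real.exp_pos _).le
    rw [← hfY]
    linarith [Real.exp_pos (k * f)]
  refine ⟨hint, ?_⟩
  -- In terms of (Y - k)/ε the payoff is e^{kf} times the normalised payoff with parameter b = fε.
  set T : Ω → ℝ := fun ω => (Y ε ω - k) / ε with hT
  have hTm : Measurable T := by fun_prop
  -- pointwise identity
  have hpt : ∀ ω, max (Real.exp (Y ε ω * f) - Real.exp (k * f)) 0 =
      (if u < f * ε then Real.exp (f * ε * Y ε ω / ε) else 0) - (if u < 0 then Real.exp (k * f) else 0)
        + Real.exp (k * f) * reducedPayoff u (f * ε) (T ω) := by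
    intro ω
    have h1 : Real.exp (k * f) * Real.exp (f * ε * T ω) = Real.exp (f * ε * Y ε ω / ε) := by
      rw [← Real.exp_add, hT]; congr 1; field_simp; ring
    have h2 : max (Real.exp (Y ε ω * f) - Real.exp (k * f)) 0 =
        Real.exp (k * f) * max (Real.exp (f * ε * T ω) - 1) 0 := by
      rw [mul_max_of_nonneg _ _ (Real.exp_pos _).le, mul_sub, h1, mul_zero, mul_one, hfY]
    rw [h2, reducedPayoff, ← h1]
    split_ifs <;> ring
  -- Fubini
  set Φ : Ω → ℝ → ℂ := fun ω y => payoffKernel u (f * ε) y *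
    Complex.exp (((u : ℂ) + y * Complex.I) * (T ω : ℂ)) with hΦ
  have hexpT : Integrable (fun ω => Real.exp (u * T ω)) P := by
    have h1 : (fun ω => Real.exp (u * T ω)) =
        fun ω => Real.exp (-(u * k / ε)) * Real.exp (u * Y ε ω / ε) := by
      ext ω
      rw [← Real.exp_add, hT]; congr 1; field_simp; ring
    rw [h1]
    exact Integrable.const_mul hud _
  have hcK := continuous_payoffKernel hu hub
  have hΦi : Integrable (Function.uncurry Φ) (P.prod volume) := by
    have hprod := Integrable.mul_prod hexpT (integrable_payoffKernel hu hub).norm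
    refine Integrable.mono' hprod ?_ (Eventually.of_forall fun p => ?_)
    · have hK := hcK.measurable
      apply Measurable.aestronglyMeasurable
      apply Measurable.mul
      · exact hK.comp measurable_snd
      · apply Complex.measurable_exp.comp
        apply Measurable.mul
        · exact (Continuous.measurable (by fun_prop : Continuous fun y : ℝ => (u : ℂ) + y * Complex.I)).comp
            measurable_snd
        · exact Complex.measurable_ofReal.comp (hTm.comp measurable_fst)
    · simp only [Function.uncurry, hΦ, norm_mul, Complex.norm_exp]
      rw [mul_comm]
      gcongr
      simp
  have hswap := integral_integral_swap hΦi
  have hleft : ∀ ω, ∫ y, Φ ω y = 2 * π * (reducedPayoff u (f * ε) (T ω) : ℂ) := fun ω =>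
    integral_payoffKernel hu hub hb (T ω)
  have hright : ∀ y : ℝ, ∫ ω, Φ ω y ∂P = payoffKernel u (f * ε) y *
      (cmgf P Y ε ((u : ℂ) + y * Complex.I) * Complex.exp (-(((u : ℂ) + y * Complex.I) * k / ε))) := by
    intro y
    rw [cmgf, ← integral_mul_const, ← integral_const_mul]
    refine integral_congr_ae (Eventually.of_forall fun ω => ?_)
    simp only [hΦ, hT]
    rw [← Complex.exp_add]
    congr 2
    push_cast
    ring
  simp only [hleft, hright] at hswap
  rw [← hswap, integral_const_mul, integral_complex_ofReal]
  have hred : Integrable (fun ω => Real.exp (k * f) * reducedPayoff u (f * ε) (T ω)) P := by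
    have h1 : (fun ω => Real.exp (k * f) * reducedPayoff u (f * ε) (T ω)) = fun ω =>
        max (Real.exp (Y ε ω * f) - Real.exp (k * f)) 0 -
        ((if u < f * ε then Real.exp (f * ε * Y ε ω / ε) else 0) -
          (if u < 0 then Real.exp (k * f) else 0)) := by
      ext ω; rw [hpt ω]; ring
    rw [h1]
    refine hint.sub (Integrable.sub ?_ (integrable_const _))
    split_ifs
    · exact hbd
    · exact integrable_zero _ _ _
  have hifs : ∫ ω, ((if u < f * ε then Real.exp (f * ε * Y ε ω / ε) else 0) -
      (if u < 0 then Real.exp (k * f) else 0)) ∂P =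
      (if u < f * ε then ∫ ω, Real.exp (f * ε * Y ε ω / ε) ∂P else 0) -
        (if u < 0 then Real.exp (k * f) else 0) := by
    rw [integral_sub _ (integrable_const _)]
    · split_ifs <;> simp
    · split_ifs
      · exact hbd
      · exact integrable_zero _ _ _
  have htot : ∫ ω, max (Real.exp (Y ε ω * f) - Real.exp (k * f)) 0 ∂P =
      ((if u < f * ε then ∫ ω, Real.exp (f * ε * Y ε ω / ε) ∂P else 0) -
        (if u < 0 then Real.exp (k * f) else 0)) +
      Real.exp (k * f) * ∫ ω, reducedPayoff u (f * ε) (T ω) ∂P := by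
    rw [← hifs, ← integral_const_mul, ← integral_add _ hred]
    · exact integral_congr_ae (Eventually.of_forall fun ω => hpt ω)
    · refine Integrable.sub ?_ (integrable_const _)
      split_ifs
      · exact hbd
      · exact integrable_zero _ _ _
  rw [htot]
  have hpi : (2 * π : ℂ) ≠ 0 := by exact_mod_cast (by positivity : (2 * π : ℝ) ≠ 0)
  generalize ∫ ω, reducedPayoff u (f * ε) (T ω) ∂P = J
  rw [Complex.ofReal_add, Complex.ofReal_mul]
  field_simp

end SharpOption

/-! ### Laplace's method to second order -/

namespace SharpOption

theorem integrable_pow_mul_gaussian {b : ℝ} (hb : 0 < b) (p : ℕ) :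
    Integrable (fun x : ℝ => x ^ p * Real.exp (-b * x ^ 2)) := by
  have := integrable_rpow_mul_exp_neg_mul_sq hb (s := p) (by
    have : (0 : ℝ) ≤ p := Nat.cast_nonneg p
    linarith)
  simpa using this

/-- Gaussian moments. -/
def gaussMoment (b : ℝ) (p : ℕ) : ℝ := ∫ x : ℝ, x ^ p * Real.exp (-b * x ^ 2)

theorem gaussMoment_zero (b : ℝ) : gaussMoment b 0 = √(π / b) := by
  simp [gaussMoment, ← integral_gaussian]

theorem gaussMoment_one {b : ℝ} (hb : 0 < b) : gaussMoment b 1 = 0 := by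
  have hd : ∀ x : ℝ, HasDerivAt (fun x => Real.exp (-b * x ^ 2)) (-(2 * b) * (x ^ 1 * Real.exp (-b * x ^ 2))) x := by
    intro x
    have h1 : HasDerivAt (fun x : ℝ => -b * x ^ 2) (-b * (2 * x)) x := by
      simpa using (hasDerivAt_pow 2 x).const_mul (-b)
    convert h1.exp using 1
    ring
  have h := integral_eq_zero_of_hasDerivAt_of_integrable hd
    ((integrable_pow_mul_gaussian hb 1).const_mul _) (by simpa using integrable_pow_mul_gaussian hb 0)
  rw [integral_const_mul] at h
  have : -(2 * b) ≠ 0 := by simpa using hb.ne'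
  exact (mul_eq_zero.1 h).resolve_left this

/-- Integration by parts: the derivative of x^{p+1} e^{-bx²} has integral zero. -/
theorem gaussMoment_add_two {b : ℝ} (hb : 0 < b) (p : ℕ) :
    gaussMoment b (p + 2) = (p + 1) / (2 * b) * gaussMoment b p := by
  have hd : ∀ x : ℝ, HasDerivAt (fun x => x ^ (p + 1) * Real.exp (-b * x ^ 2))
      ((p + 1) * (x ^ p * Real.exp (-b * x ^ 2)) - (2 * b) * (x ^ (p + 2) * Real.exp (-b * x ^ 2))) x := by
    intro x
    have h1 : HasDerivAt (fun x : ℝ => -b * x ^ 2) (-b * (2 * x)) x := by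
      simpa using (hasDerivAt_pow 2 x).const_mul (-b)
    refine ((hasDerivAt_pow (p + 1) x).mul h1.exp).congr_deriv ?_
    rw [Nat.add_sub_cancel]
    push_cast
    ring
  have h1 := (integrable_pow_mul_gaussian hb p).const_mul ((p : ℝ) + 1)
  have h2 := (integrable_pow_mul_gaussian hb (p + 2)).const_mul (2 * b)
  have h := integral_eq_zero_of_hasDerivAt_of_integrable hd (h1.sub h2) (integrable_pow_mul_gaussian hb (p + 1))
  rw [integral_sub h1 h2, integral_const_mul, integral_const_mul] at h
  change (p + 1) * gaussMoment b p - 2 * b * gaussMoment b (p + 2) = 0 at h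
  field_simp
  linarith

/-- Taylor's formula on a disc, extended by zero outside the disc. -/
theorem norm_taylor_le {B : ℂ → ℂ} {ρ M : ℝ} (hρ : 0 < ρ)
    (hB : DifferentiableOn ℂ B (Metric.ball 0 ρ)) (hM : ∀ z ∈ Metric.ball (0 : ℂ) ρ, ‖B z‖ ≤ M)
    (n : ℕ) (z : ℂ) :
    ‖(if ‖z‖ < ρ then B z else 0) -
      ∑ l ∈ Finset.range n, iteratedDeriv l B 0 / (l.factorial : ℂ) * z ^ l‖ ≤
      (n + 1) * (2 / ρ) ^ n * M * ‖z‖ ^ n := by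
  have hM0 : 0 ≤ M := (norm_nonneg _).trans (hM 0 (Metric.mem_ball_self hρ))
  by_cases hz : ‖z‖ < ρ
  · obtain ⟨D, -, hD, hBD, -⟩ := exists_taylor_factor hρ hB hM n
    rw [if_pos hz, hBD z, add_sub_cancel_left, norm_mul, norm_pow, mul_comm]
    have h1 := hD z (by simpa using hz)
    have h2 : (1 : ℝ) ≤ n + 1 := by
      have : (0 : ℝ) ≤ n := Nat.cast_nonneg n
      linarith
    have h3 : 0 ≤ (2 / ρ) ^ n * M := by positivity
    calc ‖D z‖ * ‖z‖ ^ n ≤ ((2 / ρ) ^ n * M) * ‖z‖ ^ n := by gcongr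
      _ ≤ ((n + 1) * ((2 / ρ) ^ n * M)) * ‖z‖ ^ n := by
          have h4 : (2 / ρ) ^ n * M ≤ (n + 1) * ((2 / ρ) ^ n * M) := by nlinarith
          exact mul_le_mul_of_nonneg_right h4 (by positivity)
      _ = _ := by ring
  -- Outside the disc 2‖z‖/ρ ≥ 1, so by Cauchy's estimates every lower Taylor term is dominated by
  -- the power n. The cut-off thus costs no more than the Taylor remainder, and no separate Gaussian
  -- tail bound is needed.
  · rw [if_neg hz, zero_sub, norm_neg]
    push Not at hz
    have hterm : ∀ l ∈ Finset.range n,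
        ‖iteratedDeriv l B 0 / (l.factorial : ℂ) * z ^ l‖ ≤ (2 / ρ) ^ n * M * ‖z‖ ^ n := by
      intro l hl
      have hln : l ≤ n := (Finset.mem_range.1 hl).le
      obtain ⟨D, -, hD, -, hd⟩ := exists_taylor_factor hρ hB hM l
      have h1 := hd 0
      simp only [iteratedDeriv_zero, Nat.factorial_zero, Nat.cast_one, div_one, zero_add] at h1
      rw [← h1, norm_mul, norm_pow]
      have h2 : 1 ≤ 2 / ρ * ‖z‖ := by
        rw [div_mul_eq_mul_div, le_div_iff₀ hρ]
        linarith
      have h3 : (2 / ρ * ‖z‖) ^ l ≤ (2 / ρ * ‖z‖) ^ n := pow_le_pow_right₀ h2 hln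
      calc ‖D 0‖ * ‖z‖ ^ l ≤ ((2 / ρ) ^ l * M) * ‖z‖ ^ l := by
            gcongr; exact hD 0 (Metric.mem_ball_self hρ)
        _ = M * (2 / ρ * ‖z‖) ^ l := by rw [mul_pow]; ring
        _ ≤ M * (2 / ρ * ‖z‖) ^ n := by gcongr
        _ = _ := by rw [mul_pow]; ring
    calc _ ≤ ∑ l ∈ Finset.range n, ‖iteratedDeriv l B 0 / (l.factorial : ℂ) * z ^ l‖ := norm_sum_le _ _
      _ ≤ ∑ l ∈ Finset.range n, (2 / ρ) ^ n * M * ‖z‖ ^ n := Finset.sum_le_sum hterm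
      _ = n * ((2 / ρ) ^ n * M * ‖z‖ ^ n) := by simp
      _ ≤ _ := by
          have : 0 ≤ (2 / ρ) ^ n * M * ‖z‖ ^ n := by positivity
          nlinarith

theorem pow_le_one_add_pow {x : ℝ} (hx : 0 ≤ x) {a b : ℕ} (h : a ≤ b) : x ^ a ≤ 1 + x ^ b := by
  rcases le_total x 1 with h1 | h1
  · have : x ^ a ≤ 1 := pow_le_one₀ hx h1
    have : 0 ≤ x ^ b := pow_nonneg hx b
    linarith
  · have := pow_le_pow_right₀ h1 h
    linarith

/-- The rescaled integrand of Laplace's method, extended by zero. -/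
def laplaceIntegrand (σ ρ : ℝ) (s A : ℂ → ℂ) (t x : ℝ) : ℂ :=
  if ‖(t * x : ℂ) * Complex.I‖ < ρ then
    (Real.exp (-(σ / 2) * x ^ 2) : ℂ) *
      (Complex.exp (t * (x * Complex.I) ^ 3 * s (t * x * Complex.I)) * A (t * x * Complex.I))
  else 0

/-- The polynomial multiplying the Gaussian in the expansion of `laplaceIntegrand`. -/
def laplacePoly (s A : ℂ → ℂ) (t x : ℝ) : ℂ :=
  ∑ j ∈ Finset.range 4, t ^ j * (x * Complex.I) ^ (3 * j) / (j.factorial : ℂ) *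
    ∑ l ∈ Finset.range (4 - j),
      iteratedDeriv l (fun z => s z ^ j * A z) 0 / (l.factorial : ℂ) * (t * x * Complex.I) ^ l

/-- The exponential is expanded to order 4 in w = t(ix)³s, and each sʲA to order 4 - j in t, so
every discarded term carries t⁴. The smallness condition gives ‖w‖ ≤ (σ/4)x², so half of the
Gaussian exponent absorbs e^{‖w‖}. The constant does not depend on A, which may therefore vary with
ε and b. -/
theorem norm_laplaceIntegrand_sub_le {ρ σ S : ℝ} {s : ℂ → ℂ} (hρ : 0 < ρ)
    (hs : DifferentiableOn ℂ s (Metric.ball 0 ρ)) (hS : ∀ z ∈ Metric.ball (0 : ℂ) ρ, ‖s z‖ ≤ S)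
    (hsmall : ∀ z ∈ Metric.ball (0 : ℂ) ρ, ‖z‖ * ‖s z‖ ≤ σ / 4) (hσ : 0 < σ) :
    ∃ C : ℝ, 0 ≤ C ∧ ∀ (A : ℂ → ℂ) (M : ℝ), DifferentiableOn ℂ A (Metric.ball 0 ρ) →
      (∀ z ∈ Metric.ball (0 : ℂ) ρ, ‖A z‖ ≤ M) → ∀ t : ℝ, 0 < t → ∀ x : ℝ,
      ‖laplaceIntegrand σ ρ s A t x - (Real.exp (-(σ / 2) * x ^ 2) : ℂ) * laplacePoly s A t x‖ ≤
        C * M * t ^ 4 * ((1 + x ^ 12) * Real.exp (-(σ / 4) * x ^ 2)) := by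
  have hS0 : 0 ≤ S := (norm_nonneg _).trans (hS 0 (Metric.mem_ball_self hρ))
  -- S⁴ comes from the remainder of the exponential series, the sum from the Taylor remainders of
  -- sʲA.
  refine ⟨S ^ 4 + ∑ j ∈ Finset.range 4, ((4 - j : ℕ) + 1) * (2 / ρ) ^ (4 - j) * S ^ j, by positivity, ?_⟩
  intro A M hA hM t ht x
  have hM0 : 0 ≤ M := (norm_nonneg _).trans (hM 0 (Metric.mem_ball_self hρ))
  set z : ℂ := t * x * Complex.I with hz
  have hzn : ‖z‖ = t * |x| := by
    rw [hz]; simp [abs_of_pos ht]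
  set w : ℂ := t * (x * Complex.I) ^ 3 * s z with hw
  have hgauss : Real.exp (-(σ / 2) * x ^ 2) ≤ Real.exp (-(σ / 4) * x ^ 2) := by
    apply Real.exp_le_exp.2
    nlinarith [sq_nonneg x, mul_nonneg hσ.le (sq_nonneg x)]
  have hx12 : x ^ 12 = |x| ^ 12 := by
    rw [show (12 : ℕ) = 2 * 6 by norm_num, pow_mul, pow_mul, sq_abs]
  have hxI : ‖(x : ℂ) * Complex.I‖ = |x| := by simp
  -- split of the difference
  have hsplit : laplaceIntegrand σ ρ s A t x - (Real.exp (-(σ / 2) * x ^ 2) : ℂ) * laplacePoly s A t x =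
      (Real.exp (-(σ / 2) * x ^ 2) : ℂ) *
        ((if ‖z‖ < ρ then (Complex.exp w - ∑ j ∈ Finset.range 4, w ^ j / (j.factorial : ℂ)) * A z else 0) +
        ∑ j ∈ Finset.range 4, t ^ j * (x * Complex.I) ^ (3 * j) / (j.factorial : ℂ) *
          ((if ‖z‖ < ρ then s z ^ j * A z else 0) - ∑ l ∈ Finset.range (4 - j),
            iteratedDeriv l (fun z => s z ^ j * A z) 0 / (l.factorial : ℂ) * z ^ l)) := by
    unfold laplaceIntegrand laplacePoly
    rw [← hz, ← hw]
    simp only [mul_sub, Finset.sum_sub_distrib]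
    by_cases h : ‖z‖ < ρ
    · simp only [if_pos h]
      have : ∑ j ∈ Finset.range 4, t ^ j * (x * Complex.I) ^ (3 * j) / (j.factorial : ℂ) * (s z ^ j * A z) =
          (∑ j ∈ Finset.range 4, w ^ j / (j.factorial : ℂ)) * A z := by
        rw [Finset.sum_mul]
        refine Finset.sum_congr rfl fun j _ => ?_
        rw [hw, mul_pow _ (s z), mul_pow (t : ℂ), ← pow_mul]
        ring
      rw [this]
      ring
    · simp only [if_neg h]
      simp
  rw [hsplit, norm_mul, Complex.norm_real, Real.norm_eq_abs, abs_of_pos (Real.exp_pos _)]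
  have hE : 0 < Real.exp (-(σ / 4) * x ^ 2) := Real.exp_pos _
  have hE2 : 0 < Real.exp (-(σ / 2) * x ^ 2) := Real.exp_pos _
  have h1 : Real.exp (-(σ / 2) * x ^ 2) *
      ‖(if ‖z‖ < ρ then (Complex.exp w - ∑ j ∈ Finset.range 4, w ^ j / (j.factorial : ℂ)) * A z else 0)‖ ≤
      S ^ 4 * M * t ^ 4 * ((1 + x ^ 12) * Real.exp (-(σ / 4) * x ^ 2)) := by
    by_cases h : ‖z‖ < ρ
    · rw [if_pos h, norm_mul]
      have hzb : z ∈ Metric.ball (0 : ℂ) ρ := by simpa using h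
      have hwn : ‖w‖ = t * |x| ^ 3 * ‖s z‖ := by
        rw [hw, norm_mul, norm_mul, norm_pow, hxI, Complex.norm_real, Real.norm_eq_abs, abs_of_pos ht]
      have hw1 : ‖w‖ ≤ σ / 4 * x ^ 2 := by
        have h2 := hsmall z hzb
        rw [hzn] at h2
        calc ‖w‖ = (t * |x| * ‖s z‖) * |x| ^ 2 := by rw [hwn]; ring
          _ ≤ σ / 4 * |x| ^ 2 := by gcongr
          _ = _ := by rw [sq_abs]
      have hw2 : ‖w‖ ^ 4 ≤ S ^ 4 * t ^ 4 * x ^ 12 := by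
        rw [hwn, hx12]
        calc (t * |x| ^ 3 * ‖s z‖) ^ 4 ≤ (t * |x| ^ 3 * S) ^ 4 := by
              gcongr; exact hS z hzb
          _ = _ := by ring
      have hexp := Complex.norm_exp_sub_sum_le_norm_mul_exp w 4
      have hee : Real.exp (-(σ / 2) * x ^ 2) * Real.exp ‖w‖ ≤ Real.exp (-(σ / 4) * x ^ 2) := by
        rw [← Real.exp_add]
        apply Real.exp_le_exp.2
        linarith
      have hx0 : 0 ≤ x ^ 12 := by rw [hx12]; positivity
      calc _ ≤ Real.exp (-(σ / 2) * x ^ 2) * ((‖w‖ ^ 4 * Real.exp ‖w‖) * M) := by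
            gcongr; exact hM z hzb
        _ = ‖w‖ ^ 4 * M * (Real.exp (-(σ / 2) * x ^ 2) * Real.exp ‖w‖) := by ring
        _ ≤ (S ^ 4 * t ^ 4 * x ^ 12) * M * Real.exp (-(σ / 4) * x ^ 2) := by gcongr
        _ ≤ (S ^ 4 * t ^ 4 * (1 + x ^ 12)) * M * Real.exp (-(σ / 4) * x ^ 2) := by gcongr; linarith
        _ = _ := by ring
    · rw [if_neg h, norm_zero, mul_zero]
      have hx0 : 0 ≤ x ^ 12 := by rw [hx12]; positivity
      positivity
  have h2 : ∀ j ∈ Finset.range 4, Real.exp (-(σ / 2) * x ^ 2) *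
      ‖t ^ j * (x * Complex.I) ^ (3 * j) / (j.factorial : ℂ) *
          ((if ‖z‖ < ρ then s z ^ j * A z else 0) - ∑ l ∈ Finset.range (4 - j),
            iteratedDeriv l (fun z => s z ^ j * A z) 0 / (l.factorial : ℂ) * z ^ l)‖ ≤
      (((4 - j : ℕ) + 1) * (2 / ρ) ^ (4 - j) * S ^ j) * M * t ^ 4 *
        ((1 + x ^ 12) * Real.exp (-(σ / 4) * x ^ 2)) := by
    intro j hj
    have hj4 : j < 4 := Finset.mem_range.1 hj
    have ht1 := norm_taylor_le (B := fun z => s z ^ j * A z) (M := S ^ j * M) hρ ((hs.pow j).mul hA)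
      (fun z hz => by
        rw [norm_mul, norm_pow]
        have := hS z hz
        have := hM z hz
        gcongr) (4 - j) z
    have hfac : ‖(t : ℂ) ^ j * (x * Complex.I) ^ (3 * j) / (j.factorial : ℂ)‖ ≤ t ^ j * |x| ^ (3 * j) := by
      rw [norm_div, norm_mul, norm_pow, norm_pow, hxI, Complex.norm_real, Real.norm_eq_abs, abs_of_pos ht,
        Complex.norm_natCast]
      apply div_le_self (by positivity)
      exact_mod_cast Nat.one_le_iff_ne_zero.2 (Nat.factorial_ne_zero j)
    rw [norm_mul]
    calc _ ≤ Real.exp (-(σ / 4) * x ^ 2) * ((t ^ j * |x| ^ (3 * j)) *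
          (((4 - j : ℕ) + 1) * (2 / ρ) ^ (4 - j) * (S ^ j * M) * ‖z‖ ^ (4 - j))) := by gcongr
      _ = (((4 - j : ℕ) + 1) * (2 / ρ) ^ (4 - j) * S ^ j) * M * (t ^ j * t ^ (4 - j)) *
          ((|x| ^ (3 * j) * |x| ^ (4 - j)) * Real.exp (-(σ / 4) * x ^ 2)) := by
            rw [hzn, mul_pow]; ring
      _ = (((4 - j : ℕ) + 1) * (2 / ρ) ^ (4 - j) * S ^ j) * M * t ^ 4 *
          (|x| ^ (3 * j + (4 - j)) * Real.exp (-(σ / 4) * x ^ 2)) := by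
            rw [← pow_add, ← pow_add, show j + (4 - j) = 4 by omega]
      _ ≤ _ := by
          gcongr
          rw [hx12]
          exact pow_le_one_add_pow (abs_nonneg x) (by omega)
  refine (mul_le_mul_of_nonneg_left (norm_add_le _ _) hE2.le).trans ?_
  rw [mul_add, add_mul, add_mul, add_mul]
  refine add_le_add h1 ?_
  refine (mul_le_mul_of_nonneg_left (norm_sum_le _ _) hE2.le).trans ?_
  rw [Finset.mul_sum, Finset.sum_mul, Finset.sum_mul, Finset.sum_mul]
  exact Finset.sum_le_sum h2

/-- The term with indices j, l carries t^{j+l} and x^{3j+l}, exponents of equal parity. The odd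
powers of t vanish with the odd Gaussian moments, and the t² coefficient collects the moments of
order 2, 4 and 6. -/
theorem integral_gaussian_mul_laplacePoly {σ : ℝ} (hσ : 0 < σ) {s A : ℂ → ℂ} (t : ℝ) :
    Integrable (fun x : ℝ => (Real.exp (-(σ / 2) * x ^ 2) : ℂ) * laplacePoly s A t x) ∧
    ∫ x : ℝ, (Real.exp (-(σ / 2) * x ^ 2) : ℂ) * laplacePoly s A t x =
      (√(2 * π / σ) : ℂ) * (A 0 + t ^ 2 * (-(iteratedDeriv 2 A 0) / (2 * σ) +
        3 * deriv (fun z => s z * A z) 0 / σ ^ 2 - 15 * (s 0 ^ 2 * A 0) / (2 * σ ^ 3))) := by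
  have hb : 0 < σ / 2 := by positivity
  set q : ℕ → ℕ → ℂ := fun j l => t ^ (j + l) * Complex.I ^ (3 * j + l) / (j.factorial : ℂ) *
    (iteratedDeriv l (fun z => s z ^ j * A z) 0 / (l.factorial : ℂ)) with hq
  have hexpand : (fun x : ℝ => (Real.exp (-(σ / 2) * x ^ 2) : ℂ) * laplacePoly s A t x) =
      fun x : ℝ => ∑ j ∈ Finset.range 4, ∑ l ∈ Finset.range (4 - j),
        q j l * ((x ^ (3 * j + l) * Real.exp (-(σ / 2) * x ^ 2) : ℝ) : ℂ) := by
    ext x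
    unfold laplacePoly
    rw [Finset.mul_sum]
    refine Finset.sum_congr rfl fun j _ => ?_
    rw [Finset.mul_sum, Finset.mul_sum]
    refine Finset.sum_congr rfl fun l _ => ?_
    rw [hq]
    push_cast
    ring
  have hint : ∀ j l : ℕ, Integrable (fun x : ℝ =>
      q j l * ((x ^ (3 * j + l) * Real.exp (-(σ / 2) * x ^ 2) : ℝ) : ℂ)) := fun j l =>
    ((integrable_pow_mul_gaussian hb (3 * j + l)).ofReal).const_mul _
  rw [hexpand]
  refine ⟨integrable_finsetSum _ fun j _ => integrable_finsetSum _ fun l _ => hint j l, ?_⟩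
  rw [integral_finsetSum _ fun j _ => integrable_finsetSum _ fun l _ => hint j l]
  have hterm : ∀ j l : ℕ, ∫ x : ℝ, q j l * ((x ^ (3 * j + l) * Real.exp (-(σ / 2) * x ^ 2) : ℝ) : ℂ) =
      q j l * (gaussMoment (σ / 2) (3 * j + l) : ℂ) := by
    intro j l
    rw [integral_const_mul, integral_complex_ofReal, gaussMoment]
  have hsum : ∀ j ∈ Finset.range 4, ∫ x : ℝ, ∑ l ∈ Finset.range (4 - j),
      q j l * ((x ^ (3 * j + l) * Real.exp (-(σ / 2) * x ^ 2) : ℝ) : ℂ) =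
      ∑ l ∈ Finset.range (4 - j), q j l * (gaussMoment (σ / 2) (3 * j + l) : ℂ) := by
    intro j _
    rw [integral_finsetSum _ fun l _ => hint j l]
    exact Finset.sum_congr rfl fun l _ => hterm j l
  rw [Finset.sum_congr rfl hsum]
  have m0 : gaussMoment (σ / 2) 0 = √(2 * π / σ) := by
    rw [gaussMoment_zero]; congr 1; field_simp
  have m1 := gaussMoment_one hb
  have m2 := gaussMoment_add_two hb 0
  have m3 := gaussMoment_add_two hb 1
  have m4 := gaussMoment_add_two hb 2
  have m5 := gaussMoment_add_two hb 3
  have m6 := gaussMoment_add_two hb 4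
  have m7 := gaussMoment_add_two hb 5
  have m9 := gaussMoment_add_two hb 7
  norm_num [m1] at m2 m3
  norm_num [m3] at m5
  norm_num [m5] at m7
  norm_num [m7] at m9
  norm_num at m4 m6
  rw [m2] at m4
  rw [m4] at m6
  have hI3 : Complex.I ^ 3 = -Complex.I := Complex.I_pow_three
  have hI2 := Complex.I_sq
  have hI4 := Complex.I_pow_four
  have hI6 : Complex.I ^ 6 = -1 := by
    rw [show (6 : ℕ) = 4 + 2 by norm_num, pow_add, hI4, hI2]; ring
  have hσc : (σ : ℂ) ≠ 0 := by exact_mod_cast hσ.ne'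
  simp only [Finset.sum_range_succ, Finset.sum_range_zero]
  norm_num [m1, m2, m3, m4, m5, m6, m7, m9, m0, hq, Nat.factorial, hI4, hI6, iteratedDeriv_one, iteratedDeriv_zero]
  field_simp
  ring

/-- Laplace's method to second order, uniformly in the amplitude. -/
theorem laplace_expansion {ρ σ S : ℝ} {s : ℂ → ℂ} (hρ : 0 < ρ)
    (hs : DifferentiableOn ℂ s (Metric.ball 0 ρ)) (hS : ∀ z ∈ Metric.ball (0 : ℂ) ρ, ‖s z‖ ≤ S)
    (hsmall : ∀ z ∈ Metric.ball (0 : ℂ) ρ, ‖z‖ * ‖s z‖ ≤ σ / 4) (hσ : 0 < σ) :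
    ∃ C : ℝ, 0 ≤ C ∧ ∀ (A : ℂ → ℂ) (M : ℝ), DifferentiableOn ℂ A (Metric.ball 0 ρ) →
      (∀ z ∈ Metric.ball (0 : ℂ) ρ, ‖A z‖ ≤ M) → ∀ t : ℝ, 0 < t →
      ‖(∫ x : ℝ, laplaceIntegrand σ ρ s A t x) -
        (√(2 * π / σ) : ℂ) * (A 0 + t ^ 2 * (-(iteratedDeriv 2 A 0) / (2 * σ) +
          3 * deriv (fun z => s z * A z) 0 / σ ^ 2 - 15 * (s 0 ^ 2 * A 0) / (2 * σ ^ 3)))‖ ≤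
        C * M * t ^ 4 := by
  obtain ⟨C, hC, hbound⟩ := norm_laplaceIntegrand_sub_le hρ hs hS hsmall hσ
  have hb : 0 < σ / 4 := by positivity
  have hEi : Integrable (fun x : ℝ => (1 + x ^ 12) * Real.exp (-(σ / 4) * x ^ 2)) := by
    have := (integrable_pow_mul_gaussian hb 0).add (integrable_pow_mul_gaussian hb 12)
    refine this.congr (Eventually.of_forall fun x => ?_)
    simp only [Pi.add_apply]
    ring
  refine ⟨C * ∫ x : ℝ, (1 + x ^ 12) * Real.exp (-(σ / 4) * x ^ 2),
    mul_nonneg hC (integral_nonneg fun x => by positivity), ?_⟩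
  intro A M hA hM t ht
  obtain ⟨hPi, hPe⟩ := integral_gaussian_mul_laplacePoly (s := s) (A := A) hσ t
  have hmeas : AEStronglyMeasurable (laplaceIntegrand σ ρ s A t) volume := by
    have hmap : MapsTo (fun x : ℝ => (t * x : ℂ) * Complex.I) {x : ℝ | ‖(t * x : ℂ) * Complex.I‖ < ρ}
        (Metric.ball 0 ρ) := fun x hx => by simpa using hx
    have hset : MeasurableSet {x : ℝ | ‖(t * x : ℂ) * Complex.I‖ < ρ} :=
      measurableSet_lt (by fun_prop) measurable_const
    have hsc := hs.continuousOn.comp (by fun_prop : ContinuousOn (fun x : ℝ => (t * x : ℂ) * Complex.I) _) hmap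
    have hAc := hA.continuousOn.comp (by fun_prop : ContinuousOn (fun x : ℝ => (t * x : ℂ) * Complex.I) _) hmap
    have hcont : ContinuousOn (fun x : ℝ => (Real.exp (-(σ / 2) * x ^ 2) : ℂ) *
      (Complex.exp (t * (x * Complex.I) ^ 3 * s (t * x * Complex.I)) * A (t * x * Complex.I)))
        {x : ℝ | ‖(t * x : ℂ) * Complex.I‖ < ρ} := by
      refine ContinuousOn.mul (by fun_prop) (ContinuousOn.mul ?_ hAc)
      exact Complex.continuous_exp.comp_continuousOn (ContinuousOn.mul (by fun_prop) hsc)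
    have := (aestronglyMeasurable_indicator_iff (μ := volume) hset).2 (hcont.aestronglyMeasurable hset)
    refine this.congr (Eventually.of_forall fun x => ?_)
    simp only [laplaceIntegrand, indicator, mem_ofPred_eq]
  have hdi : Integrable (fun x : ℝ => laplaceIntegrand σ ρ s A t x -
      (Real.exp (-(σ / 2) * x ^ 2) : ℂ) * laplacePoly s A t x) :=
    Integrable.mono' (hEi.const_mul (C * M * t ^ 4)) (hmeas.sub hPi.aestronglyMeasurable)
      (Eventually.of_forall fun x => hbound A M hA hM t ht x)
  have hLi : Integrable (laplaceIntegrand σ ρ s A t) := by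
    refine (hdi.add hPi).congr (Eventually.of_forall fun x => ?_)
    simp
  rw [← hPe, ← integral_sub hLi hPi]
  calc _ ≤ ∫ x : ℝ, C * M * t ^ 4 * ((1 + x ^ 12) * Real.exp (-(σ / 4) * x ^ 2)) :=
        norm_integral_le_of_norm_le (hEi.const_mul _)
          (Eventually.of_forall fun x => hbound A M hA hM t ht x)
    _ = _ := by rw [integral_const_mul]; ring

end SharpOption

/-! ### Consequences of the standing assumptions -/

namespace SharpOption

variable {Ω : Type*} [MeasurableSpace Ω]

theorem cmgf_eq_complexMGF (P : Measure Ω) (Y : ℝ → Ω → ℝ) (ε : ℝ) (z : ℂ) :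
    cmgf P Y ε z = complexMGF (Y ε) P (z / ε) := by
  unfold cmgf complexMGF
  refine integral_congr_ae (Eventually.of_forall fun ω => ?_)
  simp only
  congr 1; ring

theorem cmgf_ofReal (P : Measure Ω) (Y : ℝ → Ω → ℝ) (ε x : ℝ) :
    cmgf P Y ε x = ((∫ ω, Real.exp (x * Y ε ω / ε) ∂P : ℝ) : ℂ) := by
  unfold cmgf
  rw [← integral_complex_ofReal]
  refine integral_congr_ae (Eventually.of_forall fun ω => ?_)
  simp

theorem integral_exp_pos_of_mem_dom (P : Measure Ω) [IsProbabilityMeasure P] {Y : ℝ → Ω → ℝ} {ε x : ℝ}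
    (h : x ∈ dom P Y ε) : 0 < ∫ ω, Real.exp (x * Y ε ω / ε) ∂P :=
  integral_exp_pos h

theorem norm_cmgf_le (P : Measure Ω) (Y : ℝ → Ω → ℝ) (ε : ℝ) (z : ℂ) :
    ‖cmgf P Y ε z‖ ≤ ∫ ω, Real.exp (z.re * Y ε ω / ε) ∂P := by
  unfold cmgf
  refine (norm_integral_le_integral_norm _).trans_eq ?_
  refine integral_congr_ae (Eventually.of_forall fun ω => ?_)
  simp only [Complex.norm_exp]
  congr 1
  rw [Complex.div_ofReal_re, Complex.re_mul_ofReal]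

theorem reLmgf_ofReal (P : Measure Ω) [IsProbabilityMeasure P] {Y : ℝ → Ω → ℝ} {ε x : ℝ}
    (h : x ∈ dom P Y ε) : reLmgf P Y ε x = lmgf P Y ε x := by
  rw [reLmgf, lmgf, cmgf_ofReal, Complex.norm_real, Real.norm_eq_abs,
    abs_of_pos (integral_exp_pos_of_mem_dom P h)]

theorem norm_cmgf_eq_exp {P : Measure Ω} {Y : ℝ → Ω → ℝ} {ε : ℝ} {z : ℂ} (hε : ε ≠ 0)
    (h : cmgf P Y ε z ≠ 0) : ‖cmgf P Y ε z‖ = Real.exp (reLmgf P Y ε z / ε) := by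
  rw [reLmgf, mul_div_cancel_left₀ _ hε, Real.exp_log (norm_pos_iff.2 h)]

/-- Rescaling by ε carries an open set of finite exponential moments into the interior of the
integrability set, over which the complex moment generating function is holomorphic. -/
theorem differentiableAt_cmgf {P : Measure Ω} {Y : ℝ → Ω → ℝ} {ε : ℝ} (hε : 0 < ε) {U : Set ℝ}
    (hU : IsOpen U) (hUd : U ⊆ dom P Y ε) {z : ℂ} (hz : z.re ∈ U) :
    DifferentiableAt ℂ (cmgf P Y ε) z := by
  have h1 : cmgf P Y ε = fun z => complexMGF (Y ε) P (z / ε) := funext (cmgf_eq_complexMGF P Y ε)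
  rw [h1]
  have h2 : (z / (ε : ℂ)).re ∈ interior (integrableExpSet (Y ε) P) := by
    rw [mem_interior]
    refine ⟨(fun t => t * ε) ⁻¹' U, fun t ht => ?_, hU.preimage (by fun_prop), ?_⟩
    · have h3 := hUd ht
      change Integrable _ P at h3
      change Integrable _ P
      refine h3.congr (Eventually.of_forall fun ω => ?_)
      simp only
      congr 1
      field_simp
    · rw [mem_preimage, Complex.div_ofReal_re, div_mul_cancel₀ _ hε.ne']
      exact hz
  have h3 := (hasDerivAt_complexMGF h2).differentiableAt
  exact DifferentiableAt.comp (g := complexMGF (Y ε) P) (f := fun z : ℂ => z / ε) z h3 (by fun_prop)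

section Admissible

variable {P : Measure Ω} {Y : ℝ → Ω → ℝ} {Λ₀ Λ₁ Λ₂ : ℝ → ℝ}

theorem isOpen_domZeroInt (P : Measure Ω) (Y : ℝ → Ω → ℝ) : IsOpen (domZeroInt P Y) := isOpen_interior

theorem Admissible.tendsto_lmgf (hΛ : Admissible P Y Λ₀ Λ₁ Λ₂) {u : ℝ} (hu : u ∈ domZeroInt P Y) :
    Tendsto (fun ε => lmgf P Y ε u) (𝓝[>] 0) (𝓝 (Λ₀ u)) := by
  obtain ⟨C, ε₁, hε₁, h⟩ := hΛ.expansion {u} isCompact_singleton (by simpa using hu)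
  have h2 : Tendsto (fun ε => lmgf P Y ε u - (Λ₀ u + Λ₁ u * ε + Λ₂ u * ε ^ 2)) (𝓝[>] 0) (𝓝 0) := by
    rw [tendsto_zero_iff_norm_tendsto_zero]
    refine squeeze_zero' (Eventually.of_forall fun _ => norm_nonneg _)
      ((Ioo_mem_nhdsGT hε₁ : Ioo 0 ε₁ ∈ 𝓝[>] (0 : ℝ)) |> fun hm => (eventually_of_mem hm
        fun ε hε => h ε hε u (mem_singleton u))) ?_
    have : Tendsto (fun ε : ℝ => C * ε ^ 3) (𝓝 0) (𝓝 (C * 0 ^ 3)) :=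
      (by fun_prop : Continuous fun ε : ℝ => C * ε ^ 3).tendsto 0
    rw [zero_pow (by norm_num), mul_zero] at this
    exact this.mono_left nhdsWithin_le_nhds
  have h3 : Tendsto (fun ε : ℝ => Λ₀ u + Λ₁ u * ε + Λ₂ u * ε ^ 2) (𝓝[>] 0) (𝓝 (Λ₀ u)) := by
    have : Tendsto (fun ε : ℝ => Λ₀ u + Λ₁ u * ε + Λ₂ u * ε ^ 2) (𝓝 0)
        (𝓝 (Λ₀ u + Λ₁ u * 0 + Λ₂ u * 0 ^ 2)) :=
      (by fun_prop : Continuous fun ε : ℝ => Λ₀ u + Λ₁ u * ε + Λ₂ u * ε ^ 2).tendsto 0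
    simp only [mul_zero, ne_eq, OfNat.ofNat_ne_zero, not_false_eq_true, zero_pow, add_zero] at this
    exact this.mono_left nhdsWithin_le_nhds
  have h4 := h2.add h3
  simpa using h4

theorem Admissible.monotoneOn_deriv (hΛ : Admissible P Y Λ₀ Λ₁ Λ₂) :
    MonotoneOn (deriv Λ₀) (domZeroInt P Y) := by
  have := hΛ.strictConvex.convexOn.monotoneOn_deriv (hΛ.essSmooth.differentiable)
  exact this

/-- Monotonicity of Λ₀' turns comparisons of the strike with Λ₀'(0) and Λ₀'(c) into comparisons of
the saddlepoint with the poles 0 and c. -/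
theorem Admissible.lt_iff_lt_deriv (hΛ : Admissible P Y Λ₀ Λ₁ Λ₂) {u v : ℝ} (hu : u ∈ domZeroInt P Y)
    (hv : v ∈ domZeroInt P Y) (hne : deriv Λ₀ u ≠ deriv Λ₀ v) : deriv Λ₀ u < deriv Λ₀ v ↔ u < v := by
  constructor
  · intro h
    by_contra! hc
    exact absurd (hΛ.monotoneOn_deriv hv hu hc) (not_le.2 h)
  · intro h
    exact lt_of_le_of_ne (hΛ.monotoneOn_deriv hu hv h.le) hne

/-- A convex function lies above its tangents, so the supremum is attained where the slope is the
given one. -/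
theorem Admissible.legendre_eq (hΛ : Admissible P Y Λ₀ Λ₁ Λ₂) {u : ℝ} (hu : u ∈ domZeroInt P Y) :
    legendre (domZeroInt P Y) Λ₀ (deriv Λ₀ u) = u * deriv Λ₀ u - Λ₀ u := by
  refine IsGreatest.csSup_eq ⟨mem_image_of_mem _ hu, ?_⟩
  rintro _ ⟨v, hv, rfl⟩
  have hc := hΛ.strictConvex.convexOn
  have hd := hΛ.essSmooth.differentiable u hu
  simp only
  rcases lt_trichotomy u v with h | h | h
  · have h1 := hc.deriv_le_slope hu hv h hd
    rw [slope_def_field, le_div_iff₀ (by linarith)] at h1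
    linarith
  · rw [h]
  · have h1 := hc.slope_le_deriv hv hu h hd
    rw [slope_def_field, div_le_iff₀ (by linarith)] at h1
    linarith

variable [IsProbabilityMeasure P]

theorem Admissible.reLmgfZero_ofReal (hΛ : Admissible P Y Λ₀ Λ₁ Λ₂) {u : ℝ} (hu : u ∈ domZeroInt P Y) :
    reLmgfZero P Y u = Λ₀ u := by
  obtain ⟨ε₀, hε₀, hdom, -⟩ := hΛ.smooth
  refine Tendsto.limUnder_eq ((hΛ.tendsto_lmgf hu).congr' ?_)
  filter_upwards [(Ioo_mem_nhdsGT hε₀ : Ioo 0 ε₀ ∈ 𝓝[>] (0 : ℝ))] with ε hε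
  exact (reLmgf_ofReal P (hdom ε hε hu)).symm

/-- Away from the real axis the transform is exponentially smaller than at the saddlepoint. -/
theorem Admissible.exists_far_bound (hΛ : Admissible P Y Λ₀ Λ₁ Λ₂) {u : ℝ} (hu : u ∈ domZeroInt P Y)
    (hu0 : u ≠ 0) {ρ : ℝ} (hρ : 0 < ρ) :
    ∃ η > 0, ∃ C : ℝ, 0 ≤ C ∧ ∃ ε₁ > 0, ∀ ε ∈ Ioo (0 : ℝ) ε₁, ∀ y : ℝ, ρ ≤ |y| →
      ‖cmgf P Y ε ((u : ℂ) + y * Complex.I)‖ ≤ C * Real.exp ((Λ₀ u - η) / ε) := by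
  have hmk : ∀ y : ℝ, (⟨u, y⟩ : ℂ) = (u : ℂ) + y * Complex.I := fun y => by
    apply Complex.ext <;> simp
  have hL0 : reLmgfZero P Y ⟨u, 0⟩ = Λ₀ u := by
    rw [hmk]; simpa using hΛ.reLmgfZero_ofReal hu
  obtain ⟨ε₀, hε₀, hdom, -⟩ := hΛ.smooth
  obtain ⟨δ, hδ, R₀, haway⟩ := hΛ.tail.away u hu hu0
  obtain ⟨ε₁, hε₁, p, hp, M, htail⟩ := hΛ.tail.tail u hu hu0
  -- Beyond R both tail conditions apply. On ρ ≤ |y| ≤ R the limit is continuous as a uniform limit,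
  -- so it attains its maximum, which lies strictly below the value at 0.
  set R : ℝ := max ρ (max R₀ p) with hR
  set I₀ : Set ℝ := {y | ρ ≤ |y| ∧ |y| ≤ R} with hI₀
  have hI₀c : IsCompact I₀ := by
    refine Metric.isCompact_of_isClosed_isBounded ?_ ?_
    · exact (isClosed_le continuous_const continuous_abs).inter (isClosed_le continuous_abs continuous_const)
    · refine (Metric.isBounded_closedBall (x := (0 : ℝ)) (r := R)).subset fun y hy => ?_
      simpa using hy.2
  have hcont : Continuous (fun y : ℝ => (⟨u, y⟩ : ℂ)) := by
    simp only [hmk]; fun_prop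
  obtain ⟨C₀, ε₂, hε₂, happ⟩ := hΛ.tail.approx ((fun y : ℝ => (⟨u, y⟩ : ℂ)) '' I₀) (hI₀c.image hcont)
    (by rintro _ ⟨y, -, rfl⟩; exact ⟨hu, hu0⟩)
  have happ' : ∀ ε ∈ Ioo (0 : ℝ) ε₂, ∀ y ∈ I₀, cmgf P Y ε ⟨u, y⟩ ≠ 0 ∧
      |reLmgf P Y ε ⟨u, y⟩ - reLmgfZero P Y ⟨u, y⟩| ≤ C₀ * ε :=
    fun ε hε y hy => happ ε hε _ (mem_image_of_mem _ hy)
  -- continuity of the limit on the compact set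
  have hLc : ContinuousOn (fun y : ℝ => reLmgfZero P Y ⟨u, y⟩) I₀ := by
    have hunif : TendstoUniformlyOn (fun ε (y : ℝ) => reLmgf P Y ε ⟨u, y⟩)
        (fun y : ℝ => reLmgfZero P Y ⟨u, y⟩) (𝓝[>] 0) I₀ := by
      rw [Metric.tendstoUniformlyOn_iff]
      intro e he
      have h1 : Tendsto (fun ε : ℝ => C₀ * ε) (𝓝[>] 0) (𝓝 0) := by
        have : Tendsto (fun ε : ℝ => C₀ * ε) (𝓝 0) (𝓝 (C₀ * 0)) := (continuous_const.mul continuous_id).tendsto 0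
        rw [mul_zero] at this
        exact this.mono_left nhdsWithin_le_nhds
      filter_upwards [h1.eventually_lt_const he, (Ioo_mem_nhdsGT hε₂ : Ioo 0 ε₂ ∈ 𝓝[>] (0 : ℝ))] with ε h2 hε y hy
      rw [dist_comm, Real.dist_eq]
      exact ((happ' ε hε y hy).2).trans_lt h2
    refine hunif.continuousOn (Eventually.frequently ?_)
    filter_upwards [(Ioo_mem_nhdsGT hε₂ : Ioo 0 ε₂ ∈ 𝓝[>] (0 : ℝ)),
      (Ioo_mem_nhdsGT hε₀ : Ioo 0 ε₀ ∈ 𝓝[>] (0 : ℝ))] with ε hε hε'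
    intro y hy
    unfold reLmgf
    have h1 : ContinuousAt (fun y : ℝ => cmgf P Y ε ⟨u, y⟩) y :=
      ContinuousAt.comp (f := fun y : ℝ => (⟨u, y⟩ : ℂ)) (g := cmgf P Y ε)
        (differentiableAt_cmgf hε.1 (isOpen_domZeroInt P Y) (hdom ε hε') hu).continuousAt hcont.continuousAt
    exact (continuousAt_const.mul (h1.norm.log (norm_ne_zero_iff.2 (happ' ε hε y hy).1))).continuousWithinAt
  have hne : I₀.Nonempty := ⟨R, by
    have : 0 < R := hρ.trans_le (le_max_left _ _)
    rw [hI₀, mem_ofPred_eq, abs_of_pos this]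
    exact ⟨le_max_left _ _, le_rfl⟩⟩
  obtain ⟨y₀, hy₀, hmax⟩ := hI₀c.exists_isMaxOn hne hLc
  have hy₀0 : y₀ ≠ 0 := by
    rintro rfl
    have := hy₀.1
    rw [abs_zero] at this
    linarith
  have hlt := hΛ.tail.unique_max u hu hu0 y₀ hy₀0
  set η₁ : ℝ := reLmgfZero P Y ⟨u, 0⟩ - reLmgfZero P Y ⟨u, y₀⟩ with hη₁
  have hη₁pos : 0 < η₁ := by rw [hη₁]; linarith
  refine ⟨min η₁ δ, lt_min hη₁pos hδ, Real.exp (max C₀ M), (Real.exp_pos _).le, min ε₁ ε₂, lt_min hε₁ hε₂, ?_⟩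
  intro ε hε y hy
  have hεpos := hε.1
  rw [← hmk]
  by_cases hz : cmgf P Y ε ⟨u, y⟩ = 0
  · rw [hz, norm_zero]; positivity
  rw [norm_cmgf_eq_exp hεpos.ne' hz, ← Real.exp_add]
  apply Real.exp_le_exp.2
  have hgoal : reLmgf P Y ε ⟨u, y⟩ ≤ Λ₀ u - min η₁ δ + max C₀ M * ε := by
    by_cases hyR : |y| ≤ R
    · have h1 := abs_le.1 (happ' ε ⟨hεpos, hε.2.trans_le (min_le_right _ _)⟩ y ⟨hy, hyR⟩).2
      have h2 : reLmgfZero P Y ⟨u, y⟩ ≤ reLmgfZero P Y ⟨u, y₀⟩ := hmax (⟨hy, hyR⟩ : y ∈ I₀)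
      have h3 : C₀ * ε ≤ max C₀ M * ε := by gcongr; exact le_max_left _ _
      have h4 := min_le_left η₁ δ
      linarith [h1.2]
    · push Not at hyR
      have h1 := htail y (((le_max_right _ _).trans (le_max_right _ _)).trans hyR.le) ε
        ⟨hεpos, (hε.2.trans_le (min_le_left _ _)).le⟩ hz
      have h2 := haway y (((le_max_left _ _).trans (le_max_right _ _)).trans hyR.le)
      have h3 : M * ε ≤ max C₀ M * ε := by gcongr; exact le_max_right _ _
      have h4 := min_le_right η₁ δ
      linarith
  rw [div_le_iff₀ hεpos, add_mul, div_mul_cancel₀ _ hεpos.ne']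
  linarith

/-- Local holomorphic expansion of the logarithm of the transform around a real point. -/
theorem Admissible.exists_local_expansion (hΛ : Admissible P Y Λ₀ Λ₁ Λ₂) {u : ℝ}
    (hu : u ∈ domZeroInt P Y) (hu0 : u ≠ 0) :
    ∃ (ρ C ε₁ : ℝ) (G₀ G₁ : ℂ → ℂ) (H : ℝ → ℂ → ℂ), 0 < ρ ∧ 0 < C ∧ 0 < ε₁ ∧ ε₁ ≤ 1 ∧
      DifferentiableOn ℂ G₀ (Metric.ball 0 ρ) ∧ DifferentiableOn ℂ G₁ (Metric.ball 0 ρ) ∧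
      (∀ x : ℝ, |x| < ρ → G₀ x = Λ₀ (u + x) ∧ G₁ x = Λ₁ (u + x) ∧ u + x ∈ domZeroInt P Y) ∧
      (∀ z ∈ Metric.ball (0 : ℂ) ρ, (G₀ z).re ≤ Λ₀ (u + z.re)) ∧
      ∀ ε ∈ Ioo 0 ε₁, DifferentiableOn ℂ (H ε) (Metric.ball 0 ρ) ∧
        (∀ z ∈ Metric.ball (0 : ℂ) ρ, ‖H ε z‖ ≤ C ∧
          cmgf P Y ε (u + z) = Complex.exp ((G₀ z + ε * G₁ z + ε ^ 2 * H ε z) / ε)) ∧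
        ‖H ε 0 - Λ₂ u‖ ≤ C * ε := by
  have hUo := isOpen_domZeroInt P Y
  obtain ⟨R, hR, hRsub⟩ : ∃ R > 0, Metric.closedBall u R ⊆ domZeroInt P Y \ {0} :=
    Metric.nhds_basis_closedBall.mem_iff.1 ((hUo.sdiff isClosed_singleton).mem_nhds ⟨hu, hu0⟩)
  obtain ⟨ε₀, hε₀, hdom, -⟩ := hΛ.smooth
  have hre : ∀ z ∈ Metric.closedBall (0 : ℂ) R, u + z.re ∈ Metric.closedBall u R := by
    intro z hz
    rw [Metric.mem_closedBall, Real.dist_eq, add_sub_cancel_left]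
    exact (Complex.abs_re_le_norm z).trans (by simpa using hz)
  obtain ⟨C₀, ε₂, hε₂, happ⟩ := hΛ.tail.approx ((fun z : ℂ => u + z) '' Metric.closedBall 0 R)
    ((isCompact_closedBall _ _).image (by fun_prop)) (by
      rintro _ ⟨z, hz, rfl⟩
      have := hRsub (hre z hz)
      simpa using this)
  obtain ⟨C₁, ε₃, hε₃, hexp⟩ := hΛ.expansion (Metric.closedBall u R) (isCompact_closedBall _ _)
    (hRsub.trans sdiff_subset)
  set ε₁ : ℝ := min (min ε₀ 1) (min ε₂ ε₃) with hε₁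
  have hε₁pos : 0 < ε₁ := lt_min (lt_min hε₀ one_pos) (lt_min hε₂ hε₃)
  have hm0 : ∀ ε ∈ Ioo 0 ε₁, ε ∈ Ioo 0 ε₀ := fun ε hε =>
    ⟨hε.1, hε.2.trans_le ((min_le_left _ _).trans (min_le_left _ _))⟩
  have hm2 : ∀ ε ∈ Ioo 0 ε₁, ε ∈ Ioo 0 ε₂ := fun ε hε =>
    ⟨hε.1, hε.2.trans_le ((min_le_right _ _).trans (min_le_left _ _))⟩
  have hm3 : ∀ ε ∈ Ioo 0 ε₁, ε ∈ Ioo 0 ε₃ := fun ε hε =>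
    ⟨hε.1, hε.2.trans_le ((min_le_right _ _).trans (min_le_right _ _))⟩
  have hcb : Metric.ball (0 : ℂ) R ⊆ Metric.closedBall 0 R := Metric.ball_subset_closedBall
  have hxU : ∀ x : ℝ, |x| < R → u + x ∈ Metric.closedBall u R := fun x hx => by
    simpa [Real.dist_eq] using hx.le
  -- logarithms
  have hlog : ∀ ε : ℝ, ∃ F : ℂ → ℂ, ε ∈ Ioo 0 ε₁ → DifferentiableOn ℂ F (Metric.ball 0 R) ∧
      (∀ z ∈ Metric.ball (0 : ℂ) R, Complex.exp (F z) = cmgf P Y ε (u + z)) ∧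
      ∀ x : ℝ, |x| < R → F x = (Real.log (∫ ω, Real.exp ((u + x) * Y ε ω / ε) ∂P) : ℂ) := by
    intro ε
    by_cases hε : ε ∈ Ioo 0 ε₁
    · obtain ⟨F, h1, h2, h3⟩ := exists_log_branch (M := fun z => cmgf P Y ε (u + z))
        (m := fun x => ∫ ω, Real.exp ((u + x) * Y ε ω / ε) ∂P) hR
        (fun z hz => by
          have hz' := hRsub (hre z (hcb hz))
          have : DifferentiableAt ℂ (cmgf P Y ε) (u + z) :=
            differentiableAt_cmgf hε.1 hUo (hdom ε (hm0 ε hε)) (by simpa using hz'.1)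
          exact (DifferentiableAt.comp z this (by fun_prop)).differentiableWithinAt)
        (fun z hz => (happ ε (hm2 ε hε) _ (mem_image_of_mem _ (hcb hz))).1)
        (fun x hx => ⟨by rw [← cmgf_ofReal]; push_cast; rfl,
          integral_exp_pos_of_mem_dom P (hdom ε (hm0 ε hε) (hRsub (hxU x hx)).1)⟩)
      exact ⟨F, fun _ => ⟨h1, h2, h3⟩⟩
    · exact ⟨0, fun h => absurd h hε⟩
  choose F hF using hlog
  have hFre : ∀ ε ∈ Ioo 0 ε₁, ∀ z ∈ Metric.ball (0 : ℂ) R, ((ε : ℂ) * F ε z).re = reLmgf P Y ε (u + z) := by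
    intro ε hε z hz
    rw [reLmgf, ← (hF ε hε).2.1 z hz, Complex.norm_exp, Real.log_exp, Complex.re_ofReal_mul]
  have hFreal : ∀ ε ∈ Ioo 0 ε₁, ∀ x : ℝ, |x| < R → (ε : ℂ) * F ε x = (lmgf P Y ε (u + x) : ℂ) := by
    intro ε hε x hx
    rw [(hF ε hε).2.2 x hx, lmgf]; push_cast; rfl
  set C : ℝ := max (max C₀ C₁) 1 with hC
  obtain ⟨ρ, C', G₀, G₁, H, hρ, hρR, hC', hG₀, hG₁, hGr, hH⟩ :=
    exists_holomorphic_expansion (F := fun ε z => (ε : ℂ) * F ε z) (R := R) (ε₁ := ε₁) (C := C)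
      (r₀ := fun z => reLmgfZero P Y (u + z)) (a₀ := fun x => Λ₀ (u + x)) (a₁ := fun x => Λ₁ (u + x))
      (a₂ := fun x => Λ₂ (u + x)) hR hε₁pos ((min_le_left _ _).trans (min_le_right _ _))
      (by positivity) (fun ε hε => (hF ε hε).1.const_mul _)
      (fun ε hε z hz => by
        rw [hFre ε hε z hz]
        refine (happ ε (hm2 ε hε) _ (mem_image_of_mem _ (hcb hz))).2.trans ?_
        have := hε.1
        gcongr
        exact (le_max_left _ _).trans (le_max_left _ _))
      (fun ε hε x hx => ⟨_, hFreal ε hε x hx, by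
        refine (hexp ε (hm3 ε hε) _ (hxU x hx)).trans ?_
        have := hε.1
        gcongr
        exact (le_max_right _ _).trans (le_max_left _ _)⟩)
  have hsub : Metric.ball (0 : ℂ) ρ ⊆ Metric.ball 0 R := Metric.ball_subset_ball hρR
  refine ⟨ρ, C', ε₁, G₀, G₁, H, hρ, hC', hε₁pos, (min_le_left _ _).trans (min_le_right _ _), hG₀, hG₁,
    fun x hx => ⟨(hGr x hx).1, (hGr x hx).2, (hRsub (hxU x (hx.trans_le hρR))).1⟩, ?_, ?_⟩
  -- The inequality |E e^{zY/ε}| ≤ E e^{(Re z)Y/ε}, after applying ε log and letting ε ↓ 0.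
  · intro z hz
    have hzR := hsub hz
    have hzre : |z.re| < R := (Complex.abs_re_le_norm z).trans_lt (by simpa using hzR)
    have hdom' : u + z.re ∈ domZeroInt P Y := (hRsub (hxU _ hzre)).1
    have h1 : Tendsto (fun ε : ℝ => ((ε : ℂ) * F ε z).re) (𝓝[>] 0) (𝓝 (G₀ z).re) := by
      refine (Complex.continuous_re.tendsto _).comp ?_
      rw [tendsto_iff_norm_sub_tendsto_zero]
      have hlim : Tendsto (fun ε : ℝ => ε * ‖G₁ z‖ + ε ^ 2 * C') (𝓝[>] 0) (𝓝 0) := by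
        have : Tendsto (fun ε : ℝ => ε * ‖G₁ z‖ + ε ^ 2 * C') (𝓝 0) (𝓝 (0 * ‖G₁ z‖ + 0 ^ 2 * C')) :=
          (by fun_prop : Continuous fun ε : ℝ => ε * ‖G₁ z‖ + ε ^ 2 * C').tendsto 0
        simp only [zero_mul, ne_eq, OfNat.ofNat_ne_zero, not_false_eq_true, zero_pow, add_zero] at this
        exact this.mono_left nhdsWithin_le_nhds
      refine squeeze_zero' (Eventually.of_forall fun _ => norm_nonneg _) ?_ hlim
      filter_upwards [(Ioo_mem_nhdsGT hε₁pos : Ioo 0 ε₁ ∈ 𝓝[>] (0 : ℝ))] with ε hε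
      obtain ⟨h2, h3⟩ := (hH ε hε).2.1 z hz
      have hε0 := hε.1
      rw [h3, add_assoc, add_sub_cancel_left]
      refine (norm_add_le _ _).trans ?_
      rw [norm_mul, norm_mul, norm_pow, Complex.norm_real, Real.norm_eq_abs, abs_of_pos hε0]
      gcongr
    refine le_of_tendsto_of_tendsto h1 (hΛ.tendsto_lmgf hdom') ?_
    filter_upwards [(Ioo_mem_nhdsGT hε₁pos : Ioo 0 ε₁ ∈ 𝓝[>] (0 : ℝ))] with ε hε
    rw [hFre ε hε z hzR, reLmgf, lmgf]
    have hne := (happ ε (hm2 ε hε) _ (mem_image_of_mem _ (hcb hzR))).1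
    have hle := norm_cmgf_le P Y ε (u + z)
    simp only [Complex.add_re, Complex.ofReal_re] at hle
    exact mul_le_mul_of_nonneg_left (Real.log_le_log (norm_pos_iff.2 hne) hle) hε.1.le
  · intro ε hε
    obtain ⟨h1, h2, h3⟩ := hH ε hε
    refine ⟨h1, fun z hz => ⟨(h2 z hz).1, ?_⟩, by simpa using h3⟩
    have hne : (ε : ℂ) ≠ 0 := by exact_mod_cast hε.1.ne'
    rw [← (h2 z hz).2, mul_div_cancel_left₀ _ hne, (hF ε hε).2.1 z (hsub hz)]

/-- Positivity comes from the bound Re G₀ ≤ Λ₀ on vertical lines; strict convexity serves only to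
exclude that Λ₀ is affine near u, by a midpoint comparison. -/
theorem Admissible.iteratedDeriv_two_pos (hΛ : Admissible P Y Λ₀ Λ₁ Λ₂) {u : ℝ}
    (hu : u ∈ domZeroInt P Y) (hu0 : u ≠ 0) : 0 < iteratedDeriv 2 Λ₀ u := by
  obtain ⟨ρ, C, ε₁, G₀, G₁, H, hρ, -, -, -, hG₀, -, hGr, hle, -⟩ := hΛ.exists_local_expansion hu hu0
  have h := iteratedDeriv_two_re_pos (g := fun x => Λ₀ (u + x)) hρ hG₀ (fun x hx => (hGr x hx).1) hle ?_
  · rw [iteratedDeriv_comp_const_add] at h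
    simpa using h
  · intro hc
    obtain ⟨r, hr, hball⟩ := Metric.eventually_nhds_iff.1 hc
    set x : ℝ := min r ρ / 2 with hx
    have hx0 : 0 < x := by rw [hx]; have := lt_min hr hρ; linarith
    have hxr : x < r := by rw [hx]; have := min_le_left r ρ; have := lt_min hr hρ; linarith
    have hxρ : x < ρ := by rw [hx]; have := min_le_right r ρ; have := lt_min hr hρ; linarith
    have h1 := hball (y := x) (by simpa [abs_of_pos hx0] using hxr)
    have h2 := hball (y := -x) (by simpa [abs_of_pos hx0] using hxr)
    have h3 := hΛ.strictConvex.2 (hGr x (by rwa [abs_of_pos hx0])).2.2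
      (hGr (-x) (by rwa [abs_neg, abs_of_pos hx0])).2.2 (by intro h; linarith)
      (show (0 : ℝ) < 1 / 2 by norm_num) (show (0 : ℝ) < 1 / 2 by norm_num) (by norm_num)
    simp only [smul_eq_mul] at h3
    rw [show (1 / 2 : ℝ) * (u + x) + 1 / 2 * (u + -x) = u + 0 by ring] at h3
    linarith

end Admissible

end SharpOption

/-! ### The neighbourhood of the saddlepoint -/

namespace SharpOption

/-- The first-order coefficient in Laplace's method. -/
def laplaceCoeff (σ : ℝ) (s A : ℂ → ℂ) : ℂ :=
  -(iteratedDeriv 2 A 0) / (2 * σ) + 3 * deriv (fun z => s z * A z) 0 / σ ^ 2 -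
    15 * (s 0 ^ 2 * A 0) / (2 * σ ^ 3)

theorem laplaceCoeff_eq {σ ρ : ℝ} {s A : ℂ → ℂ} (hρ : 0 < ρ)
    (hs : DifferentiableOn ℂ s (Metric.ball 0 ρ)) (hA : DifferentiableOn ℂ A (Metric.ball 0 ρ)) :
    laplaceCoeff σ s A = -(iteratedDeriv 2 A 0) / (2 * σ) +
      3 * (deriv s 0 * A 0 + s 0 * deriv A 0) / σ ^ 2 - 15 * (s 0 ^ 2 * A 0) / (2 * σ ^ 3) := by
  have hb : Metric.ball (0 : ℂ) ρ ∈ 𝓝 0 := Metric.ball_mem_nhds _ hρ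
  rw [laplaceCoeff]
  congr 4
  exact deriv_fun_mul (hs.differentiableAt hb) (hA.differentiableAt hb)

/-- The coefficient is linear in the amplitude and involves only its value and first two derivatives
at 0, which Cauchy's estimates control. It is used to replace the ε-dependent amplitude by its
leading part. -/
theorem norm_laplaceCoeff_sub_le {σ ρ : ℝ} {s : ℂ → ℂ} (hρ : 0 < ρ) (hσ : 0 < σ)
    (hs : DifferentiableOn ℂ s (Metric.ball 0 ρ)) :
    ∃ K : ℝ, 0 ≤ K ∧ ∀ (A B : ℂ → ℂ) (M : ℝ), DifferentiableOn ℂ A (Metric.ball 0 ρ) →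
      DifferentiableOn ℂ B (Metric.ball 0 ρ) → (∀ z ∈ Metric.ball (0 : ℂ) ρ, ‖A z - B z‖ ≤ M) →
      ‖laplaceCoeff σ s A - laplaceCoeff σ s B‖ ≤ K * M := by
  have hb : Metric.ball (0 : ℂ) ρ ∈ 𝓝 0 := Metric.ball_mem_nhds _ hρ
  refine ⟨(2 / ρ) ^ 2 / σ + 3 * (‖deriv s 0‖ + ‖s 0‖ * (2 / ρ)) / σ ^ 2 +
    15 * ‖s 0‖ ^ 2 / (2 * σ ^ 3), by positivity, ?_⟩
  intro A B M hA hB hM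
  set D : ℂ → ℂ := fun z => A z - B z with hD
  have hDd : DifferentiableOn ℂ D (Metric.ball 0 ρ) := hA.sub hB
  have h0 : ‖D 0‖ ≤ M := hM 0 (Metric.mem_ball_self hρ)
  have hM0 : 0 ≤ M := (norm_nonneg _).trans h0
  have hd1 : deriv D 0 = deriv A 0 - deriv B 0 :=
    deriv_fun_sub (hA.differentiableAt hb) (hB.differentiableAt hb)
  have hd2 : iteratedDeriv 2 D 0 = iteratedDeriv 2 A 0 - iteratedDeriv 2 B 0 := by
    have := iteratedDeriv_sub (n := 2) (hA.analyticAt hb).contDiffAt (hB.analyticAt hb).contDiffAt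
    exact this
  have hcoef : ∀ n, ‖iteratedDeriv n D 0 / (n.factorial : ℂ)‖ ≤ (2 / ρ) ^ n * M := by
    intro n
    obtain ⟨T, -, hT, -, hd⟩ := exists_taylor_factor hρ hDd hM n
    have h1 := hd 0
    simp only [iteratedDeriv_zero, Nat.factorial_zero, Nat.cast_one, div_one, zero_add] at h1
    rw [← h1]
    exact hT 0 (Metric.mem_ball_self hρ)
  have h1 : ‖deriv D 0‖ ≤ 2 / ρ * M := by simpa [iteratedDeriv_one] using hcoef 1
  have h2 : ‖iteratedDeriv 2 D 0 / 2‖ ≤ (2 / ρ) ^ 2 * M := by simpa [Nat.factorial] using hcoef 2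
  have heq : laplaceCoeff σ s A - laplaceCoeff σ s B =
      -(iteratedDeriv 2 D 0 / 2) / σ + 3 * (deriv s 0 * D 0 + s 0 * deriv D 0) / σ ^ 2 -
        15 * (s 0 ^ 2 * D 0) / (2 * σ ^ 3) := by
    rw [laplaceCoeff_eq hρ hs hA, laplaceCoeff_eq hρ hs hB, hd1, hd2, hD]
    have : (σ : ℂ) ≠ 0 := by exact_mod_cast hσ.ne'
    field_simp
    ring
  have n1 : ‖-(iteratedDeriv 2 D 0 / 2) / (σ : ℂ)‖ ≤ (2 / ρ) ^ 2 * M / σ := by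
    rw [norm_div, norm_neg, Complex.norm_real, Real.norm_eq_abs, abs_of_pos hσ]
    gcongr
  have n2 : ‖3 * (deriv s 0 * D 0 + s 0 * deriv D 0) / (σ : ℂ) ^ 2‖ ≤
      3 * (‖deriv s 0‖ * M + ‖s 0‖ * (2 / ρ * M)) / σ ^ 2 := by
    rw [norm_div, norm_pow, Complex.norm_real, Real.norm_eq_abs, abs_of_pos hσ, norm_mul]
    simp only [Complex.norm_ofNat]
    gcongr
    refine (norm_add_le _ _).trans ?_
    rw [norm_mul, norm_mul]
    gcongr
  have n3 : ‖15 * (s 0 ^ 2 * D 0) / (2 * (σ : ℂ) ^ 3)‖ ≤ 15 * (‖s 0‖ ^ 2 * M) / (2 * σ ^ 3) := by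
    rw [norm_div, norm_mul, norm_mul, norm_mul, norm_pow, norm_pow, Complex.norm_real, Real.norm_eq_abs,
      abs_of_pos hσ]
    simp only [Complex.norm_ofNat]
    gcongr
  rw [heq]
  refine (norm_sub_le _ _).trans ((add_le_add (norm_add_le _ _) le_rfl).trans ?_)
  calc _ ≤ _ := add_le_add (add_le_add n1 n2) n3
    _ = _ := by ring

/-- The amplitude of the saddlepoint integral at leading order. -/
def amplitude (G : ℂ → ℂ) (u v : ℝ) (z : ℂ) : ℂ :=
  Complex.exp (G z) * (((u : ℂ) + z) * ((v : ℂ) + z))⁻¹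

theorem ofReal_add_ne_zero {u r : ℝ} (h : r ≤ |u|) {z : ℂ} (hz : z ∈ Metric.ball (0 : ℂ) r) :
    (u : ℂ) + z ≠ 0 := by
  intro hc
  have h1 : z = ((-u : ℝ) : ℂ) := by push_cast; linear_combination hc
  rw [mem_ball_zero_iff, h1, Complex.norm_real, Real.norm_eq_abs, abs_neg] at hz
  linarith

theorem differentiableOn_amplitude {G : ℂ → ℂ} {u v r : ℝ} (hG : DifferentiableOn ℂ G (Metric.ball 0 r))
    (hu : r ≤ |u|) (hv : r ≤ |v|) : DifferentiableOn ℂ (amplitude G u v) (Metric.ball 0 r) := by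
  unfold amplitude
  refine hG.cexp.mul (DifferentiableOn.inv (by fun_prop) fun z hz => ?_)
  exact mul_ne_zero (ofReal_add_ne_zero hu hz) (ofReal_add_ne_zero hv hz)

/-- Logarithmic differentiation: the quotient of derivative and amplitude is G' - 1/(u+z) - 1/(v+z),
and differentiating once more gives the second formula. -/
theorem amplitude_derivs {G : ℂ → ℂ} {u v r : ℝ} (hr : 0 < r) (hG : DifferentiableOn ℂ G (Metric.ball 0 r))
    (hu : r ≤ |u|) (hv : r ≤ |v|) :
    deriv (amplitude G u v) 0 = amplitude G u v 0 * (deriv G 0 - (u : ℂ)⁻¹ - (v : ℂ)⁻¹) ∧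
    iteratedDeriv 2 (amplitude G u v) 0 = amplitude G u v 0 *
      ((deriv G 0 - (u : ℂ)⁻¹ - (v : ℂ)⁻¹) ^ 2 + iteratedDeriv 2 G 0 + ((u : ℂ)⁻¹) ^ 2 + ((v : ℂ)⁻¹) ^ 2) := by
  have hopen : IsOpen (Metric.ball (0 : ℂ) r) := Metric.isOpen_ball
  have h0 : (0 : ℂ) ∈ Metric.ball (0 : ℂ) r := Metric.mem_ball_self hr
  have hinv : ∀ w : ℝ, r ≤ |w| → ∀ z ∈ Metric.ball (0 : ℂ) r,
      HasDerivAt (fun z : ℂ => ((w : ℂ) + z)⁻¹) (-(((w : ℂ) + z)⁻¹) ^ 2) z := by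
    intro w hw z hz
    have h1 : HasDerivAt (fun z : ℂ => (w : ℂ) + z) 1 z := (hasDerivAt_id z).const_add _
    refine (h1.inv (ofReal_add_ne_zero hw hz)).congr_deriv ?_
    rw [inv_pow, neg_div, one_div]
  have hdG : ∀ z ∈ Metric.ball (0 : ℂ) r, HasDerivAt G (deriv G z) z := fun z hz =>
    (hG.differentiableAt (hopen.mem_nhds hz)).hasDerivAt
  have hamp : ∀ z, amplitude G u v z = Complex.exp (G z) * (((u : ℂ) + z)⁻¹ * ((v : ℂ) + z)⁻¹) := fun z => by
    rw [amplitude, mul_inv]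
  have hd : ∀ z ∈ Metric.ball (0 : ℂ) r, HasDerivAt (amplitude G u v)
      (amplitude G u v z * (deriv G z - ((u : ℂ) + z)⁻¹ - ((v : ℂ) + z)⁻¹)) z := by
    intro z hz
    rw [funext hamp]
    refine ((hdG z hz).cexp.fun_mul ((hinv u hu z hz).fun_mul (hinv v hv z hz))).congr_deriv ?_
    ring
  refine ⟨by rw [(hd 0 h0).deriv]; simp, ?_⟩
  have hev : deriv (amplitude G u v) =ᶠ[𝓝 0]
      fun z => amplitude G u v z * (deriv G z - ((u : ℂ) + z)⁻¹ - ((v : ℂ) + z)⁻¹) :=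
    eventually_of_mem (hopen.mem_nhds h0) fun z hz => (hd z hz).deriv
  have hdG2 : HasDerivAt (deriv G) (iteratedDeriv 2 G 0) 0 := by
    rw [iteratedDeriv_succ, iteratedDeriv_one]
    exact ((hG.deriv hopen).differentiableAt (hopen.mem_nhds h0)).hasDerivAt
  rw [iteratedDeriv_succ, iteratedDeriv_one, hev.deriv_eq]
  rw [((hd 0 h0).fun_mul ((hdG2.fun_sub (hinv u hu 0 h0)).fun_sub (hinv v hv 0 h0))).deriv]
  simp only [add_zero]
  ring

/-- `Υ` is the relative first-order coefficient of the saddlepoint expansion. -/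
theorem Upsilon_eq (Λ₀ Λ₁ Λ₂ : ℝ → ℝ) {b u : ℝ} (hu : u ≠ 0) (hub : u - b ≠ 0)
    (hσ : iteratedDeriv 2 Λ₀ u ≠ 0) :
    Upsilon Λ₀ Λ₁ Λ₂ b u = Λ₂ u +
      (-((iteratedDeriv 1 Λ₁ u - u⁻¹ - (u - b)⁻¹) ^ 2 + iteratedDeriv 2 Λ₁ u + (u⁻¹) ^ 2 + ((u - b)⁻¹) ^ 2) /
        (2 * iteratedDeriv 2 Λ₀ u) +
      3 * (iteratedDeriv 4 Λ₀ u / 24 +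
        iteratedDeriv 3 Λ₀ u / 6 * (iteratedDeriv 1 Λ₁ u - u⁻¹ - (u - b)⁻¹)) / iteratedDeriv 2 Λ₀ u ^ 2 -
      15 * (iteratedDeriv 3 Λ₀ u / 6) ^ 2 / (2 * iteratedDeriv 2 Λ₀ u ^ 3)) := by
  unfold Upsilon
  simp only
  obtain ⟨v, hv⟩ : ∃ v, v = u - b := ⟨_, rfl⟩
  have hb : b = u - v := by rw [hv]; ring
  rw [← hv] at hub ⊢
  rw [hb]
  generalize iteratedDeriv 2 Λ₀ u = L02 at *
  generalize iteratedDeriv 3 Λ₀ u = L03 at *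
  generalize iteratedDeriv 4 Λ₀ u = L04 at *
  generalize iteratedDeriv 1 Λ₁ u = L11 at *
  generalize iteratedDeriv 2 Λ₁ u = L12 at *
  field_simp
  ring

/-- The contribution of a neighbourhood of the saddlepoint. -/
theorem saddlepoint_near_expansion {Λ₀ Λ₁ Λ₂ : ℝ → ℝ} {u c ρ C₁ ε₁ : ℝ} {G₀ G₁ : ℂ → ℂ} {H : ℝ → ℂ → ℂ}
    (hρ : 0 < ρ) (hC₁ : 0 < C₁) (hε₁ : ε₁ ≤ 1)
    (hG₀ : DifferentiableOn ℂ G₀ (Metric.ball 0 ρ)) (hG₁ : DifferentiableOn ℂ G₁ (Metric.ball 0 ρ))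
    (hGr : ∀ x : ℝ, |x| < ρ → G₀ x = Λ₀ (u + x) ∧ G₁ x = Λ₁ (u + x))
    (hH : ∀ ε ∈ Ioo 0 ε₁, DifferentiableOn ℂ (H ε) (Metric.ball 0 ρ) ∧
      (∀ z ∈ Metric.ball (0 : ℂ) ρ, ‖H ε z‖ ≤ C₁) ∧ ‖H ε 0 - Λ₂ u‖ ≤ C₁ * ε)
    (hu : u ≠ 0) (huc : u ≠ c) (hσ : 0 < iteratedDeriv 2 Λ₀ u) :
    ∃ r > 0, r ≤ ρ ∧ ∃ C : ℝ, 0 ≤ C ∧ ∀ ε ∈ Ioo 0 ε₁, ∀ b : ℝ, |b - c| ≤ |u - c| / 2 →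
      ‖(∫ y : ℝ, if |y| < r then
          (((u : ℂ) + y * Complex.I) * (((u - b : ℝ) : ℂ) + y * Complex.I))⁻¹ *
            (Complex.exp ((G₀ (y * Complex.I) + ε * G₁ (y * Complex.I) + ε ^ 2 * H ε (y * Complex.I)) / ε) *
              Complex.exp (-(((u : ℂ) + y * Complex.I) * deriv Λ₀ u / ε))) else 0) -
        ((Real.exp ((Λ₀ u - u * deriv Λ₀ u) / ε) * (√ε * √(2 * π / iteratedDeriv 2 Λ₀ u) *
          (Real.exp (Λ₁ u) / (u * (u - b)) * (1 + Upsilon Λ₀ Λ₁ Λ₂ b u * ε))) : ℝ) : ℂ)‖ ≤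
        C * (Real.exp ((Λ₀ u - u * deriv Λ₀ u) / ε) * (√ε * ε ^ 2)) := by
  set σ : ℝ := iteratedDeriv 2 Λ₀ u with hσdef
  have hσc : (σ : ℂ) ≠ 0 := by exact_mod_cast hσ.ne'
  -- derivatives at the saddlepoint
  have hder₀ : ∀ n, iteratedDeriv n G₀ 0 = ((iteratedDeriv n Λ₀ u : ℝ) : ℂ) := by
    intro n
    have := iteratedDeriv_ofReal_eq (g := fun x => Λ₀ (u + x)) hG₀ (fun x hx => (hGr x hx).1) n 0 (by simpa using hρ)
    rw [iteratedDeriv_comp_const_add] at this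
    simpa using this.symm
  have hder₁ : ∀ n, iteratedDeriv n G₁ 0 = ((iteratedDeriv n Λ₁ u : ℝ) : ℂ) := by
    intro n
    have := iteratedDeriv_ofReal_eq (g := fun x => Λ₁ (u + x)) hG₁ (fun x hx => (hGr x hx).2) n 0 (by simpa using hρ)
    rw [iteratedDeriv_comp_const_add] at this
    simpa using this.symm
  -- bounds on a smaller disc
  set r₀ : ℝ := ρ / 2 with hr₀
  have hr₀pos : 0 < r₀ := by positivity
  have hcb : Metric.closedBall (0 : ℂ) r₀ ⊆ Metric.ball 0 ρ :=
    Metric.closedBall_subset_ball (by rw [hr₀]; linarith)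
  have hsub₀ : Metric.ball (0 : ℂ) r₀ ⊆ Metric.ball 0 ρ := Metric.ball_subset_closedBall.trans hcb
  obtain ⟨B₀, hB₀⟩ := (isCompact_closedBall (0 : ℂ) r₀).exists_bound_of_continuousOn (hG₀.continuousOn.mono hcb)
  obtain ⟨B₁, hB₁⟩ := (isCompact_closedBall (0 : ℂ) r₀).exists_bound_of_continuousOn (hG₁.continuousOn.mono hcb)
  obtain ⟨s, hs, hsb, hG₀s, hsd⟩ := exists_taylor_factor hr₀pos (hG₀.mono hsub₀)
    (fun z hz => hB₀ z (Metric.ball_subset_closedBall hz)) 3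
  have hs0 : s 0 = ((iteratedDeriv 3 Λ₀ u / 6 : ℝ) : ℂ) := by
    have := hsd 0
    rw [hder₀] at this
    simp [Nat.factorial] at this
    rw [this]; push_cast; ring
  have hs1 : deriv s 0 = ((iteratedDeriv 4 Λ₀ u / 24 : ℝ) : ℂ) := by
    have := hsd 1
    rw [hder₀] at this
    simp [Nat.factorial] at this
    rw [this]; push_cast; ring
  have hG₀e : ∀ z, G₀ z = Λ₀ u + deriv Λ₀ u * z + σ / 2 * z ^ 2 + z ^ 3 * s z := by
    intro z
    rw [hG₀s z]
    simp only [hder₀, Finset.sum_range_succ, Finset.sum_range_zero, iteratedDeriv_zero, iteratedDeriv_one]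
    simp [Nat.factorial, hσdef]
  set S : ℝ := (2 / r₀) ^ 3 * B₀ with hS
  have hS0 : 0 ≤ S := (norm_nonneg _).trans (hsb 0 (Metric.mem_ball_self hr₀pos))
  have hucpos : 0 < |u - c| := abs_pos.2 (sub_ne_zero.2 huc)
  have hupos : 0 < |u| := abs_pos.2 hu
  -- The bound σ/(4(S+1)) yields the smallness required by Laplace's method. The bounds |u|/2 and
  -- |u-c|/4 keep the disc away from the poles -u and b-u for every admissible b, as |u-b| ≥
  -- |u-c|/2.
  set r : ℝ := min (min r₀ (σ / (4 * (S + 1)))) (min (|u| / 2) (|u - c| / 4)) with hr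
  have hrpos : 0 < r := lt_min (lt_min hr₀pos (by positivity)) (lt_min (by positivity) (by positivity))
  have hrr₀ : r ≤ r₀ := (min_le_left _ _).trans (min_le_left _ _)
  have hrσ : r ≤ σ / (4 * (S + 1)) := (min_le_left _ _).trans (min_le_right _ _)
  have hru : r ≤ |u| / 2 := (min_le_right _ _).trans (min_le_left _ _)
  have hruc : r ≤ |u - c| / 4 := (min_le_right _ _).trans (min_le_right _ _)
  have hsubr : Metric.ball (0 : ℂ) r ⊆ Metric.ball 0 r₀ := Metric.ball_subset_ball hrr₀
  have hsr : DifferentiableOn ℂ s (Metric.ball 0 r) := hs.mono hsubr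
  have hG₁r : DifferentiableOn ℂ G₁ (Metric.ball 0 r) := hG₁.mono (hsubr.trans hsub₀)
  obtain ⟨C₂, hC₂, hlap⟩ := laplace_expansion (σ := σ) (S := S) hrpos hsr (fun z hz => hsb z (hsubr hz))
    (fun z hz => by
      have h1 : ‖z‖ ≤ σ / (4 * (S + 1)) := (mem_ball_zero_iff.1 hz).le.trans hrσ
      have h2 := hsb z (hsubr hz)
      calc ‖z‖ * ‖s z‖ ≤ σ / (4 * (S + 1)) * (S + 1) := by
            gcongr
            linarith
        _ = σ / 4 := by field_simp) hσ
  obtain ⟨K, hK, hcoef⟩ := norm_laplaceCoeff_sub_le hrpos hσ hsr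
  set Q : ℝ := 2 / |u| * (4 / |u - c|) with hQ
  have hQ0 : 0 < Q := by positivity
  set m₀ : ℝ := √(2 * π / σ) with hm₀
  refine ⟨r, hrpos, hrr₀.trans (by rw [hr₀]; linarith),
    C₂ * (Real.exp (B₁ + C₁) * Q) + m₀ * (Real.exp B₁ * Q * (C₁ ^ 2 * Real.exp C₁ + C₁) +
      K * (Real.exp B₁ * Q * (C₁ * Real.exp C₁))), by positivity, ?_⟩
  intro ε hε b hb
  have hεpos := hε.1
  have hε1 : ε ≤ 1 := hε.2.le.trans hε₁
  have hεc : (ε : ℂ) ≠ 0 := by exact_mod_cast hεpos.ne'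
  obtain ⟨hHd, hHb, hH0⟩ := hH ε hε
  set t : ℝ := √ε with ht
  have htpos : 0 < t := Real.sqrt_pos.2 hεpos
  have ht2 : t ^ 2 = ε := Real.sq_sqrt hεpos.le
  have ht2c : (t : ℂ) ^ 2 = ε := by exact_mod_cast ht2
  have htc : (t : ℂ) ≠ 0 := by exact_mod_cast htpos.ne'
  set E : ℝ := Real.exp ((Λ₀ u - u * deriv Λ₀ u) / ε) with hE
  have hEpos : 0 < E := Real.exp_pos _
  have hub : |u - c| / 2 ≤ |u - b| := by
    have h1 : |u - c| ≤ |u - b| + |b - c| := by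
      have := abs_add_le (u - b) (b - c)
      rwa [sub_add_sub_cancel] at this
    linarith
  have hub0 : u - b ≠ 0 := by
    rw [← abs_pos]; linarith
  have hrv : r ≤ |u - b| := by linarith
  have hru' : r ≤ |u| := by linarith
  -- amplitudes
  set A₀ : ℂ → ℂ := amplitude G₁ u (u - b) with hA₀
  -- The full amplitude is A₀ e^{εH}; it depends on ε and b, but with a bound independent of both.
  set A : ℂ → ℂ := amplitude (fun z => G₁ z + ε * H ε z) u (u - b) with hA
  have hHr : DifferentiableOn ℂ (H ε) (Metric.ball 0 r) := hHd.mono (hsubr.trans hsub₀)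
  have hA₀d : DifferentiableOn ℂ A₀ (Metric.ball 0 r) := differentiableOn_amplitude hG₁r hru' hrv
  have hAd : DifferentiableOn ℂ A (Metric.ball 0 r) :=
    differentiableOn_amplitude (hG₁r.add (hHr.const_mul _)) hru' hrv
  have hQb : ∀ z ∈ Metric.ball (0 : ℂ) r, ‖(((u : ℂ) + z) * (((u - b : ℝ) : ℂ) + z))⁻¹‖ ≤ Q := by
    intro z hz
    have hzr : ‖z‖ < r := mem_ball_zero_iff.1 hz
    have key : ∀ w : ℝ, |w| - r ≤ ‖(w : ℂ) + z‖ := by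
      intro w
      have := norm_sub_le_norm_add (w : ℂ) z
      rw [Complex.norm_real, Real.norm_eq_abs] at this
      linarith
    have h1 : |u| / 2 ≤ ‖(u : ℂ) + z‖ := by linarith [key u]
    have h2 : |u - c| / 4 ≤ ‖((u - b : ℝ) : ℂ) + z‖ := by linarith [key (u - b)]
    rw [norm_inv, norm_mul, mul_inv, hQ, ← inv_div |u| 2, ← inv_div |u - c| 4]
    gcongr
  have hA₀b : ∀ z ∈ Metric.ball (0 : ℂ) r, ‖A₀ z‖ ≤ Real.exp B₁ * Q := by
    intro z hz
    rw [hA₀, amplitude, norm_mul, Complex.norm_exp]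
    gcongr
    · exact (Complex.re_le_norm _).trans (hB₁ z (Metric.ball_subset_closedBall (hsubr hz)))
    · exact hQb z hz
  have hAA₀ : ∀ z, A z = A₀ z * Complex.exp (ε * H ε z) := by
    intro z
    rw [hA, hA₀, amplitude, amplitude, Complex.exp_add]; ring
  have hεH : ∀ z ∈ Metric.ball (0 : ℂ) r, ‖(ε : ℂ) * H ε z‖ ≤ C₁ * ε := by
    intro z hz
    rw [norm_mul, Complex.norm_real, Real.norm_eq_abs, abs_of_pos hεpos, mul_comm]
    gcongr
    exact hHb z (hsub₀ (hsubr hz))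
  have hεH1 : ∀ z ∈ Metric.ball (0 : ℂ) r, ‖(ε : ℂ) * H ε z‖ ≤ C₁ := fun z hz =>
    (hεH z hz).trans (mul_le_of_le_one_right hC₁.le hε1)
  have hAb : ∀ z ∈ Metric.ball (0 : ℂ) r, ‖A z‖ ≤ Real.exp (B₁ + C₁) * Q := by
    intro z hz
    rw [hAA₀, norm_mul, Complex.norm_exp, Real.exp_add]
    calc ‖A₀ z‖ * Real.exp ((ε : ℂ) * H ε z).re ≤ (Real.exp B₁ * Q) * Real.exp C₁ := by
          gcongr
          · exact hA₀b z hz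
          · exact (Complex.re_le_norm _).trans (hεH1 z hz)
      _ = _ := by ring
  have hAsub : ∀ z ∈ Metric.ball (0 : ℂ) r, ‖A z - A₀ z‖ ≤ Real.exp B₁ * Q * (C₁ * Real.exp C₁) * ε := by
    intro z hz
    have h1 := Complex.norm_exp_sub_sum_le_norm_mul_exp ((ε : ℂ) * H ε z) 1
    simp only [Finset.sum_range_one, pow_zero, Nat.factorial_zero, Nat.cast_one, div_one, pow_one] at h1
    rw [hAA₀, show A₀ z * Complex.exp (ε * H ε z) - A₀ z = A₀ z * (Complex.exp (ε * H ε z) - 1) by ring, norm_mul]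
    calc ‖A₀ z‖ * ‖Complex.exp (ε * H ε z) - 1‖ ≤ (Real.exp B₁ * Q) * ((C₁ * ε) * Real.exp C₁) := by
          gcongr
          · exact hA₀b z hz
          · refine h1.trans ?_
            gcongr
            · exact hεH z hz
            · exact hεH1 z hz
      _ = _ := by ring
  -- value of the coefficients
  have h0 : (0 : ℂ) ∈ Metric.ball (0 : ℂ) r := Metric.mem_ball_self hrpos
  have hA₀0 : A₀ 0 = ((Real.exp (Λ₁ u) / (u * (u - b)) : ℝ) : ℂ) := by
    have h1 : G₁ 0 = (Λ₁ u : ℂ) := by simpa using hder₁ 0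
    rw [hA₀, amplitude, h1]
    push_cast
    rw [add_zero, add_zero]
    rfl
  -- Υ is the sum of Λ₂, from the correction e^{εH(0)}, and the relative Laplace coefficient of the
  -- leading amplitude.
  have hU : A₀ 0 * (Upsilon Λ₀ Λ₁ Λ₂ b u : ℂ) = A₀ 0 * Λ₂ u + laplaceCoeff σ s A₀ := by
    obtain ⟨hd1, hd2⟩ := amplitude_derivs hrpos hG₁r hru' hrv
    rw [laplaceCoeff_eq hrpos hsr hA₀d, hd1, hd2, ← iteratedDeriv_one, hder₁, hder₁, hs0, hs1,
      Upsilon_eq Λ₀ Λ₁ Λ₂ hu hub0 hσ.ne', ← hσdef, ← hA₀]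
    push_cast
    ring
  have hA0 : ‖A 0 - A₀ 0 * (1 + ε * Λ₂ u)‖ ≤ Real.exp B₁ * Q * (C₁ ^ 2 * Real.exp C₁ + C₁) * ε ^ 2 := by
    have h1 := Complex.norm_exp_sub_sum_le_norm_mul_exp ((ε : ℂ) * H ε 0) 2
    simp only [Finset.sum_range_succ, Finset.sum_range_zero, zero_add, pow_zero, Nat.factorial_zero, Nat.cast_one, div_one, pow_one,
      Nat.factorial_one] at h1
    have h2 : ‖Complex.exp (ε * H ε 0) - (1 + ε * H ε 0)‖ ≤ C₁ ^ 2 * Real.exp C₁ * ε ^ 2 := by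
      refine h1.trans ?_
      calc _ ≤ (C₁ * ε) ^ 2 * Real.exp C₁ := by
            gcongr
            · exact hεH 0 h0
            · exact hεH1 0 h0
        _ = _ := by ring
    have h3 : ‖(ε : ℂ) * (H ε 0 - Λ₂ u)‖ ≤ C₁ * ε ^ 2 := by
      rw [norm_mul, Complex.norm_real, Real.norm_eq_abs, abs_of_pos hεpos]
      calc ε * ‖H ε 0 - Λ₂ u‖ ≤ ε * (C₁ * ε) := by gcongr
        _ = _ := by ring
    rw [hAA₀, show A₀ 0 * Complex.exp (ε * H ε 0) - A₀ 0 * (1 + ε * Λ₂ u) =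
      A₀ 0 * ((Complex.exp (ε * H ε 0) - (1 + ε * H ε 0)) + ε * (H ε 0 - Λ₂ u)) by ring, norm_mul]
    calc _ ≤ (Real.exp B₁ * Q) * (C₁ ^ 2 * Real.exp C₁ * ε ^ 2 + C₁ * ε ^ 2) := by
          gcongr
          · exact hA₀b 0 h0
          · exact (norm_add_le _ _).trans (add_le_add h2 h3)
      _ = _ := by ring
  -- rescaling
  set N : ℝ → ℂ := fun y => if |y| < r then
          (((u : ℂ) + y * Complex.I) * (((u - b : ℝ) : ℂ) + y * Complex.I))⁻¹ *
            (Complex.exp ((G₀ (y * Complex.I) + ε * G₁ (y * Complex.I) + ε ^ 2 * H ε (y * Complex.I)) / ε) *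
              Complex.exp (-(((u : ℂ) + y * Complex.I) * deriv Λ₀ u / ε))) else 0 with hN
  -- With z = itx and t² = ε, the linear term of G₀ is cancelled by the strike exponential, the
  -- quadratic term becomes the Gaussian, and the cubic remainder over ε retains one factor t.
  have hNt : ∀ x : ℝ, N (t * x) = (E : ℂ) * laplaceIntegrand σ r s A t x := by
    intro x
    have hnorm : ‖(t * x : ℂ) * Complex.I‖ = |t * x| := by simp [abs_mul]
    rw [hN, laplaceIntegrand, hnorm]
    simp only
    split_ifs with h
    · rw [hA, amplitude, hE]
      push_cast
      set z : ℂ := (t : ℂ) * x * Complex.I with hz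
      rw [hG₀e z]
      have hz2 : z ^ 2 = -(ε * x ^ 2) := by
        rw [hz, mul_pow, mul_pow, Complex.I_sq, ht2c]; ring
      have hz3 : z ^ 3 = ε * (t * (x * Complex.I) ^ 3) := by
        rw [hz, ← ht2c]; ring
      rw [hz2, hz3]
      have hexp : Complex.exp ((Λ₀ u + deriv Λ₀ u * z + σ / 2 * -(ε * x ^ 2) +
            ε * (t * (x * Complex.I) ^ 3) * s z + ε * G₁ z + ε ^ 2 * H ε z) / ε) *
          Complex.exp (-(((u : ℂ) + z) * deriv Λ₀ u / ε)) =
          Complex.exp ((Λ₀ u - u * deriv Λ₀ u) / ε) * (Complex.exp (-(σ / 2) * x ^ 2) *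
            (Complex.exp (t * (x * Complex.I) ^ 3 * s z) * Complex.exp (G₁ z + ε * H ε z))) := by
        rw [← Complex.exp_add, ← Complex.exp_add, ← Complex.exp_add, ← Complex.exp_add]
        congr 1
        field_simp
        ring
      rw [hexp]
      ring
    · simp
  have hNint : ∫ y : ℝ, N y = t * (E * ∫ x : ℝ, laplaceIntegrand σ r s A t x) := by
    have h1 := Measure.integral_comp_mul_left N t
    simp only [hNt] at h1
    rw [integral_const_mul] at h1
    rw [h1, abs_of_pos (inv_pos.2 htpos), Complex.real_smul]
    push_cast
    field_simp
  have hlapA := hlap A _ hAd hAb t htpos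
  rw [hNint]
  have hfin : (t : ℂ) * (E * ∫ x : ℝ, laplaceIntegrand σ r s A t x) -
      ((E * (t * m₀ * (Real.exp (Λ₁ u) / (u * (u - b)) * (1 + Upsilon Λ₀ Λ₁ Λ₂ b u * ε))) : ℝ) : ℂ) =
      (t * E : ℝ) * (((∫ x : ℝ, laplaceIntegrand σ r s A t x) - (m₀ : ℂ) * (A 0 + t ^ 2 * laplaceCoeff σ s A)) +
        m₀ * ((A 0 - A₀ 0 * (1 + ε * Λ₂ u)) + ε * (laplaceCoeff σ s A - laplaceCoeff σ s A₀))) := by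
    rw [ht2c]
    push_cast
    have h1 : (Real.exp (Λ₁ u) : ℂ) / (u * (u - b)) = A₀ 0 := by rw [hA₀0]; push_cast; rfl
    rw [← Complex.ofReal_exp, h1]
    linear_combination -((t : ℂ) * E * m₀ * ε) * hU
  rw [hfin, norm_mul, Complex.norm_real, Real.norm_eq_abs, abs_of_pos (by positivity)]
  have hm₀0 : 0 ≤ m₀ := Real.sqrt_nonneg _
  have hcA : ‖laplaceCoeff σ s A - laplaceCoeff σ s A₀‖ ≤ K * (Real.exp B₁ * Q * (C₁ * Real.exp C₁) * ε) :=
    hcoef A A₀ _ hAd hA₀d hAsub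
  have hlast : ‖((∫ x : ℝ, laplaceIntegrand σ r s A t x) - (m₀ : ℂ) * (A 0 + t ^ 2 * laplaceCoeff σ s A)) +
        m₀ * ((A 0 - A₀ 0 * (1 + ε * Λ₂ u)) + ε * (laplaceCoeff σ s A - laplaceCoeff σ s A₀))‖ ≤
      C₂ * (Real.exp (B₁ + C₁) * Q) * ε ^ 2 + m₀ * (Real.exp B₁ * Q * (C₁ ^ 2 * Real.exp C₁ + C₁) * ε ^ 2 +
        ε * (K * (Real.exp B₁ * Q * (C₁ * Real.exp C₁) * ε))) := by
    refine (norm_add_le _ _).trans (add_le_add ?_ ?_)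
    · refine hlapA.trans_eq ?_
      rw [← ht2]; ring
    · rw [norm_mul, Complex.norm_real, Real.norm_eq_abs, abs_of_nonneg hm₀0]
      gcongr
      refine (norm_add_le _ _).trans (add_le_add hA0 ?_)
      rw [norm_mul, Complex.norm_real, Real.norm_eq_abs, abs_of_pos hεpos]
      gcongr
  calc _ ≤ t * E * _ := mul_le_mul_of_nonneg_left hlast (by positivity)
    _ = _ := by ring

end SharpOption

/-! ### The whole saddlepoint integral and the price remainder -/

namespace SharpOption

variable {Ω : Type*} [MeasurableSpace Ω]

/-- The cubic term of the exponential series gives a bound by ε³, and ε ≤ √ε for ε ≤ 1. The far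
contribution is thereby measured in units of the error term. -/
theorem exp_neg_div_le {η ε : ℝ} (hη : 0 < η) (hε : 0 < ε) (hε1 : ε ≤ 1) :
    Real.exp (-η / ε) ≤ 6 / η ^ 3 * (√ε * ε ^ 2) := by
  have h1 : (η / ε) ^ 3 / 6 ≤ Real.exp (η / ε) := by
    have := Real.pow_div_factorial_le_exp (η / ε) (by positivity) 3
    simpa [Nat.factorial] using this
  have h2 : Real.exp (-η / ε) ≤ ((η / ε) ^ 3 / 6)⁻¹ := by
    rw [neg_div, Real.exp_neg]
    exact inv_anti₀ (by positivity) h1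
  have h3 : ε ≤ √ε := by
    apply Real.le_sqrt_of_sq_le
    nlinarith
  calc _ ≤ ((η / ε) ^ 3 / 6)⁻¹ := h2
    _ = 6 / η ^ 3 * (ε * ε ^ 2) := by field_simp
    _ ≤ _ := by gcongr

/-- The saddlepoint integral: uniform expansion to first order. -/
theorem Admissible.saddlepoint_integral {P : Measure Ω} [IsProbabilityMeasure P] {Y : ℝ → Ω → ℝ}
    {Λ₀ Λ₁ Λ₂ : ℝ → ℝ} (hΛ : Admissible P Y Λ₀ Λ₁ Λ₂) {u c : ℝ} (hu : u ∈ domZeroInt P Y) (hu0 : u ≠ 0)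
    (huc : u ≠ c) :
    ∃ C : ℝ, 0 ≤ C ∧ ∃ ε₁ > 0, ∀ ε ∈ Ioo 0 ε₁, ∀ b : ℝ, |b - c| ≤ |u - c| / 2 →
      ‖(∫ y : ℝ, (((u : ℂ) + y * Complex.I) * (((u - b : ℝ) : ℂ) + y * Complex.I))⁻¹ *
          (cmgf P Y ε ((u : ℂ) + y * Complex.I) *
            Complex.exp (-(((u : ℂ) + y * Complex.I) * deriv Λ₀ u / ε)))) -
        ((Real.exp ((Λ₀ u - u * deriv Λ₀ u) / ε) * (√ε * √(2 * π / iteratedDeriv 2 Λ₀ u) *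
          (Real.exp (Λ₁ u) / (u * (u - b)) * (1 + Upsilon Λ₀ Λ₁ Λ₂ b u * ε))) : ℝ) : ℂ)‖ ≤
        C * (Real.exp ((Λ₀ u - u * deriv Λ₀ u) / ε) * (√ε * ε ^ 2)) := by
  obtain ⟨ρ, C₁, ε₁, G₀, G₁, H, hρ, hC₁, hε₁, hε₁1, hG₀, hG₁, hGr, -, hH⟩ := hΛ.exists_local_expansion hu hu0
  obtain ⟨r, hr, hrρ, Cn, hCn, hnear⟩ := saddlepoint_near_expansion (c := c) (Λ₂ := Λ₂) hρ hC₁ hε₁1 hG₀ hG₁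
    (fun x hx => ⟨(hGr x hx).1, (hGr x hx).2.1⟩)
    (fun ε hε => ⟨(hH ε hε).1, fun z hz => ((hH ε hε).2.1 z hz).1, (hH ε hε).2.2⟩) hu0 huc
    (hΛ.iteratedDeriv_two_pos hu hu0)
  obtain ⟨η, hη, Cf, hCf, ε₂, hε₂, hfar⟩ := hΛ.exists_far_bound hu hu0 hr
  obtain ⟨ε₀, hε₀, hdom, -⟩ := hΛ.smooth
  have hucpos : 0 < |u - c| := abs_pos.2 (sub_ne_zero.2 huc)
  -- A lower bound for |u| and |u-b| valid for all admissible b.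
  set m : ℝ := min 1 (min |u| (|u - c| / 2)) with hm
  have hmpos : 0 < m := lt_min one_pos (lt_min (abs_pos.2 hu0) (by positivity))
  set I₀ : ℝ := ∫ y : ℝ, (1 + y ^ 2)⁻¹ with hI₀
  have hI₀0 : 0 ≤ I₀ := integral_nonneg fun y => by positivity
  refine ⟨(m ^ 2)⁻¹ * Cf * (6 / η ^ 3) * I₀ + Cn, by positivity, min ε₀ (min ε₁ ε₂),
    lt_min hε₀ (lt_min hε₁ hε₂), ?_⟩
  intro ε hε b hb
  have hεpos := hε.1
  have hm0 : ε ∈ Ioo 0 ε₀ := ⟨hεpos, hε.2.trans_le (min_le_left _ _)⟩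
  have hm1 : ε ∈ Ioo 0 ε₁ := ⟨hεpos, hε.2.trans_le ((min_le_right _ _).trans (min_le_left _ _))⟩
  have hm2 : ε ∈ Ioo 0 ε₂ := ⟨hεpos, hε.2.trans_le ((min_le_right _ _).trans (min_le_right _ _))⟩
  have hub : |u - c| / 2 ≤ |u - b| := by
    have h1 : |u - c| ≤ |u - b| + |b - c| := by
      have := abs_add_le (u - b) (b - c)
      rwa [sub_add_sub_cancel] at this
    linarith
  have hub0 : u - b ≠ 0 := by
    rw [← abs_pos]; linarith
  set E : ℝ := Real.exp ((Λ₀ u - u * deriv Λ₀ u) / ε) with hE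
  have hEpos : 0 < E := Real.exp_pos _
  set g : ℝ → ℂ := fun y => (((u : ℂ) + y * Complex.I) * (((u - b : ℝ) : ℂ) + y * Complex.I))⁻¹ *
          (cmgf P Y ε ((u : ℂ) + y * Complex.I) *
            Complex.exp (-(((u : ℂ) + y * Complex.I) * deriv Λ₀ u / ε))) with hg
  have hker : ∀ y : ℝ, ‖(((u : ℂ) + y * Complex.I) * (((u - b : ℝ) : ℂ) + y * Complex.I))⁻¹‖ ≤
      (m ^ 2)⁻¹ * (1 + y ^ 2)⁻¹ := fun y =>
    norm_inv_mul_le hmpos (min_le_left _ _) ((min_le_right _ _).trans (min_le_left _ _))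
      (((min_le_right _ _).trans (min_le_right _ _)).trans hub) y
  have hexpn : ∀ y : ℝ, ‖Complex.exp (-(((u : ℂ) + y * Complex.I) * deriv Λ₀ u / ε))‖ =
      Real.exp (-(u * deriv Λ₀ u / ε)) := by
    intro y
    rw [Complex.norm_exp]
    congr 1
    rw [Complex.neg_re, Complex.div_ofReal_re, Complex.re_mul_ofReal]
    simp
  have hcont : Continuous g := by
    have h1 : Continuous fun y : ℝ => cmgf P Y ε ((u : ℂ) + y * Complex.I) := by
      rw [continuous_iff_continuousAt]
      intro y
      exact ContinuousAt.comp (f := fun y : ℝ => (u : ℂ) + y * Complex.I) (g := cmgf P Y ε)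
        (differentiableAt_cmgf hεpos (isOpen_domZeroInt P Y) (hdom ε hm0) (by simpa using hu)).continuousAt
        (by fun_prop)
    refine Continuous.mul (Continuous.inv₀ (by fun_prop) fun y => ?_) (h1.mul (by fun_prop))
    exact mul_ne_zero (add_mul_I_ne_zero hu0 y) (add_mul_I_ne_zero hub0 y)
  have hgi : Integrable g := by
    refine Integrable.mono' ((integrable_inv_one_add_sq.const_mul ((m ^ 2)⁻¹)).mul_const
      ((∫ ω, Real.exp (u * Y ε ω / ε) ∂P) * Real.exp (-(u * deriv Λ₀ u / ε))))
      hcont.aestronglyMeasurable (Eventually.of_forall fun y => ?_)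
    rw [hg]
    simp only
    rw [norm_mul, norm_mul, hexpn]
    have h1 := norm_cmgf_le P Y ε ((u : ℂ) + y * Complex.I)
    have h2 : ((u : ℂ) + y * Complex.I).re = u := by simp
    rw [h2] at h1
    have h3 := hker y
    gcongr
  set near : ℝ → ℂ := fun y => if |y| < r then
          (((u : ℂ) + y * Complex.I) * (((u - b : ℝ) : ℂ) + y * Complex.I))⁻¹ *
            (Complex.exp ((G₀ (y * Complex.I) + ε * G₁ (y * Complex.I) + ε ^ 2 * H ε (y * Complex.I)) / ε) *
              Complex.exp (-(((u : ℂ) + y * Complex.I) * deriv Λ₀ u / ε))) else 0 with hneardef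
  have hneq : near = {y : ℝ | |y| < r}.indicator g := by
    ext y
    by_cases h : |y| < r
    · rw [indicator_of_mem (by exact h), hneardef, hg]
      simp only [if_pos h]
      rw [((hH ε hm1).2.1 (y * Complex.I) (by simpa using h.trans_le hrρ)).2]
    · rw [indicator_of_notMem (by exact h), hneardef]
      simp only [if_neg h]
  have hset : MeasurableSet {y : ℝ | |y| < r} := measurableSet_lt (by fun_prop) measurable_const
  have hni : Integrable near := by rw [hneq]; exact hgi.indicator hset
  have hfarb : ∀ y : ℝ, ‖g y - near y‖ ≤ ((m ^ 2)⁻¹ * Cf * (E * Real.exp (-η / ε))) * (1 + y ^ 2)⁻¹ := by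
    intro y
    rw [hneq]
    by_cases h : |y| < r
    · rw [indicator_of_mem (by exact h), sub_self, norm_zero]
      positivity
    · rw [indicator_of_notMem (by exact h), sub_zero, hg]
      simp only
      rw [norm_mul, norm_mul, hexpn]
      have h1 := hfar ε hm2 y (not_lt.1 h)
      have h3 := hker y
      have h4 : Real.exp ((Λ₀ u - η) / ε) * Real.exp (-(u * deriv Λ₀ u / ε)) = E * Real.exp (-η / ε) := by
        rw [hE, ← Real.exp_add, ← Real.exp_add]
        congr 1; ring
      calc _ ≤ ((m ^ 2)⁻¹ * (1 + y ^ 2)⁻¹) *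
            ((Cf * Real.exp ((Λ₀ u - η) / ε)) * Real.exp (-(u * deriv Λ₀ u / ε))) := by gcongr
        _ = ((m ^ 2)⁻¹ * Cf * (Real.exp ((Λ₀ u - η) / ε) * Real.exp (-(u * deriv Λ₀ u / ε)))) *
            (1 + y ^ 2)⁻¹ := by ring
        _ = _ := by rw [h4]
  have hfarI : ‖(∫ y, g y) - ∫ y, near y‖ ≤ (m ^ 2)⁻¹ * Cf * (6 / η ^ 3) * I₀ * (E * (√ε * ε ^ 2)) := by
    rw [← integral_sub hgi hni]
    refine (norm_integral_le_of_norm_le (integrable_inv_one_add_sq.const_mul _)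
      (Eventually.of_forall hfarb)).trans ?_
    rw [integral_const_mul]
    have h1 := exp_neg_div_le hη hεpos (hm1.2.le.trans hε₁1)
    calc _ ≤ (m ^ 2)⁻¹ * Cf * (E * (6 / η ^ 3 * (√ε * ε ^ 2))) * I₀ := by gcongr
      _ = _ := by ring
  have hn := hnear ε hm1 b hb
  calc _ ≤ ‖(∫ y, g y) - ∫ y, near y‖ + ‖(∫ y, near y) - _‖ := norm_sub_le_norm_sub_add_norm_sub _ _ _
    _ ≤ _ := add_le_add hfarI hn
    _ = _ := by ring

/-- The remainder of the expansion of the option price is of second order. -/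
theorem isBigO_price_remainder (Λ₀ Λ₁ Λ₂ : ℝ → ℝ) {u c : ℝ} {b q : ℝ → ℝ} (hu : u ≠ 0) (huc : u ≠ c)
    (hc : 0 ≤ c) (hb : (fun ε => b ε - c) =O[𝓝[>] (0 : ℝ)] (fun ε => ε))
    (hq : q =O[𝓝[>] (0 : ℝ)] (fun ε => ε ^ 2)) :
    (fun ε => (if 0 < c then b ε * (u - c) / (c * (u - b ε)) else u / (u - b ε)) *
        (1 + Upsilon Λ₀ Λ₁ Λ₂ (b ε) u * ε + q ε) -
      (1 + Upsilon Λ₀ Λ₁ Λ₂ c u * ε + (if 0 < c then u * (b ε - c) / ((u - c) * c) else 0) +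
        (if c = 0 then b ε / u else 0))) =O[𝓝[>] (0 : ℝ)] (fun ε => ε ^ 2) := by
  have hid : Tendsto (fun ε : ℝ => ε) (𝓝[>] 0) (𝓝 0) := tendsto_id.mono_left nhdsWithin_le_nhds
  have hbt : Tendsto b (𝓝[>] 0) (𝓝 c) := by
    have h1 := hb.trans_tendsto hid
    simpa using h1.add_const c
  have huc' : u - c ≠ 0 := sub_ne_zero.2 huc
  have hubt : Tendsto (fun ε => u - b ε) (𝓝[>] 0) (𝓝 (u - c)) := tendsto_const_nhds.sub hbt
  have hne : ∀ᶠ ε in 𝓝[>] (0 : ℝ), u - b ε ≠ 0 := hubt.eventually_ne huc'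
  have hinv : (fun ε => (u - b ε)⁻¹) =O[𝓝[>] (0 : ℝ)] (fun _ => (1 : ℝ)) := (hubt.inv₀ huc').isBigO_one ℝ
  -- As a function of b, Υ is rational with no pole at c, so replacing b by c changes it by O(b-c) =
  -- O(ε).
  have hU : (fun ε => Upsilon Λ₀ Λ₁ Λ₂ (b ε) u - Upsilon Λ₀ Λ₁ Λ₂ c u) =O[𝓝[>] (0 : ℝ)] (fun ε => ε) := by
    have hd : DifferentiableAt ℝ (fun b => Upsilon Λ₀ Λ₁ Λ₂ b u) c := by
      have hinvd : DifferentiableAt ℝ (fun b : ℝ => (u - b)⁻¹) c :=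
        DifferentiableAt.inv (by fun_prop) huc'
      have heq : (fun b => Upsilon Λ₀ Λ₁ Λ₂ b u) = fun b =>
          Λ₂ u - 5 * iteratedDeriv 3 Λ₀ u ^ 2 / (24 * iteratedDeriv 2 Λ₀ u ^ 3) +
          (4 * iteratedDeriv 1 Λ₁ u * iteratedDeriv 3 Λ₀ u + iteratedDeriv 4 Λ₀ u) / (8 * iteratedDeriv 2 Λ₀ u ^ 2) -
          (iteratedDeriv 1 Λ₁ u ^ 2 + iteratedDeriv 2 Λ₁ u) / (2 * iteratedDeriv 2 Λ₀ u) -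
          iteratedDeriv 3 Λ₀ u / (2 * u * iteratedDeriv 2 Λ₀ u ^ 2) -
          iteratedDeriv 3 Λ₀ u / (2 * iteratedDeriv 2 Λ₀ u ^ 2) * (u - b)⁻¹ -
          (iteratedDeriv 1 Λ₁ u * (b - 2 * u) + 3) / (u * iteratedDeriv 2 Λ₀ u) * (u - b)⁻¹ -
          b ^ 2 / (u ^ 2 * iteratedDeriv 2 Λ₀ u) * ((u - b)⁻¹) ^ 2 := by
        ext b
        simp only [Upsilon, div_eq_mul_inv, mul_inv, inv_pow]
        ring
      rw [heq]
      fun_prop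
    exact (hd.isBigO_sub.comp_tendsto hbt).trans hb
  have hκ1 : (fun ε => (if 0 < c then b ε * (u - c) / (c * (u - b ε)) else u / (u - b ε))) =O[𝓝[>] (0 : ℝ)]
      (fun _ => (1 : ℝ)) := by
    split_ifs with h
    · have : Tendsto (fun ε => b ε * (u - c) / (c * (u - b ε))) (𝓝[>] 0) (𝓝 (c * (u - c) / (c * (u - c)))) :=
        (hbt.mul_const _).div (hubt.const_mul c) (mul_ne_zero h.ne' huc')
      exact this.isBigO_one ℝ
    · have : Tendsto (fun ε => u / (u - b ε)) (𝓝[>] 0) (𝓝 (u / (u - c))) := tendsto_const_nhds.div hubt huc'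
      exact this.isBigO_one ℝ
  -- κ is the exact prefactor b/(u(u-b)) relative to the one in Ā_c. For c = 0 the latter retains
  -- the factor b in its numerator, which explains the second branch. ℓ is the first-order part of κ
  -- - 1.
  set κ : ℝ → ℝ := fun ε => if 0 < c then b ε * (u - c) / (c * (u - b ε)) else u / (u - b ε) with hκ
  set ℓ : ℝ → ℝ := fun ε => (if 0 < c then u * (b ε - c) / ((u - c) * c) else 0) +
        (if c = 0 then b ε / u else 0) with hℓ
  have hb2 : (fun ε => (b ε - c) ^ 2) =O[𝓝[>] (0 : ℝ)] (fun ε => ε ^ 2) := hb.pow 2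
  -- In both cases the difference is exactly a constant times (b-c)²/(u-b).
  have hκℓ : (fun ε => κ ε - 1 - ℓ ε) =O[𝓝[>] (0 : ℝ)] (fun ε => ε ^ 2) := by
    rcases hc.lt_or_eq with h | h
    · have heq : (fun ε => κ ε - 1 - ℓ ε) =ᶠ[𝓝[>] 0]
          fun ε => (u / (c * (u - c))) * ((b ε - c) ^ 2 * (u - b ε)⁻¹) := by
        filter_upwards [hne] with ε hε
        simp only [hκ, hℓ, if_pos h, if_neg h.ne']
        have := h.ne'
        field_simp
        ring
      have h1 := (hb2.mul hinv).const_mul_left (u / (c * (u - c)))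
      simp only [mul_one] at h1
      exact heq.trans_isBigO h1
    · have heq : (fun ε => κ ε - 1 - ℓ ε) =ᶠ[𝓝[>] 0]
          fun ε => u⁻¹ * ((b ε - c) ^ 2 * (u - b ε)⁻¹) := by
        filter_upwards [hne] with ε hε
        simp only [hκ, hℓ, ← h, lt_irrefl, if_false, if_true]
        field_simp
        ring
      have h1 := (hb2.mul hinv).const_mul_left u⁻¹
      simp only [mul_one] at h1
      exact heq.trans_isBigO h1
  have hℓO : ℓ =O[𝓝[>] (0 : ℝ)] (fun ε => ε) := by
    rcases hc.lt_or_eq with h | h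
    · have heq : ℓ = fun ε => u / ((u - c) * c) * (b ε - c) := by
        ext ε; simp only [hℓ, if_pos h, if_neg h.ne']; ring
      rw [heq]; exact hb.const_mul_left _
    · have heq : ℓ = fun ε => u⁻¹ * (b ε - c) := by
        ext ε; simp only [hℓ, ← h, lt_irrefl, if_false, if_true]; ring
      rw [heq]; exact hb.const_mul_left _
  have hsq : (fun ε : ℝ => ε ^ 2) =O[𝓝[>] (0 : ℝ)] (fun ε => ε) := by
    have h1 := (isBigO_refl (fun ε : ℝ => ε) (𝓝[>] (0 : ℝ))).mul (hid.isBigO_one ℝ)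
    refine h1.congr (fun ε => by ring) (fun ε => by ring)
  have hκm : (fun ε => κ ε - 1) =O[𝓝[>] (0 : ℝ)] (fun ε => ε) := by
    have := (hκℓ.trans hsq).add hℓO
    refine this.congr_left fun ε => by ring
  have hεε := isBigO_refl (fun ε : ℝ => ε) (𝓝[>] (0 : ℝ))
  have t1 : (fun ε => (κ ε - 1) * (Upsilon Λ₀ Λ₁ Λ₂ c u * ε)) =O[𝓝[>] (0 : ℝ)] (fun ε => ε ^ 2) :=
    (hκm.mul (hεε.const_mul_left (Upsilon Λ₀ Λ₁ Λ₂ c u))).congr_right fun ε => by ring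
  have t2 : (fun ε => κ ε * ((Upsilon Λ₀ Λ₁ Λ₂ (b ε) u - Upsilon Λ₀ Λ₁ Λ₂ c u) * ε)) =O[𝓝[>] (0 : ℝ)]
      (fun ε => ε ^ 2) := (hκ1.mul (hU.mul hεε)).congr_right fun ε => by ring
  have t3 : (fun ε => κ ε * q ε) =O[𝓝[>] (0 : ℝ)] (fun ε => ε ^ 2) :=
    (hκ1.mul hq).congr_right fun ε => by ring
  refine (((hκℓ.add t1).add t2).add t3).congr_left fun ε => ?_
  simp only [hκ, hℓ]
  ring

end SharpOption

end

/-! ### Assembly of the expansion -/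

theorem corollary2p4 {Ω : Type*} [MeasurableSpace Ω] (P : Measure Ω) [IsProbabilityMeasure P]
    (Y : ℝ → Ω → ℝ) (hY : ∀ ε : ℝ, 0 < ε → Measurable (Y ε))
    (Λ₀ Λ₁ Λ₂ : ℝ → ℝ) (hΛ : SharpOption.Admissible P Y Λ₀ Λ₁ Λ₂)
    (f : ℝ → ℝ) (hf : ∀ ε : ℝ, 0 < ε → 0 ≤ f ε)
    (c : ℝ) (hc0 : 0 ≤ c) (hc : c ∈ SharpOption.domZeroInt P Y)
    (hfc : (fun ε : ℝ => f ε * ε - c) =O[𝓝[>] (0 : ℝ)] (fun ε : ℝ => ε))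
    (k : ℝ) (hk : k ∈ deriv Λ₀ '' SharpOption.domZeroInt P Y)
    (hk0 : k ≠ deriv Λ₀ 0) (hkc : k ≠ deriv Λ₀ c) :
    ∃ r : ℝ → ℝ, r =O[𝓝[>] (0 : ℝ)] (fun ε : ℝ => ε ^ 2) ∧
      ∀ᶠ ε in 𝓝[>] (0 : ℝ),
        f ε * ε ∈ SharpOption.dom P Y ε ∧
        Integrable (fun ω => max (Real.exp (Y ε ω * f ε) - Real.exp (k * f ε)) 0) P ∧
        ∫ ω, max (Real.exp (Y ε ω * f ε) - Real.exp (k * f ε)) 0 ∂P =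
          (if k < deriv Λ₀ c then Real.exp (SharpOption.lmgf P Y ε (f ε * ε) / ε) else 0)
          - (if k < deriv Λ₀ 0 then Real.exp (k * f ε) else 0)
          + Real.exp (-SharpOption.legendre (SharpOption.domZeroInt P Y) Λ₀ k / ε + k * f ε
                + Λ₁ (SharpOption.uStar (SharpOption.domZeroInt P Y) Λ₀ k))
            * SharpOption.Abar Λ₀ f c (SharpOption.uStar (SharpOption.domZeroInt P Y) Λ₀ k) ε
            * (SharpOption.Afac Λ₀ Λ₁ Λ₂ f c
                (SharpOption.uStar (SharpOption.domZeroInt P Y) Λ₀ k) ε + r ε) := by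
  have huU : SharpOption.uStar (SharpOption.domZeroInt P Y) Λ₀ k ∈ SharpOption.domZeroInt P Y :=
    Function.invFunOn_mem hk
  have huk : deriv Λ₀ (SharpOption.uStar (SharpOption.domZeroInt P Y) Λ₀ k) = k :=
    Function.invFunOn_eq hk
  generalize SharpOption.uStar (SharpOption.domZeroInt P Y) Λ₀ k = u at huU huk ⊢
  subst huk
  have hu0 : u ≠ 0 := by rintro rfl; exact hk0 rfl
  have huc : u ≠ c := by rintro rfl; exact hkc rfl
  rw [hΛ.legendre_eq huU]
  simp only [hΛ.lt_iff_lt_deriv huU hc hkc, hΛ.lt_iff_lt_deriv huU hΛ.zero_mem hk0]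
  have hσ := hΛ.iteratedDeriv_two_pos huU hu0
  obtain ⟨C, hC, ε₁, hε₁, hsp⟩ := hΛ.saddlepoint_integral huU hu0 huc
  obtain ⟨ε₀, hε₀, hdom, -⟩ := hΛ.smooth
  have hucpos : 0 < |u - c| := abs_pos.2 (sub_ne_zero.2 huc)
  have hid : Tendsto (fun ε : ℝ => ε) (𝓝[>] 0) (𝓝 0) := tendsto_id.mono_left nhdsWithin_le_nhds
  have hbt : Tendsto (fun ε => f ε * ε) (𝓝[>] 0) (𝓝 c) := by
    have h1 := hfc.trans_tendsto hid
    simpa using h1.add_const c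
  have hclose : ∀ᶠ ε in 𝓝[>] (0 : ℝ), |f ε * ε - c| ≤ |u - c| / 2 := by
    have h1 : Tendsto (fun ε => |f ε * ε - c|) (𝓝[>] 0) (𝓝 |c - c|) := (hbt.sub_const c).abs
    rw [sub_self, abs_zero] at h1
    exact (h1.eventually_lt_const (half_pos hucpos)).mono fun ε h => h.le
  have hbU : ∀ᶠ ε in 𝓝[>] (0 : ℝ), f ε * ε ∈ SharpOption.domZeroInt P Y :=
    hbt.eventually_mem ((SharpOption.isOpen_domZeroInt P Y).mem_nhds hc)
  have hmem0 : ∀ᶠ ε in 𝓝[>] (0 : ℝ), ε ∈ Ioo 0 ε₀ := Ioo_mem_nhdsGT hε₀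
  have hmem1 : ∀ᶠ ε in 𝓝[>] (0 : ℝ), ε ∈ Ioo 0 ε₁ := Ioo_mem_nhdsGT hε₁
  set X : ℝ → ℝ := fun ε => (∫ y : ℝ, (((u : ℂ) + y * Complex.I) *
      (((u - f ε * ε : ℝ) : ℂ) + y * Complex.I))⁻¹ * (SharpOption.cmgf P Y ε ((u : ℂ) + y * Complex.I) *
        Complex.exp (-(((u : ℂ) + y * Complex.I) * deriv Λ₀ u / ε)))).re with hX
  set E : ℝ → ℝ := fun ε => Real.exp ((Λ₀ u - u * deriv Λ₀ u) / ε) with hE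
  set m₀ : ℝ := √(2 * π / iteratedDeriv 2 Λ₀ u) with hm₀
  have hm₀pos : 0 < m₀ := Real.sqrt_pos.2 (by positivity)
  -- The saddlepoint integral divided by its leading term, minus its first-order expansion at b =
  -- f(ε)ε. The absolute error bound thus becomes a relative O(ε²).
  set q : ℝ → ℝ := fun ε => X ε * (u * (u - f ε * ε)) / (E ε * (√ε * m₀ * Real.exp (Λ₁ u))) -
    (1 + SharpOption.Upsilon Λ₀ Λ₁ Λ₂ (f ε * ε) u * ε) with hq
  have hgeom : ∀ ε, |f ε * ε - c| ≤ |u - c| / 2 → u - f ε * ε ≠ 0 := by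
    intro ε h
    have h1 : |u - c| ≤ |u - f ε * ε| + |f ε * ε - c| := by
      have := abs_add_le (u - f ε * ε) (f ε * ε - c)
      rwa [sub_add_sub_cancel] at this
    rw [← abs_pos]; linarith
  have hqO : q =O[𝓝[>] (0 : ℝ)] (fun ε => ε ^ 2) := by
    refine IsBigO.of_bound (C * (|u| * (2 * |u - c|)) / (m₀ * Real.exp (Λ₁ u))) ?_
    filter_upwards [hclose, hmem1] with ε hcl h1
    have hεpos := h1.1
    have hEpos : 0 < E ε := Real.exp_pos _
    have hs : 0 < √ε := Real.sqrt_pos.2 hεpos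
    have hne := hgeom ε hcl
    have h2 := hsp ε h1 (f ε * ε) hcl
    have h3 := (Complex.abs_re_le_norm _).trans h2
    rw [Complex.sub_re, Complex.ofReal_re] at h3
    change |X ε - E ε * (√ε * m₀ * (Real.exp (Λ₁ u) / (u * (u - f ε * ε)) *
      (1 + SharpOption.Upsilon Λ₀ Λ₁ Λ₂ (f ε * ε) u * ε)))| ≤ C * (E ε * (√ε * ε ^ 2)) at h3
    have h4 : q ε = (X ε - E ε * (√ε * m₀ * (Real.exp (Λ₁ u) / (u * (u - f ε * ε)) *
      (1 + SharpOption.Upsilon Λ₀ Λ₁ Λ₂ (f ε * ε) u * ε)))) *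
        ((u * (u - f ε * ε)) / (E ε * (√ε * m₀ * Real.exp (Λ₁ u)))) := by
      have := Real.exp_pos (Λ₁ u)
      simp only [hq]
      field_simp
    have h5 : |u - f ε * ε| ≤ 2 * |u - c| := by
      have := abs_sub_le u c (f ε * ε)
      rw [abs_sub_comm c] at this
      linarith
    rw [h4, Real.norm_eq_abs, abs_mul, abs_div, abs_mul u, abs_of_pos (show 0 < E ε * (√ε * m₀ * Real.exp (Λ₁ u)) by positivity),
      Real.norm_eq_abs, abs_of_nonneg (sq_nonneg ε)]
    calc _ ≤ (C * (E ε * (√ε * ε ^ 2))) * ((|u| * (2 * |u - c|)) / (E ε * (√ε * m₀ * Real.exp (Λ₁ u)))) := by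
          gcongr
      _ = _ := by
          have := Real.exp_pos (Λ₁ u)
          field_simp
  -- The witness is κ(1 + Υ(b)ε + q) - A_c, so A_c + r collapses and the asserted equality becomes
  -- an exact identity.
  refine ⟨_, SharpOption.isBigO_price_remainder Λ₀ Λ₁ Λ₂ hu0 huc hc0 hfc hqO, ?_⟩
  filter_upwards [hclose, hbU, hmem0, hmem1] with ε hcl hbε h0 h1
  have hεpos := h0.1
  have hbd := hdom ε h0 hbε
  have hne := hgeom ε hcl
  obtain ⟨hint, hprice⟩ := SharpOption.integral_payoff_eq P Y (k := deriv Λ₀ u) hεpos (hY ε hεpos) (hf ε hεpos) hu0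
    (fun h => hne (sub_eq_zero.2 h)) (hdom ε h0 huU) hbd
  refine ⟨hbd, hint, ?_⟩
  -- real form of the inversion formula
  have hprice' : ∫ ω, max (Real.exp (Y ε ω * f ε) - Real.exp (deriv Λ₀ u * f ε)) 0 ∂P =
      (if u < f ε * ε then ∫ ω, Real.exp (f ε * ε * Y ε ω / ε) ∂P else 0) -
        (if u < 0 then Real.exp (deriv Λ₀ u * f ε) else 0) +
      Real.exp (deriv Λ₀ u * f ε) / (2 * π) * (f ε * ε) * X ε := by
    have h2 := congrArg Complex.re hprice
    rw [Complex.ofReal_re, Complex.add_re, Complex.ofReal_re] at h2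
    rw [h2]
    congr 1
    simp only [SharpOption.payoffKernel, mul_assoc ((f ε * ε : ℝ) : ℂ)]
    rw [integral_const_mul, ← mul_assoc, hX]
    simp only
    rw [← Complex.re_ofReal_mul]
    congr 2
    push_cast
    ring
  rw [hprice']
  -- Since b is within |u-c|/2 of c, both lie on the same side of u.
  have hlt : u < f ε * ε ↔ u < c := by
    have h2 := abs_le.1 hcl
    constructor
    · intro h
      by_contra! hc'
      rw [abs_of_nonneg (by linarith)] at h2
      have : c < u := lt_of_le_of_ne hc' (Ne.symm huc)
      linarith [h2.2]
    · intro h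
      rw [abs_of_neg (by linarith)] at h2
      linarith [h2.1]
  have hexp : ∫ ω, Real.exp (f ε * ε * Y ε ω / ε) ∂P = Real.exp (SharpOption.lmgf P Y ε (f ε * ε) / ε) := by
    rw [SharpOption.lmgf, mul_div_cancel_left₀ _ hεpos.ne', Real.exp_log (SharpOption.integral_exp_pos_of_mem_dom P hbd)]
  simp only [hlt, hexp]
  congr 1
  have hs : 0 < √ε := Real.sqrt_pos.2 hεpos
  have hEpos : 0 < E ε := Real.exp_pos _
  have hXq : X ε = E ε * (√ε * m₀ * Real.exp (Λ₁ u)) / (u * (u - f ε * ε)) *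
      (1 + SharpOption.Upsilon Λ₀ Λ₁ Λ₂ (f ε * ε) u * ε + q ε) := by
    have := Real.exp_pos (Λ₁ u)
    simp only [hq]
    field_simp
    ring
  have hEexp : Real.exp (-(u * deriv Λ₀ u - Λ₀ u) / ε + deriv Λ₀ u * f ε + Λ₁ u) =
      E ε * Real.exp (deriv Λ₀ u * f ε) * Real.exp (Λ₁ u) := by
    rw [hE, ← Real.exp_add, ← Real.exp_add]
    congr 1; ring
  have hm₀2 : m₀ / (2 * π) = (√(2 * π * iteratedDeriv 2 Λ₀ u))⁻¹ := by
    have h2 : 0 < √(2 * π * iteratedDeriv 2 Λ₀ u) := Real.sqrt_pos.2 (by positivity)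
    have h3 : m₀ * √(2 * π * iteratedDeriv 2 Λ₀ u) = 2 * π := by
      rw [hm₀, ← Real.sqrt_mul (by positivity)]
      rw [show 2 * π / iteratedDeriv 2 Λ₀ u * (2 * π * iteratedDeriv 2 Λ₀ u) = (2 * π) ^ 2 by field_simp]
      exact Real.sqrt_sq (by positivity)
    have : (0 : ℝ) < 2 * π := by positivity
    rw [div_eq_iff this.ne', eq_comm, inv_mul_eq_div, div_eq_iff h2.ne']
    exact h3.symm
  -- This exposes the factor b in the c = 0 branch of Ā, where it cancels against the kernel's
  -- numerator without requiring f(ε) ≠ 0.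
  have hpow : ε ^ (3 / 2 : ℝ) * f ε = √ε * (f ε * ε) := by
    rw [show (3 / 2 : ℝ) = 1 / 2 + 1 by norm_num, Real.rpow_add_one hεpos.ne', Real.sqrt_eq_rpow]
    ring
  have hAf : SharpOption.Afac Λ₀ Λ₁ Λ₂ f c u ε = 1 + SharpOption.Upsilon Λ₀ Λ₁ Λ₂ c u * ε +
      (if 0 < c then u * (f ε * ε - c) / ((u - c) * c) else 0) + (if c = 0 then f ε * ε / u else 0) := by
    rw [SharpOption.Afac, mul_comm ε (f ε)]
  rw [hAf, add_sub_cancel, SharpOption.Abar, hpow, hEexp, hXq]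
  generalize 1 + SharpOption.Upsilon Λ₀ Λ₁ Λ₂ (f ε * ε) u * ε + q ε = Z
  have huc' : u - c ≠ 0 := sub_ne_zero.2 huc
  have hstep : Real.exp (deriv Λ₀ u * f ε) / (2 * π) * (f ε * ε) *
      (E ε * (√ε * m₀ * Real.exp (Λ₁ u)) / (u * (u - f ε * ε)) * Z) =
      E ε * Real.exp (deriv Λ₀ u * f ε) * Real.exp (Λ₁ u) * √ε * Z * (m₀ / (2 * π)) *
        ((f ε * ε) / (u * (u - f ε * ε))) := by
    field_simp
  rw [hstep, hm₀2]
  rcases hc0.lt_or_eq with h | h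
  · simp only [if_pos h, if_neg h.ne', add_zero]
    have := h.ne'
    field_simp
  · simp only [← h, lt_irrefl, if_false, if_true, zero_add, sub_zero]
    field_simp
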